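/- **Theorem (Online Bernstein–von Mises).** *Setting.* Let $p\ge 1$, $\Theta=\mathbb R^p$, $\mathrm x>0$, $r>0$. For $t\ge1$ let $p_{t,\theta}$, $\theta\in\Theta$, be probability densities with respect to a $\sigma$-finite measure, and let $Y_1,Y_2,\dots$ be observations such that for some $\theta_\star\in\Theta$ and every $t$ the vector $(Y_1,\dots,Y_t)$ has density $\prod_{s\le t}p_{s,\theta_\star}(y_s)$. Put $\ell_t(\theta)=-\log p_{t,\theta}(Y_t)$, $L_{1:t}=\sum_{s\le t}\ell_s$, $\mathbf F_{t,\theta}=\sum_{s\le t}\nabla^2\ell_s(\theta)$, $\Theta_r=\{\theta:\|\theta-\theta_\star\|_2\le r\}$. Let $\theta_0\in\Theta$, let $\mathbf\Omega_0$ be a non-random symmetric positive definite matrix, $\Pi_0=N(\theta_0,\mathbf\Omega_0^{-1})$ the prior, $\Pi(\cdot\mid \mathbf D_{1:t})\propto e^{-L_{1:t}}\,d\Pi_0$ the full posterior, $\hat\theta^{\rm ML}_t\in\arg\min_\theta L_{1:t}(\theta)$ and $\hat\theta^{\rm MAP}_t\in\arg\min_\theta\{L_{1:t}(\theta)+\frac12\|\mathbf\Omega_0^{1/2}(\theta-\theta_0)\|_2^2\}$.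 For $t_0\in\mathbb N$, the one-pass algorithm is: for $t\le t_0$, $\theta_t=\hat\theta_t^{\rm MAP}$ and $\mathbf\Omega_t=\mathbf\Omega_0+\sum_{s\le t}\nabla^2\ell_s(\hat\theta_t^{\rm MAP})$; for $t>t_0$, $\mathbf\Omega_t=\mathbf\Omega_{t-1}+\nabla^2\ell_t(\theta_{t-1})$ and $\theta_t=\theta_{t-1}-\mathbf\Omega_t^{-1}g_t$ with $g_t=\nabla\ell_t(\theta_{t-1})$. Put $\Pi_t=N(\theta_t,\mathbf\Omega_t^{-1})$, $Q_{{\rm BvM},t}=N(\hat\theta_t^{\rm ML},\mathbf F_{t,\theta_\star}^{-1})$, $t_{\rm exit}=\inf\{t>t_0:\theta_t\notin\Theta_r\}$ (with $\inf\emptyset=\infty$), and let $d_V(P,Q)=\sup_A|P(A)-Q(A)|$ be the total variation distance. *Assumptions.* Below $C,K_0>0$ are universal constants; $K_1,K_2,K_3,K_4,K_6,L_2,L_3>0$ and $K_5,L_1\ge0$ are constants; $\preceq$ is the Loewner order; $\|\cdot\|_2$ of a matrix is the spectral norm; and $\mathscr E_1,\dots,\mathscr E_4$ are events, each of probability at least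 $1-e^{-\mathrm x}$. - (A0) Every $\ell_t$ is real-valued and twice differentiable; for every $t\ge 1$, $\theta_\star$ is the unique minimizer of $\theta\mapsto\mathbb E\,\ell_t(\theta)$; and $0<\underline\lambda_0\le\lambda_{\min}(\mathbf\Omega_0)\le\lambda_{\max}(\mathbf\Omega_0)\le\overline\lambda_0\le K_0$. - (A1) On $\mathscr E_1$, for all $t\ge K_1(p+\mathrm x)$: $\ \lambda_{\min}\big(\sum_{s\le t}\nabla^2\ell_s(\bar\theta_s)\big)\ge K_2t$ for all $\bar\theta_1,\dots,\bar\theta_t\in\Theta_r$. - (A2) For all $t\ge1$ and $\theta,\theta'\in\Theta_r$ there are $0\le\phi\le L_1\|\theta-\theta'\|_2$ and $\tilde\theta$ on the segment between $\theta$ and $\theta'$ with $\nabla^2\ell_t(\theta)\preceq(1+\phi)\nabla^2\ell_t(\tilde\theta)$ and $\ell_t(\theta)=\ell_t(\theta')+\langle\nabla\ell_t(\theta'),\theta-\theta'\rangle+\frac12\langle\theta-\theta',\nabla^2\ell_t(\tilde\theta)(\theta-\theta')\rangle$. Moreover $\|\nabla^2\ell_t(\theta)\|_2\le L_2$ for all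 $t\ge1$ and $\theta\in\Theta_r$. - (A3) For all $t\ge1$: $\|\nabla^2\ell_t(\theta)-\nabla^2\ell_t(\theta')\|_2\le L_3\|\theta-\theta'\|_2$ for $\theta,\theta'\in\Theta_r$, and $(1+e^{K_6\|h\|_2})^{-1}\mathbf F_{t,\theta}\preceq\mathbf F_{t,\theta+h}\preceq(1+e^{K_6\|h\|_2})\mathbf F_{t,\theta}$ for $\theta,\theta+h\in\Theta_r$. - (A4) $t_0\ge K_1(p+\mathrm x)$. On $\mathscr E_2$, $\sum_{s=t_0+1}^t\{\ell_s(\theta_\star)-\ell_s(\theta_{s-1})\}\le K_3\mathrm x$ for all $t>t_0$. On $\mathscr E_3$, $\sum_{s=t_0+1}^t\langle g_s,\mathbf\Omega_s^{-1}g_s\rangle\le K_4p\log t+K_5(\mathrm x+\log t)$ for all $t_0<t\le t_{\rm exit}$. - (A5) with constant $M$: $t_0\ge\lceil M(p\log(p\vee3)+\mathrm x)\rceil$, and on $\mathscr E_4$: $\hat\theta_t^{\rm MAP}$ and $\hat\theta_t^{\rm ML}$ exist for all $t\ge t_0$, $\|\mathbf\Omega_{t_0}^{1/2}(\hat\theta^{\rm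 MAP}_{t_0}-\theta_\star)\|_2\le C(p+\mathrm x)$, and $\|\hat\theta_t^{\rm MAP}-\theta_\star\|_2\vee\|\hat\theta_t^{\rm ML}-\theta_\star\|_2\le C\sqrt{(p+\log t+\mathrm x)/t}$ for all $t\ge t_0$. *Conclusion.* Given the universal constants, there are positive constants $M=M(K_1,\dots,K_5,L_1,L_2,r)$, $M_2=M_2(K_6,L_3,\overline\lambda_0)$ and, for every $B>0$, $K=K(K_1,\dots,K_5,L_1,L_2,L_3,\overline\lambda_0,r,B)$ such that the following holds. If (A0)–(A5) hold, with this $M$ in (A5), then on $\mathscr E_1\cap\mathscr E_2\cap\mathscr E_3\cap\mathscr E_4$, for every $t\in\mathbb N$ with $t>M_2t_0$ and $t_0\le B(p\log t+\mathrm x)$, the matrices $\mathbf\Omega_t$ and $\mathbf F_{t,\theta_\star}$ are positive definite, the full posterior is a probability measure, and $$d_V\big(Q_{{\rm BvM},t},\Pi_t\big)\le K\,\epsilon_{{\rm app},t},\qquad d_V\big(\Pi_t,\Pi(\cdot\mid\mathbf D_{1:t})\big)\le K\,\epsilon_{{\rm app},t}+d_V\big(Q_{{\rm BvM},t},\Pi(\cdot\mid\mathbf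 D_{1:t})\big),$$ where $\epsilon_{{\rm app},t}=\sqrt{\log^2(t/t_0)\,(p\log t+\mathrm x)^2/t}$. (For $t_0=\lceil M(p\log(p\vee3)+\mathrm x)\rceil$ the condition $t_0\le B(p\log t+\mathrm x)$ holds for all $t>M_2t_0$ with a $B$ that depends on $M$ only, because $M_2$ may be taken at least $3$. Then $K$ depends on $K_1,\dots,K_5,L_1,L_2,L_3,\overline\lambda_0,r$ only.) -/

import Mathlib

open MeasureTheory ProbabilityTheory
open scoped Gradient

namespace OnlineBvM

/-! ### Linear algebra on the parameter space `ℝ^p` -/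

/-- The parameter space `Θ = ℝ^p`, with the Euclidean norm. -/
abbrev Param (p : ℕ) : Type := EuclideanSpace ℝ (Fin p)

/-- Real `p × p` matrices. -/
abbrev Mat (p : ℕ) : Type := Matrix (Fin p) (Fin p) ℝ

/-- The vector `A v`. -/
noncomputable def mulVec {p : ℕ} (A : Mat p) (v : Param p) : Param p :=
  WithLp.toLp 2 (A.mulVec v.ofLp)

/-- The quadratic form `⟨A, v ⊗ v⟩ = ⟨v, A v⟩`; it equals `‖A^{1/2} v‖₂²` when `A` is positive
semi-definite. -/
noncomputable def quad {p : ℕ} (A : Mat p) (v : Param p) : ℝ :=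
  inner ℝ v (mulVec A v)

/-- The Loewner order `A ≼ B`. -/
def Loewner {p : ℕ} (A B : Mat p) : Prop := (B - A).PosSemidef

/-- The spectral norm `‖A‖₂`, the largest singular value. -/
noncomputable def specNorm {p : ℕ} (A : Mat p) : ℝ :=
  ‖Matrix.toEuclideanCLM (n := Fin p) (𝕜 := ℝ) A‖

/-- The Hessian matrix `∇² f(θ)`, with entries `∂²f / ∂θ_i ∂θ_j`. -/
noncomputable def hess {p : ℕ} (f : Param p → ℝ) (θ : Param p) : Mat p :=
  Matrix.of fun i j =>
    fderiv ℝ (fun θ' => fderiv ℝ f θ' (EuclideanSpace.single j 1)) θ (EuclideanSpace.single i 1)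

/-- `θ` is a global minimizer of `f`. -/
def IsArgmin {p : ℕ} (f : Param p → ℝ) (θ : Param p) : Prop := ∀ θ', f θ ≤ f θ'

/-- A global minimizer of `f` (an arbitrary point if there is none). -/
noncomputable def argmin {p : ℕ} (f : Param p → ℝ) : Param p := Classical.epsilon (IsArgmin f)

/-! ### The statistical model -/

/-- Probability densities `p_{t,θ}` of the observations `Y_t`, with respect to σ-finite
dominating measures. -/
structure Model (p : ℕ) (𝒴 : Type*) [MeasurableSpace 𝒴] where
  /-- the dominating measures -/
  ref : ℕ → Measure 𝒴
  /-- the densities -/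
  dens : ℕ → Param p → 𝒴 → ℝ
  sigmaFinite_ref : ∀ t, SigmaFinite (ref t)
  measurable_dens : ∀ t θ, Measurable (dens t θ)
  dens_nonneg : ∀ t θ y, 0 ≤ dens t θ y
  lintegral_dens : ∀ t θ, ∫⁻ y, ENNReal.ofReal (dens t θ y) ∂(ref t) = 1

/-- The negative log-likelihoods `ℓ_t(θ) = - log p_{t,θ}(Y_t)` along the data sequence `y`. -/
noncomputable def Model.loss {p : ℕ} {𝒴 : Type*} [MeasurableSpace 𝒴] (m : Model p 𝒴)
    (y : ℕ → 𝒴) (t : ℕ) (θ : Param p) : ℝ :=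
  -Real.log (m.dens t θ (y t))

/-- Correct specification: for every `t`, the vector `(Y_1, …, Y_t)` has the product density
`(y_1, …, y_t) ↦ ∏_{s ≤ t} p_{s,θ⋆}(y_s)`. (Observations are indexed by `1, 2, …`; the index `0`
is not used.) -/
def Model.CorrectlySpecified {p : ℕ} {𝒴 : Type*} [MeasurableSpace 𝒴] (m : Model p 𝒴)
    {S : Type*} [MeasurableSpace S] (P : Measure S) (Y : ℕ → S → 𝒴) (θstar : Param p) : Prop :=
  (∀ t, Measurable (Y t)) ∧
  ∀ t : ℕ,
    P.map (fun ω (s : Fin t) => Y (s + 1) ω) =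
      (Measure.pi fun s : Fin t => m.ref (s + 1)).withDensity
        (fun y => ∏ s : Fin t, ENNReal.ofReal (m.dens (s + 1) θstar (y s)))

/-- The loss sequence `(ℓ_t)_t` at the sample point `ω`. -/
noncomputable def Model.lossAt {p : ℕ} {𝒴 : Type*} [MeasurableSpace 𝒴] (m : Model p 𝒴)
    {S : Type*} (Y : ℕ → S → 𝒴) (ω : S) : ℕ → Param p → ℝ :=
  m.loss (fun t => Y t ω)

/-! ### Estimators, the one-pass algorithm and the posteriors, for a loss sequence `ℓ` -/

/-- The batch loss `L_{1:t}(θ) = ∑_{s=1}^t ℓ_s(θ)`. -/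
noncomputable def batchLoss {p : ℕ} (ℓ : ℕ → Param p → ℝ) (t : ℕ) (θ : Param p) : ℝ :=
  ∑ s ∈ Finset.Icc 1 t, ℓ s θ

/-- `F_{t,θ} = ∑_{s=1}^t ∇² ℓ_s(θ)`. -/
noncomputable def fisher {p : ℕ} (ℓ : ℕ → Param p → ℝ) (t : ℕ) (θ : Param p) : Mat p :=
  ∑ s ∈ Finset.Icc 1 t, hess (ℓ s) θ

/-- The maximum likelihood estimator. -/
noncomputable def mle {p : ℕ} (ℓ : ℕ → Param p → ℝ) (t : ℕ) : Param p :=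
  argmin (batchLoss ℓ t)

/-- The penalized batch loss `L_{1:t}(θ) + ‖Ω₀^{1/2}(θ - θ₀)‖₂² / 2`. -/
noncomputable def mapLoss {p : ℕ} (ℓ : ℕ → Param p → ℝ) (θ₀ : Param p) (Ω₀ : Mat p) (t : ℕ)
    (θ : Param p) : ℝ :=
  batchLoss ℓ t θ + 1 / 2 * quad Ω₀ (θ - θ₀)

/-- The batch maximum a posteriori estimator for the prior `N(θ₀, Ω₀⁻¹)`. -/
noncomputable def mapEst {p : ℕ} (ℓ : ℕ → Param p → ℝ) (θ₀ : Param p) (Ω₀ : Mat p) (t : ℕ) :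
    Param p :=
  argmin (mapLoss ℓ θ₀ Ω₀ t)

/-- The online one-pass algorithm, `t ↦ (θ_t, Ω_t)`: batch updates up to the phase transition time
`t₀`, and then `Ω_t = Ω_{t-1} + H_t`, `θ_t = θ_{t-1} - Ω_t⁻¹ g_t` with `g_t = ∇ ℓ_t(θ_{t-1})` and
`H_t = ∇² ℓ_t(θ_{t-1})`. -/
noncomputable def alg {p : ℕ} (ℓ : ℕ → Param p → ℝ) (θ₀ : Param p) (Ω₀ : Mat p) (t₀ : ℕ) :
    ℕ → Param p × Mat p
  | 0 => (θ₀, Ω₀)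
  | t + 1 =>
    if t + 1 ≤ t₀ then
      (mapEst ℓ θ₀ Ω₀ (t + 1), Ω₀ + fisher ℓ (t + 1) (mapEst ℓ θ₀ Ω₀ (t + 1)))
    else
      let θ := (alg ℓ θ₀ Ω₀ t₀ t).1
      let Ω := (alg ℓ θ₀ Ω₀ t₀ t).2 + hess (ℓ (t + 1)) θ
      (θ - mulVec Ω⁻¹ (∇ (ℓ (t + 1)) θ), Ω)

/-- The iterate `θ_t`. -/
noncomputable def algθ {p : ℕ} (ℓ : ℕ → Param p → ℝ) (θ₀ : Param p) (Ω₀ : Mat p) (t₀ t : ℕ) :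
    Param p :=
  (alg ℓ θ₀ Ω₀ t₀ t).1

/-- The precision matrix `Ω_t`. -/
noncomputable def algΩ {p : ℕ} (ℓ : ℕ → Param p → ℝ) (θ₀ : Param p) (Ω₀ : Mat p) (t₀ t : ℕ) :
    Mat p :=
  (alg ℓ θ₀ Ω₀ t₀ t).2

/-- The gradient `g_t = ∇ ℓ_t(θ_{t-1})`, for `t ≥ 1`. -/
noncomputable def algGrad {p : ℕ} (ℓ : ℕ → Param p → ℝ) (θ₀ : Param p) (Ω₀ : Mat p) (t₀ t : ℕ) :
    Param p :=
  ∇ (ℓ t) (algθ ℓ θ₀ Ω₀ t₀ (t - 1))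

/-- The local neighbourhood `Θ_r` of `θ⋆`. -/
def localSet {p : ℕ} (θstar : Param p) (r : ℝ) : Set (Param p) := {θ | ‖θ - θstar‖ ≤ r}

/-- The exit time `inf {t : t > t₀, θ_t ∉ Θ_r}`, equal to `∞` if the iterates never leave `Θ_r`. -/
noncomputable def exitTime {p : ℕ} (ℓ : ℕ → Param p → ℝ) (θ₀ : Param p) (Ω₀ : Mat p) (t₀ : ℕ)
    (θstar : Param p) (r : ℝ) : ℕ∞ :=
  sInf {n : ℕ∞ | ∃ s : ℕ, n = (s : ℕ∞) ∧ t₀ < s ∧ algθ ℓ θ₀ Ω₀ t₀ s ∉ localSet θstar r}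

/-- The one-pass posterior `Π_t = N(θ_t, Ω_t⁻¹)`. -/
noncomputable def onePassPosterior {p : ℕ} (ℓ : ℕ → Param p → ℝ) (θ₀ : Param p) (Ω₀ : Mat p)
    (t₀ t : ℕ) : Measure (Param p) :=
  multivariateGaussian (algθ ℓ θ₀ Ω₀ t₀ t) (algΩ ℓ θ₀ Ω₀ t₀ t)⁻¹

/-- The Gaussian approximation `Q_{BvM,t} = N(θ̂_t^{ML}, F_{t,θ⋆}⁻¹)`. -/
noncomputable def bvmGaussian {p : ℕ} (ℓ : ℕ → Param p → ℝ) (θstar : Param p) (t : ℕ) :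
    Measure (Param p) :=
  multivariateGaussian (mle ℓ t) (fisher ℓ t θstar)⁻¹

/-- The unnormalized full posterior, with density `exp (- L_{1:t})` with respect to the prior
`Π₀ = N(θ₀, Ω₀⁻¹)`. -/
noncomputable def unnormalizedPosterior {p : ℕ} (ℓ : ℕ → Param p → ℝ) (θ₀ : Param p) (Ω₀ : Mat p)
    (t : ℕ) : Measure (Param p) :=
  (multivariateGaussian θ₀ Ω₀⁻¹).withDensity
    (fun θ => ENNReal.ofReal (Real.exp (-batchLoss ℓ t θ)))

/-- The full posterior `Π(· ∣ D_{1:t})` given the first `t` observations. -/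
noncomputable def fullPosterior {p : ℕ} (ℓ : ℕ → Param p → ℝ) (θ₀ : Param p) (Ω₀ : Mat p)
    (t : ℕ) : Measure (Param p) :=
  (unnormalizedPosterior ℓ θ₀ Ω₀ t Set.univ)⁻¹ • unnormalizedPosterior ℓ θ₀ Ω₀ t

/-- The total variation distance `sup_A |P(A) - Q(A)|` over measurable sets `A`. -/
noncomputable def tvDist {α : Type*} [MeasurableSpace α] (P Q : Measure α) : ℝ :=
  ⨆ A : {A : Set α // MeasurableSet A}, |P.real A.1 - Q.real A.1|

/-- The approximation rate `ε_{app,t} = √(log²(t/t₀) (p log t + x)² / t)`. -/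
noncomputable def epsApp (t₀ p : ℕ) (x : ℝ) (t : ℕ) : ℝ :=
  Real.sqrt (Real.log ((t : ℝ) / t₀) ^ 2 * ((p : ℝ) * Real.log t + x) ^ 2 / t)

/-! ### The assumptions -/

/-- `E` is an event of probability at least `1 - e^{-x}`. -/
def HighProb {S : Type*} [MeasurableSpace S] (P : Measure S) (x : ℝ) (E : Set S) : Prop :=
  MeasurableSet E ∧ 1 - Real.exp (-x) ≤ P.real E

/-- Basic setup: the losses are finite and twice differentiable, `θ⋆` is the unique minimizer of
`θ ↦ E ℓ_t(θ) ∈ (-∞, ∞]`, and the initial precision has its eigenvalues in `[lamLow, lamHigh]`,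
with `lamHigh` at most the universal constant `K₀`. -/
structure A0 {p : ℕ} {𝒴 : Type*} [MeasurableSpace 𝒴] (m : Model p 𝒴) {S : Type*}
    [MeasurableSpace S] (P : Measure S) (Y : ℕ → S → 𝒴) (θstar : Param p) (Ω₀ : Mat p)
    (lamLow lamHigh K₀ : ℝ) : Prop where
  dens_pos : ∀ ω, ∀ t, 1 ≤ t → ∀ θ, 0 < m.dens t θ (Y t ω)
  differentiable : ∀ ω, ∀ t, 1 ≤ t → Differentiable ℝ (m.lossAt Y ω t)
  differentiable_fderiv : ∀ ω, ∀ t, 1 ≤ t → Differentiable ℝ (fderiv ℝ (m.lossAt Y ω t))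
  integrable_star : ∀ t, 1 ≤ t → Integrable (fun ω => m.lossAt Y ω t θstar) P
  /-- `E ℓ_t(θ)` is well defined in `(-∞, ∞]` -/
  integrable_negPart : ∀ t, 1 ≤ t → ∀ θ, Integrable (fun ω => max (-m.lossAt Y ω t θ) 0) P
  /-- `E ℓ_t(θ⋆) < E ℓ_t(θ)`, the right-hand side being `∞` if `ℓ_t(θ)` is not integrable -/
  unique_min : ∀ t, 1 ≤ t → ∀ θ, θ ≠ θstar → Integrable (fun ω => m.lossAt Y ω t θ) P →
    ∫ ω, m.lossAt Y ω t θstar ∂P < ∫ ω, m.lossAt Y ω t θ ∂P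
  lamLow_pos : 0 < lamLow
  lamLow_le : lamLow ≤ lamHigh
  lower : Loewner (lamLow • (1 : Mat p)) Ω₀
  upper : Loewner Ω₀ (lamHigh • (1 : Mat p))
  lamHigh_le : lamHigh ≤ K₀

/-- Uniform lower bound for the information on `Θ_r`:
`inf_{θ̄_1, …, θ̄_t ∈ Θ_r} λ_min (∑_{s ≤ t} ∇² ℓ_s(θ̄_s)) ≥ K₂ t` for all `t ≥ K₁ (p + x)`, on `E₁`. -/
structure A1 {p : ℕ} {S : Type*} [MeasurableSpace S] (P : Measure S)
    (ℓ : S → ℕ → Param p → ℝ) (θstar : Param p) (r x K₁ K₂ : ℝ) (E₁ : Set S) : Prop where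
  event : HighProb P x E₁
  lower : ∀ ω ∈ E₁, ∀ t : ℕ, 1 ≤ t → K₁ * (p + x) ≤ t →
    ∀ θbar : ℕ → Param p, (∀ s ∈ Finset.Icc 1 t, θbar s ∈ localSet θstar r) →
      Loewner ((K₂ * t) • (1 : Mat p)) (∑ s ∈ Finset.Icc 1 t, hess (ℓ ω s) (θbar s))

/-- Relative smoothness along Taylor points, and boundedness of the Hessians on `Θ_r`. -/
structure A2 {p : ℕ} {S : Type*} (ℓ : S → ℕ → Param p → ℝ) (θstar : Param p)
    (r L₁ L₂ : ℝ) : Prop where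
  taylor : ∀ ω, ∀ t, 1 ≤ t → ∀ θ ∈ localSet θstar r, ∀ θ' ∈ localSet θstar r,
    ∃ φ : ℝ, 0 ≤ φ ∧ φ ≤ L₁ * ‖θ - θ'‖ ∧
      ∃ θt ∈ segment ℝ θ θ',
        Loewner (hess (ℓ ω t) θ) ((1 + φ) • hess (ℓ ω t) θt) ∧
        ℓ ω t θ = ℓ ω t θ' + inner ℝ (∇ (ℓ ω t) θ') (θ - θ')
          + 1 / 2 * quad (hess (ℓ ω t) θt) (θ - θ')
  bounded : ∀ ω, ∀ t, 1 ≤ t → ∀ θ ∈ localSet θstar r, specNorm (hess (ℓ ω t) θ) ≤ L₂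

/-- Smoothness of the Hessians on `Θ_r`. -/
structure A3 {p : ℕ} {S : Type*} (ℓ : S → ℕ → Param p → ℝ) (θstar : Param p)
    (r L₃ K₆ : ℝ) : Prop where
  lipschitz : ∀ ω, ∀ t, 1 ≤ t → ∀ θ ∈ localSet θstar r, ∀ θ' ∈ localSet θstar r,
    specNorm (hess (ℓ ω t) θ - hess (ℓ ω t) θ') ≤ L₃ * ‖θ - θ'‖
  fisher : ∀ ω, ∀ t, 1 ≤ t → ∀ θ h : Param p, θ ∈ localSet θstar r → θ + h ∈ localSet θstar r →
    Loewner ((1 + Real.exp (K₆ * ‖h‖))⁻¹ • fisher (ℓ ω) t θ) (fisher (ℓ ω) t (θ + h)) ∧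
    Loewner (fisher (ℓ ω) t (θ + h)) ((1 + Real.exp (K₆ * ‖h‖)) • fisher (ℓ ω) t θ)

/-- Fluctuation control along the online updates. -/
structure A4 {p : ℕ} {S : Type*} [MeasurableSpace S] (P : Measure S)
    (ℓ : S → ℕ → Param p → ℝ) (θstar θ₀ : Param p) (Ω₀ : Mat p) (t₀ : ℕ)
    (r x K₁ K₃ K₄ K₅ : ℝ) (E₂ E₃ : Set S) : Prop where
  le_t₀ : K₁ * (p + x) ≤ t₀
  event₂ : HighProb P x E₂
  event₃ : HighProb P x E₃
  regret : ∀ ω ∈ E₂, ∀ t : ℕ, t₀ < t →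
    ∑ s ∈ Finset.Icc (t₀ + 1) t, (ℓ ω s θstar - ℓ ω s (algθ (ℓ ω) θ₀ Ω₀ t₀ (s - 1))) ≤ K₃ * x
  grad : ∀ ω ∈ E₃, ∀ t : ℕ, t₀ < t → (t : ℕ∞) ≤ exitTime (ℓ ω) θ₀ Ω₀ t₀ θstar r →
    ∑ s ∈ Finset.Icc (t₀ + 1) t, quad (algΩ (ℓ ω) θ₀ Ω₀ t₀ s)⁻¹ (algGrad (ℓ ω) θ₀ Ω₀ t₀ s)
      ≤ K₄ * p * Real.log t + K₅ * (x + Real.log t)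

/-- Warm-start phase: `t₀` is at least `⌈M (p log (p ∨ 3) + x)⌉`, and on `E₄` the batch estimators
exist from time `t₀` on and converge at the parametric rate, with a universal constant `C`. -/
structure A5 {p : ℕ} {S : Type*} [MeasurableSpace S] (P : Measure S)
    (ℓ : S → ℕ → Param p → ℝ) (θstar θ₀ : Param p) (Ω₀ : Mat p) (t₀ : ℕ)
    (x M C : ℝ) (E₄ : Set S) : Prop where
  le_t₀ : ⌈M * (p * Real.log (max (p : ℝ) 3) + x)⌉ ≤ (t₀ : ℤ)
  event : HighProb P x E₄
  exists_map : ∀ ω ∈ E₄, ∀ t : ℕ, t₀ ≤ t → ∃ θ, IsArgmin (mapLoss (ℓ ω) θ₀ Ω₀ t) θ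
  exists_mle : ∀ ω ∈ E₄, ∀ t : ℕ, t₀ ≤ t → ∃ θ, IsArgmin (batchLoss (ℓ ω) t) θ
  warm : ∀ ω ∈ E₄,
    Real.sqrt (quad (algΩ (ℓ ω) θ₀ Ω₀ t₀ t₀) (mapEst (ℓ ω) θ₀ Ω₀ t₀ - θstar)) ≤ C * (p + x)
  rate : ∀ ω ∈ E₄, ∀ t : ℕ, t₀ ≤ t →
    max ‖mapEst (ℓ ω) θ₀ Ω₀ t - θstar‖ ‖mle (ℓ ω) t - θstar‖
      ≤ C * Real.sqrt ((p + Real.log t + x) / t)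

end OnlineBvM

/-! On the four events the argument is deterministic. Write `G_t = p log t + x` (`growth`).

Localization. The online Newton step changes the energy `‖Ω_t^{1/2}(θ_t - θ⋆)‖²` by `⟨e, H e⟩ - 2⟨g,
e⟩ + ⟨g, Ω⁻¹ g⟩`, where `e` is the error of the previous iterate. Taylor's formula bounds the first
two terms by twice the loss difference `ℓ(θ⋆) - ℓ(θ)` plus a cubic error
(`quad_hess_sub_inner_gradient_le`). After summation the loss differences and gradient terms are
`O(G_t)` by (A4), and so is the energy of the warm start. Since `Ω_t ≽ K₂ t`, an energy `O(G_s)`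
means `‖θ_s - θ⋆‖² = O(G_s / s)`, and the sum of the cubes is then a small multiple of `G_t` when
`G_{t₀} / t₀` is small, which is what `M` arranges. The induction closes and the iterates never
leave `Θ_r` (`PathBounds.localization`). As `M` may not depend on `L₃`, the cubic constant has to
come from `L₁` and `L₂` alone; this is `quad_hess_sub_le_of_taylor`, where the Lipschitz constant
improves itself.

Closeness to the BvM Gaussian. The Lipschitz bound on the Hessians and the rate give `‖F_t - Ω_t‖ ≲
√(G_t t)`, a relative error `√(G_t / t)`. For the means, the recursion telescopes exactly: `Ω_t (θ_t
- y)` is the prior drift `Ω₀ (θ₀ - y)` plus one Newton residual per loss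
(`PathBounds.mulVec_algΩ_sub`). At `y` the maximum likelihood estimator the gradients sum to zero,
the residuals become Taylor remainders, and these sum to `O(log(t/t₀) G_t)` because `∑ 1/s` is
logarithmic. The drift is `O(G_t)` by comparing MAP and ML at time `t₀`, using `t₀ ≤ B G_t`.

Gaussian comparison. Total variation is at most the root of the chi-square divergence, which
factorizes after simultaneous diagonalization of the two precisions
(`tvDist_multivariateGaussian_le`). The bound on the full posterior is then the triangle inequality.
-/

namespace OnlineBvM

/-! ### Total variation distance and chi-square divergence. -/

section TotalVariation

variable {α β : Type*} [MeasurableSpace α] [MeasurableSpace β]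

lemma tvDist_le_of_forall {P Q : Measure α} {c : ℝ}
    (h : ∀ A, MeasurableSet A → |P.real A - Q.real A| ≤ c) : tvDist P Q ≤ c := by
  have : Nonempty {A : Set α // MeasurableSet A} := ⟨⟨∅, MeasurableSet.empty⟩⟩
  exact ciSup_le fun A => h A.1 A.2

lemma abs_measureReal_sub_le_one (P Q : Measure α) [IsProbabilityMeasure P]
    [IsProbabilityMeasure Q] (A : Set α) : |P.real A - Q.real A| ≤ 1 := by
  have h₁ : P.real A ≤ 1 := measureReal_le_one
  have h₂ : Q.real A ≤ 1 := measureReal_le_one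
  have h₃ : 0 ≤ P.real A := measureReal_nonneg
  have h₄ : 0 ≤ Q.real A := measureReal_nonneg
  exact abs_sub_le_iff.2 ⟨by linarith, by linarith⟩

lemma abs_measureReal_sub_le_tvDist (P Q : Measure α) [IsProbabilityMeasure P]
    [IsProbabilityMeasure Q] {A : Set α} (hA : MeasurableSet A) :
    |P.real A - Q.real A| ≤ tvDist P Q :=
  le_ciSup (f := fun A : {A : Set α // MeasurableSet A} => |P.real A.1 - Q.real A.1|)
    ⟨1, by rintro _ ⟨B, rfl⟩; exact abs_measureReal_sub_le_one P Q B.1⟩ ⟨A, hA⟩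

lemma tvDist_le_one (P Q : Measure α) [IsProbabilityMeasure P] [IsProbabilityMeasure Q] :
    tvDist P Q ≤ 1 :=
  tvDist_le_of_forall fun A _ => abs_measureReal_sub_le_one P Q A

lemma tvDist_comm (P Q : Measure α) : tvDist P Q = tvDist Q P := by
  simp only [tvDist, abs_sub_comm]

lemma tvDist_triangle (P Q R : Measure α) [IsProbabilityMeasure P] [IsProbabilityMeasure Q]
    [IsProbabilityMeasure R] : tvDist P R ≤ tvDist P Q + tvDist Q R :=
  tvDist_le_of_forall fun A hA =>
    (abs_sub_le _ (Q.real A) _).trans (add_le_add (abs_measureReal_sub_le_tvDist P Q hA)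
      (abs_measureReal_sub_le_tvDist Q R hA))

lemma tvDist_map_le (P Q : Measure α) [IsProbabilityMeasure P] [IsProbabilityMeasure Q]
    {f : α → β} (hf : Measurable f) : tvDist (P.map f) (Q.map f) ≤ tvDist P Q :=
  tvDist_le_of_forall fun A hA => by
    rw [map_measureReal_apply hf hA, map_measureReal_apply hf hA]
    exact abs_measureReal_sub_le_tvDist P Q (hf hA)

/-- Total variation is bounded by the square root of the chi-square divergence. -/
lemma tvDist_withDensity_le (P : Measure α) [IsProbabilityMeasure P] {ρ : α → ℝ}
    (hρ : Measurable ρ) (hρ0 : ∀ a, 0 ≤ ρ a) (hint : Integrable ρ P) (hone : ∫ a, ρ a ∂P = 1)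
    (hsq : Integrable (fun a => ρ a ^ 2) P) :
    tvDist P (P.withDensity fun a => ENNReal.ofReal (ρ a)) ≤ √(∫ a, ρ a ^ 2 ∂P - 1) := by
  refine tvDist_le_of_forall fun A hA => ?_
  have hQ : (P.withDensity fun a => ENNReal.ofReal (ρ a)).real A = ∫ a in A, ρ a ∂P := by
    rw [Measure.real, withDensity_apply _ hA,
      integral_eq_lintegral_of_nonneg_ae (Filter.Eventually.of_forall hρ0)
        hρ.aestronglyMeasurable]
  have hg : Integrable (fun a => ρ a - 1) P := hint.sub (integrable_const 1)
  have hg2 : Integrable (fun a => (ρ a - 1) ^ 2) P := by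
    have : (fun a => (ρ a - 1) ^ 2) = fun a => ρ a ^ 2 - 2 * ρ a + 1 := by ext a; ring
    rw [this]
    exact (hsq.sub (hint.const_mul 2)).add (integrable_const 1)
  have hg2i : ∫ a, (ρ a - 1) ^ 2 ∂P = ∫ a, ρ a ^ 2 ∂P - 1 := by
    have : (fun a => (ρ a - 1) ^ 2) = fun a => ρ a ^ 2 - 2 * ρ a + 1 := by ext a; ring
    have h1 : Integrable (fun a => ρ a ^ 2 - 2 * ρ a) P := hsq.sub (hint.const_mul 2)
    rw [this, integral_add h1 (integrable_const 1),
      integral_sub hsq (hint.const_mul 2), integral_const_mul, hone]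
    simp; ring
  have hPA : P.real A = ∫ _ in A, (1 : ℝ) ∂P := by simp
  have hdiff : |P.real A - (P.withDensity fun a => ENNReal.ofReal (ρ a)).real A|
      ≤ ∫ a, |ρ a - 1| ∂P := by
    rw [hQ, hPA, abs_sub_comm, ← integral_sub hint.integrableOn (integrable_const 1).integrableOn]
    calc |∫ a in A, (ρ a - 1) ∂P| ≤ ∫ a in A, |ρ a - 1| ∂P := abs_integral_le_integral_abs
      _ ≤ ∫ a, |ρ a - 1| ∂P :=
        setIntegral_le_integral hg.abs (Filter.Eventually.of_forall fun a => abs_nonneg _)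
  refine hdiff.trans (Real.le_sqrt_of_sq_le ?_)
  rw [← hg2i]
  set c := ∫ a, |ρ a - 1| ∂P with hc
  -- Cauchy–Schwarz as non-negativity of the variance of `|ρ - 1|` under `P`: expanding gives `c² ≤
  -- ∫ (ρ - 1)²`.
  have h0 : 0 ≤ ∫ a, (|ρ a - 1| - c) ^ 2 ∂P := integral_nonneg fun a => sq_nonneg _
  have : (fun a => (|ρ a - 1| - c) ^ 2) = fun a => (ρ a - 1) ^ 2 - 2 * c * |ρ a - 1| + c ^ 2 := by
    ext a; rw [← sq_abs (ρ a - 1)]; ring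
  have h1 : Integrable (fun a => (ρ a - 1) ^ 2 - 2 * c * |ρ a - 1|) P :=
    hg2.sub (hg.abs.const_mul _)
  rw [this, integral_add h1 (integrable_const _),
    integral_sub hg2 (hg.abs.const_mul _), integral_const_mul, ← hc] at h0
  simp at h0
  nlinarith

end TotalVariation

/-! ### Likelihood ratios of Gaussians on the line. -/

section GaussianDensity

/-- The density of `N(μ, 1/lam)` with respect to `N(0, 1)`. -/
noncomputable def gaussianRatio (μ lam : ℝ) (x : ℝ) : ℝ :=
  √lam * Real.exp (x ^ 2 / 2 - lam * (x - μ) ^ 2 / 2)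

lemma measurable_gaussianRatio (μ lam : ℝ) : Measurable (gaussianRatio μ lam) := by
  unfold gaussianRatio; fun_prop

lemma gaussianRatio_nonneg (μ lam x : ℝ) : 0 ≤ gaussianRatio μ lam x := by
  unfold gaussianRatio; positivity

lemma gaussianPDFReal_inv (μ x : ℝ) {lam : ℝ} (hlam : 0 < lam) :
    gaussianPDFReal μ (lam⁻¹).toNNReal x
      = √lam * (√(2 * Real.pi))⁻¹ * Real.exp (-(lam * (x - μ) ^ 2 / 2)) := by
  rw [gaussianPDFReal, Real.coe_toNNReal _ (inv_nonneg.2 hlam.le),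
    Real.sqrt_mul (by positivity), Real.sqrt_inv, mul_inv, inv_inv]
  rw [mul_comm (√(2 * Real.pi))⁻¹]
  congr 2
  field_simp

lemma gaussianPDFReal_zero_one (x : ℝ) :
    gaussianPDFReal 0 1 x = (√(2 * Real.pi))⁻¹ * Real.exp (-(x ^ 2 / 2)) := by
  simp [gaussianPDFReal]; left; ring

lemma gaussianPDFReal_mul_gaussianRatio (μ x : ℝ) {lam : ℝ} (hlam : 0 < lam) :
    gaussianPDFReal 0 1 x * gaussianRatio μ lam x = gaussianPDFReal μ (lam⁻¹).toNNReal x := by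
  rw [gaussianPDFReal_inv μ x hlam, gaussianPDFReal_zero_one, gaussianRatio,
    show -(lam * (x - μ) ^ 2 / 2) = -(x ^ 2 / 2) + (x ^ 2 / 2 - lam * (x - μ) ^ 2 / 2) by ring,
    Real.exp_add]
  ring

lemma toNNReal_inv_ne_zero {lam : ℝ} (hlam : 0 < lam) : (lam⁻¹).toNNReal ≠ 0 := by
  simpa using hlam

lemma gaussianReal_eq_withDensity_gaussianRatio (μ : ℝ) {lam : ℝ} (hlam : 0 < lam) :
    gaussianReal μ (lam⁻¹).toNNReal
      = (gaussianReal 0 1).withDensity fun x => ENNReal.ofReal (gaussianRatio μ lam x) := by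
  rw [gaussianReal_of_var_ne_zero μ (toNNReal_inv_ne_zero hlam),
    gaussianReal_of_var_ne_zero 0 one_ne_zero,
    ← withDensity_mul _ (measurable_gaussianPDF 0 1)
      (measurable_gaussianRatio μ lam).ennreal_ofReal]
  congr 1
  ext x
  rw [Pi.mul_apply, gaussianPDF, gaussianPDF, ← gaussianPDFReal_mul_gaussianRatio μ x hlam,
    ENNReal.ofReal_mul (gaussianPDFReal_nonneg 0 1 x)]

lemma integrable_gaussianReal_iff (f : ℝ → ℝ) :
    Integrable f (gaussianReal 0 1) ↔ Integrable (fun x => gaussianPDFReal 0 1 x * f x) := by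
  rw [gaussianReal_of_var_ne_zero 0 one_ne_zero,
    integrable_withDensity_iff_integrable_smul' (measurable_gaussianPDF 0 1)
      (Filter.Eventually.of_forall fun x => gaussianPDF_lt_top)]
  simp [toReal_gaussianPDF]

lemma integrable_gaussianRatio (μ : ℝ) {lam : ℝ} (hlam : 0 < lam) :
    Integrable (gaussianRatio μ lam) (gaussianReal 0 1) := by
  rw [integrable_gaussianReal_iff]
  simp_rw [gaussianPDFReal_mul_gaussianRatio μ _ hlam]
  exact integrable_gaussianPDFReal _ _

/-- Completing the square: the exponent `x²/2 - lam (x - μ)²` has leading coefficient `-(2 lam -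
1)/2`, so `lam > 1/2` is exactly what makes the second moment of the ratio finite. -/
lemma gaussianPDFReal_mul_gaussianRatio_sq (μ x : ℝ) {lam : ℝ} (hlam : 1 / 2 < lam) :
    gaussianPDFReal 0 1 x * gaussianRatio μ lam x ^ 2
      = lam / √(2 * lam - 1) * Real.exp (lam * μ ^ 2 / (2 * lam - 1))
        * gaussianPDFReal (2 * lam * μ / (2 * lam - 1)) ((2 * lam - 1)⁻¹).toNNReal x := by
  have h : 0 < 2 * lam - 1 := by linarith
  have hs : √(2 * lam - 1) ≠ 0 := (Real.sqrt_pos.2 h).ne'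
  rw [gaussianPDFReal_inv _ x h, gaussianPDFReal_zero_one, gaussianRatio, mul_pow,
    Real.sq_sqrt (by linarith), ← Real.exp_nat_mul]
  have e : -(x ^ 2 / 2) + (2 : ℕ) * (x ^ 2 / 2 - lam * (x - μ) ^ 2 / 2)
      = lam * μ ^ 2 / (2 * lam - 1)
        + -((2 * lam - 1) * (x - 2 * lam * μ / (2 * lam - 1)) ^ 2 / 2) := by
    field_simp
    push_cast
    ring
  calc (√(2 * Real.pi))⁻¹ * Real.exp (-(x ^ 2 / 2)) *
        (lam * Real.exp ((2 : ℕ) * (x ^ 2 / 2 - lam * (x - μ) ^ 2 / 2)))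
      = (√(2 * Real.pi))⁻¹ * lam *
        (Real.exp (-(x ^ 2 / 2)) * Real.exp ((2 : ℕ) * (x ^ 2 / 2 - lam * (x - μ) ^ 2 / 2))) := by
        ring
    _ = _ := by
        rw [← Real.exp_add, e, Real.exp_add]
        field_simp

lemma integrable_gaussianRatio_sq (μ : ℝ) {lam : ℝ} (hlam : 1 / 2 < lam) :
    Integrable (fun x => gaussianRatio μ lam x ^ 2) (gaussianReal 0 1) := by
  rw [integrable_gaussianReal_iff]
  simp_rw [gaussianPDFReal_mul_gaussianRatio_sq μ _ hlam]
  exact (integrable_gaussianPDFReal _ _).const_mul _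

/-- The second moment is `lam / √(2 lam - 1) · exp (lam μ² / (2 lam - 1))`. For `lam ≥ 3/4` one has
`lam² / (2 lam - 1) ≤ 1 + 2 (lam - 1)² ≤ exp (2 (lam - 1)²)` and `lam / (2 lam - 1) ≤ 3/2`. The
exponential form lets the bounds add up over coordinates. -/
lemma integral_gaussianRatio_sq_le (μ : ℝ) {lam : ℝ} (hlam : |lam - 1| ≤ 1 / 4) :
    ∫ x, gaussianRatio μ lam x ^ 2 ∂(gaussianReal 0 1)
      ≤ Real.exp ((lam - 1) ^ 2 + 3 / 2 * μ ^ 2) := by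
  obtain ⟨h₁, h₂⟩ := abs_le.1 hlam
  have hl : 1 / 2 < lam := by linarith
  have h : 0 < 2 * lam - 1 := by linarith
  rw [integral_gaussianReal_eq_integral_smul one_ne_zero]
  simp_rw [smul_eq_mul, gaussianPDFReal_mul_gaussianRatio_sq μ _ hl]
  rw [integral_const_mul, integral_gaussianPDFReal_eq_one _ (toNNReal_inv_ne_zero h), mul_one,
    Real.exp_add]
  have hs : 0 < √(2 * lam - 1) := Real.sqrt_pos.2 h
  refine mul_le_mul ?_ (Real.exp_le_exp.2 ?_) (Real.exp_pos _).le (Real.exp_pos _).le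
  · rw [div_le_iff₀ hs]
    refine (sq_le_sq₀ (by linarith) (by positivity)).1 ?_
    rw [mul_pow, Real.sq_sqrt h.le, ← Real.exp_nat_mul]
    have h3 := Real.add_one_le_exp ((2 : ℕ) * (lam - 1) ^ 2)
    have h4 : lam ^ 2 ≤ ((2 : ℕ) * (lam - 1) ^ 2 + 1) * (2 * lam - 1) := by
      push_cast
      nlinarith [mul_nonneg (sq_nonneg (lam - 1)) (by linarith : 0 ≤ 4 * lam - 3)]
    exact h4.trans (mul_le_mul_of_nonneg_right h3 h.le)
  · rw [div_le_iff₀ h]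
    nlinarith [mul_nonneg (sq_nonneg μ) (by linarith : 0 ≤ 2 * lam - 3 / 2)]

end GaussianDensity

end OnlineBvM

namespace OnlineBvM

/-! ### Comparison of multivariate Gaussians. -/

section GaussianComparison

variable {p : ℕ}

/-- Product measures with densities. -/
lemma pi_withDensity_eq {ι : Type*} [Fintype ι] (P Q : ι → Measure ℝ)
    [∀ i, IsProbabilityMeasure (P i)] [∀ i, IsProbabilityMeasure (Q i)] (ρ : ι → ℝ → ℝ)
    (hρ : ∀ i, Measurable (ρ i)) (hρ0 : ∀ i a, 0 ≤ ρ i a) (hint : ∀ i, Integrable (ρ i) (P i))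
    (hQ : ∀ i, Q i = (P i).withDensity fun a => ENNReal.ofReal (ρ i a)) :
    Measure.pi Q = (Measure.pi P).withDensity fun a => ENNReal.ofReal (∏ i, ρ i (a i)) := by
  have hm : Measurable fun a : ι → ℝ => ∏ i, ρ i (a i) :=
    Finset.measurable_prod _ fun i _ => (hρ i).comp (measurable_pi_apply i)
  refine Measure.pi_eq fun s hs => ?_
  rw [withDensity_apply _ (MeasurableSet.univ_pi hs)]
  -- On rectangles the identity is Fubini for a product of functions of one coordinate each, the
  -- indicator being absorbed into the density.
  have hQs : ∀ i, Q i (s i) = ENNReal.ofReal (∫ a, (s i).indicator (ρ i) a ∂(P i)) := fun i => by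
    rw [hQ i, withDensity_apply _ (hs i), integral_indicator (hs i),
      ofReal_integral_eq_lintegral_ofReal (hint i).integrableOn
        (Filter.Eventually.of_forall (hρ0 i))]
  simp_rw [hQs]
  rw [← ENNReal.ofReal_prod_of_nonneg fun i _ =>
    integral_nonneg fun a => Set.indicator_nonneg (fun b _ => hρ0 i b) a,
    ← integral_fintype_prod_eq_prod (f := fun i a => (s i).indicator (ρ i) a),
    ← ofReal_integral_eq_lintegral_ofReal
      (Integrable.fintype_prod (f := fun i a => ρ i a) hint).integrableOn
      (Filter.Eventually.of_forall fun a => Finset.prod_nonneg fun i _ => hρ0 i _),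
    ← integral_indicator (MeasurableSet.univ_pi hs)]
  congr 2
  ext a
  by_cases ha : a ∈ Set.univ.pi s
  · rw [Set.indicator_of_mem ha]
    exact Finset.prod_congr rfl fun i _ => (Set.indicator_of_mem (ha i trivial) _).symm
  · rw [Set.indicator_of_notMem ha]
    obtain ⟨i, hi⟩ : ∃ i, a i ∉ s i := by simpa [Set.mem_pi] using ha
    exact (Finset.prod_eq_zero (Finset.mem_univ i) (Set.indicator_of_notMem hi _)).symm

/-- Total variation between a standard Gaussian vector and a Gaussian vector with independent
coordinates. -/
lemma tvDist_pi_gaussianReal_le {ι : Type*} [Fintype ι] (μ lam : ι → ℝ) {e : ℝ}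
    (hlam : ∀ i, |lam i - 1| ≤ 1 / 4)
    (he : ∑ i, ((lam i - 1) ^ 2 + 3 / 2 * μ i ^ 2) ≤ e) :
    tvDist (Measure.pi fun _ : ι => gaussianReal 0 1)
      (Measure.pi fun i => gaussianReal (μ i) ((lam i)⁻¹).toNNReal) ≤ √(Real.exp e - 1) := by
  have hpos : ∀ i, 0 < lam i := fun i => by linarith [(abs_le.1 (hlam i)).1]
  have hhalf : ∀ i, 1 / 2 < lam i := fun i => by linarith [(abs_le.1 (hlam i)).1]
  have hint := fun i => integrable_gaussianRatio (μ i) (hpos i)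
  rw [pi_withDensity_eq (fun _ => gaussianReal 0 1) _ (fun i => gaussianRatio (μ i) (lam i))
    (fun i => measurable_gaussianRatio _ _) (fun i => gaussianRatio_nonneg _ _) hint
    (fun i => gaussianReal_eq_withDensity_gaussianRatio (μ i) (hpos i))]
  have hsq : (fun a : ι → ℝ => (∏ i, gaussianRatio (μ i) (lam i) (a i)) ^ 2)
      = fun a => ∏ i, gaussianRatio (μ i) (lam i) (a i) ^ 2 := by
    ext a; rw [Finset.prod_pow]
  have hm : Measurable fun a : ι → ℝ => ∏ i, gaussianRatio (μ i) (lam i) (a i) :=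
    Finset.measurable_prod _ fun i _ =>
      (measurable_gaussianRatio _ _).comp (measurable_pi_apply i)
  refine (tvDist_withDensity_le _ hm
    (fun a => Finset.prod_nonneg fun i _ => gaussianRatio_nonneg _ _ _)
    (Integrable.fintype_prod (f := fun i a => gaussianRatio (μ i) (lam i) a) hint) ?_ ?_).trans ?_
  · rw [integral_fintype_prod_eq_prod (f := fun i a => gaussianRatio (μ i) (lam i) a)]
    refine Finset.prod_eq_one fun i _ => ?_
    rw [integral_gaussianReal_eq_integral_smul one_ne_zero]
    simp_rw [smul_eq_mul, gaussianPDFReal_mul_gaussianRatio (μ i) _ (hpos i)]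
    exact integral_gaussianPDFReal_eq_one _ (toNNReal_inv_ne_zero (hpos i))
  · rw [hsq]
    exact Integrable.fintype_prod (f := fun i a => gaussianRatio (μ i) (lam i) a ^ 2)
      fun i => integrable_gaussianRatio_sq (μ i) (hhalf i)
  · refine Real.sqrt_le_sqrt (sub_le_sub_right ?_ 1)
    rw [hsq, integral_fintype_prod_eq_prod (f := fun i a => gaussianRatio (μ i) (lam i) a ^ 2)]
    refine le_trans (Finset.prod_le_prod (fun i _ => integral_nonneg fun a => sq_nonneg _)
      fun i _ => integral_gaussianRatio_sq_le (μ i) (hlam i)) ?_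
    rw [← Real.exp_sum]
    exact Real.exp_le_exp.2 he


lemma mulVec_eq_toEuclideanCLM (A : Mat p) (v : Param p) :
    mulVec A v = Matrix.toEuclideanCLM (n := Fin p) (𝕜 := ℝ) A v := rfl

lemma mulVec_mulVec (A B : Mat p) (v : Param p) : mulVec A (mulVec B v) = mulVec (A * B) v := by
  simp [mulVec, Matrix.mulVec_mulVec]

lemma mulVec_add_right (A : Mat p) (v w : Param p) :
    mulVec A (v + w) = mulVec A v + mulVec A w := by
  simp [mulVec_eq_toEuclideanCLM]

lemma mulVec_sub_right (A : Mat p) (v w : Param p) :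
    mulVec A (v - w) = mulVec A v - mulVec A w := by
  simp [mulVec_eq_toEuclideanCLM]

lemma mulVec_add_left (A B : Mat p) (v : Param p) :
    mulVec (A + B) v = mulVec A v + mulVec B v := by
  simp [mulVec_eq_toEuclideanCLM]

lemma one_mulVec (v : Param p) : mulVec 1 v = v := by simp [mulVec]

lemma inner_mulVec_eq_dotProduct (A : Mat p) (v w : Param p) :
    inner ℝ v (mulVec A w) = v.ofLp ⬝ᵥ A.mulVec w.ofLp := by
  rw [EuclideanSpace.inner_eq_star_dotProduct]
  simp [mulVec, dotProduct_comm]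

lemma inner_mulVec_transpose (A : Mat p) (v w : Param p) :
    inner ℝ (mulVec A.transpose v) w = inner ℝ v (mulVec A w) := by
  rw [real_inner_comm, inner_mulVec_eq_dotProduct, inner_mulVec_eq_dotProduct,
    Matrix.dotProduct_mulVec, Matrix.vecMul_transpose, dotProduct_comm]

lemma quad_mulVec (A B : Mat p) (v : Param p) :
    quad A (mulVec B v) = quad (B.transpose * A * B) v := by
  rw [quad, quad, ← mulVec_mulVec, ← mulVec_mulVec, ← inner_mulVec_transpose B.transpose,
    Matrix.transpose_transpose]

lemma quad_one (v : Param p) : quad 1 v = ‖v‖ ^ 2 := by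
  rw [quad, one_mulVec, real_inner_self_eq_norm_sq]

/-- Affine images of Gaussian vectors with independent coordinates. -/
lemma map_pi_gaussianReal (b : Param p) (B : Mat p) (μ : Fin p → ℝ) (lam : Fin p → ℝ)
    (hlam : ∀ i, 0 < lam i) :
    (Measure.pi fun i => gaussianReal (μ i) ((lam i)⁻¹).toNNReal).map
        (fun z => b + mulVec B (WithLp.toLp 2 z))
      = multivariateGaussian (b + mulVec B (WithLp.toLp 2 μ))
          (B * Matrix.diagonal (fun i => (lam i)⁻¹) * B.transpose) := by
  have hmeas : Measurable fun z : Fin p → ℝ => b + mulVec B (WithLp.toLp 2 z) := by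
    simp_rw [mulVec_eq_toEuclideanCLM]; fun_prop
  have hD : (Matrix.diagonal fun i => (lam i)⁻¹).PosSemidef :=
    Matrix.PosSemidef.diagonal fun i => (inv_pos.2 (hlam i)).le
  have hS : (B * Matrix.diagonal (fun i => (lam i)⁻¹) * B.transpose).PosSemidef := by
    simpa using hD.mul_mul_conjTranspose_same B
  have := Measure.isProbabilityMeasure_map (μ := Measure.pi fun i =>
    gaussianReal (μ i) ((lam i)⁻¹).toNNReal) hmeas.aemeasurable
  -- Both characteristic functions are exponentials of a quadratic; on the left the product over
  -- coordinates is evaluated at `Bᵀ t`.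
  apply Measure.ext_of_charFun (E := EuclideanSpace ℝ (Fin p))
  ext t
  rw [charFun_multivariateGaussian hS, charFun_apply,
    integral_map hmeas.aemeasurable (Measurable.aestronglyMeasurable (by fun_prop))]
  have e : ∀ z : Fin p → ℝ, inner ℝ (b + mulVec B (WithLp.toLp 2 z)) t
      = inner ℝ b t + inner ℝ (WithLp.toLp 2 z) (mulVec B.transpose t) := fun z => by
    rw [inner_add_left, ← inner_mulVec_transpose B.transpose, Matrix.transpose_transpose]
  have hpi : ∫ z : Fin p → ℝ, Complex.exp (inner ℝ (b + mulVec B (WithLp.toLp 2 z)) t * Complex.I)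
      ∂(Measure.pi fun i => gaussianReal (μ i) ((lam i)⁻¹).toNNReal)
      = Complex.exp (inner ℝ b t * Complex.I)
        * ∏ i, charFun (gaussianReal (μ i) ((lam i)⁻¹).toNNReal) (mulVec B.transpose t i) := by
    rw [← charFun_pi, charFun_apply,
      integral_map (by fun_prop) (Measurable.aestronglyMeasurable (by fun_prop)),
      ← integral_const_mul]
    refine integral_congr_ae (Filter.Eventually.of_forall fun z => ?_)
    simp only
    rw [e z, ← Complex.exp_add]
    push_cast
    ring_nf
  rw [hpi]
  simp_rw [charFun_gaussianReal]
  rw [← Complex.exp_sum, ← Complex.exp_add]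
  congr 1
  have h1 : inner ℝ t (b + mulVec B (WithLp.toLp 2 μ))
      = inner ℝ b t + ∑ i, mulVec B.transpose t i * μ i := by
    rw [real_inner_comm, e]
    simp [PiLp.inner_apply]
  have h2 : t.ofLp ⬝ᵥ (B * Matrix.diagonal (fun i => (lam i)⁻¹) * B.transpose).mulVec t.ofLp
      = ∑ i, (lam i)⁻¹ * mulVec B.transpose t i ^ 2 := by
    rw [← Matrix.mulVec_mulVec, ← Matrix.mulVec_mulVec, Matrix.dotProduct_mulVec,
      ← Matrix.mulVec_transpose, dotProduct]
    refine Finset.sum_congr rfl fun i _ => ?_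
    rw [Matrix.mulVec_diagonal]
    simp only [mulVec]
    ring
  rw [h1, h2]
  push_cast
  simp_rw [Real.coe_toNNReal _ (inv_nonneg.2 (hlam _).le)]
  rw [add_mul, Finset.sum_sub_distrib, Finset.sum_mul, Finset.sum_div]
  push_cast
  rw [add_sub_assoc]

/-- Simultaneous diagonalization of two quadratic forms, the first of them positive definite. -/
lemma exists_simultaneous_diagonalization (A F : Mat p) (hA : A.PosDef) (hF : F.IsHermitian) :
    ∃ (B : Mat p) (lam : Fin p → ℝ), B * B.transpose = A⁻¹ ∧ B.transpose * A * B = 1 ∧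
      B.transpose * F * B = Matrix.diagonal lam := by
  -- Whitening by `R = A^{-1/2}` turns `A` into the identity and `F` into `R F R`, which an
  -- orthogonal `U` diagonalizes; hence `B = R U`.
  open scoped MatrixOrder in
  set R : Mat p := CFC.sqrt A⁻¹ with hR
  have hAi : A⁻¹.PosDef := hA.inv
  have hRR : R * R = A⁻¹ := CFC.sqrt_mul_sqrt_self _ hAi.posSemidef.nonneg
  have hRt : R.transpose = R := by
    have : R.IsHermitian := (CFC.sqrt_nonneg A⁻¹).isSelfAdjoint
    simpa using this.eq
  have hN : (R * F * R).IsHermitian := by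
    have := Matrix.isHermitian_mul_mul_conjTranspose R hF
    simpa [hRt] using this
  set U : Mat p := (hN.eigenvectorUnitary : Mat p) with hU
  have hUU : U * U.transpose = 1 := by
    have := Unitary.mul_star_self_of_mem hN.eigenvectorUnitary.2
    simpa [Matrix.star_eq_conjTranspose] using this
  have hUU' : U.transpose * U = 1 := mul_eq_one_comm.1 hUU
  have hspec : R * F * R = U * Matrix.diagonal hN.eigenvalues * U.transpose := by
    have := hN.spectral_theorem
    simpa [Unitary.conjStarAlgAut_apply, Matrix.star_eq_conjTranspose, Function.comp_def]
      using this
  have hBB : R * U * (R * U).transpose = A⁻¹ := by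
    rw [Matrix.transpose_mul, hRt, ← hRR, Matrix.mul_assoc, ← Matrix.mul_assoc U, hUU,
      Matrix.one_mul]
  refine ⟨R * U, hN.eigenvalues, hBB, ?_, ?_⟩
  · have : A * (R * U) * (R * U).transpose = 1 := by
      rw [Matrix.mul_assoc, hBB, Matrix.mul_nonsing_inv _ ((Matrix.isUnit_iff_isUnit_det _).1
        hA.isUnit)]
    rw [Matrix.mul_assoc]
    exact mul_eq_one_comm.1 this
  · calc (R * U).transpose * F * (R * U) = U.transpose * (R * F * R) * U := by
          rw [Matrix.transpose_mul, hRt]; simp only [Matrix.mul_assoc]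
      _ = (U.transpose * U) * Matrix.diagonal hN.eigenvalues * (U.transpose * U) :=
          (congrArg (fun N => U.transpose * N * U) hspec).trans (by simp only [Matrix.mul_assoc])
      _ = _ := by rw [hUU', Matrix.one_mul, Matrix.mul_one]

/-- Total variation between two non-degenerate Gaussian distributions, in terms of the relative
difference of the precision matrices and of the difference of the means. -/
theorem tvDist_multivariateGaussian_le (hp : 1 ≤ p) (a b : Param p) (A F : Mat p) (hA : A.PosDef)
    (hF : F.PosDef) {δ : ℝ} (hδ : ∀ v, |quad F v - quad A v| ≤ δ * quad A v) :
    tvDist (multivariateGaussian a A⁻¹) (multivariateGaussian b F⁻¹)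
      ≤ 4 * √(p * δ ^ 2 + 3 / 2 * quad A (b - a)) := by
  obtain ⟨B, lam, hBB, hBA, hBF⟩ := exists_simultaneous_diagonalization A F hA hF.isHermitian
  -- In the coordinates `z ↦ a + B z` the first Gaussian is standard and the second has independent
  -- coordinates with mean `μ` and precisions `lam`. Here `Bᵀ A` is the inverse of `B`.
  set μ : Param p := mulVec (B.transpose * A) (b - a) with hμ
  have hAAi : A⁻¹ * A = 1 :=
    Matrix.nonsing_inv_mul _ ((Matrix.isUnit_iff_isUnit_det _).1 hA.isUnit)
  have hBμ : mulVec B μ = b - a := by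
    rw [hμ, mulVec_mulVec, ← Matrix.mul_assoc, hBB, hAAi, one_mulVec]
  have hquad : quad A (b - a) = ∑ i, μ i ^ 2 := by
    rw [← hBμ, quad_mulVec, hBA, quad_one, EuclideanSpace.real_norm_sq_eq]
  have hq0 : 0 ≤ quad A (b - a) := by rw [hquad]; positivity
  have hlam : ∀ i, |lam i - 1| ≤ δ := fun i => by
    have h := hδ (mulVec B (EuclideanSpace.single i 1))
    rw [quad_mulVec, quad_mulVec, hBA, hBF, quad_one] at h
    simpa [quad, inner_mulVec_eq_dotProduct, Matrix.mulVec_diagonal, Pi.single_apply] using h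
  have hδ0 : 0 ≤ δ := (abs_nonneg _).trans (hlam ⟨0, hp⟩)
  set e := p * δ ^ 2 + 3 / 2 * quad A (b - a) with he
  have hp' : (1 : ℝ) ≤ p := by exact_mod_cast hp
  -- For `e > 1/16` the right-hand side already exceeds 1. Otherwise `p ≥ 1` forces `δ ≤ 1/4`, the
  -- range where the second moments are controlled. The factor 4 is fixed by this case; `exp e - 1 ≤
  -- 2 e` would need less.
  by_cases hbig : 1 / 16 < e
  · refine (tvDist_le_one _ _).trans ?_
    have : (1 : ℝ) / 4 ≤ √e := Real.le_sqrt_of_sq_le (by linarith)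
    linarith
  push Not at hbig
  have hδ4 : δ ≤ 1 / 4 := by
    have : δ ^ 2 ≤ (1 / 4) ^ 2 := by nlinarith [sq_nonneg δ]
    exact (sq_le_sq₀ hδ0 (by norm_num)).1 this
  have hlam4 : ∀ i, |lam i - 1| ≤ 1 / 4 := fun i => (hlam i).trans hδ4
  have hpos : ∀ i, 0 < lam i := fun i => by linarith [(abs_le.1 (hlam4 i)).1]
  have hP : multivariateGaussian a A⁻¹
      = (Measure.pi fun _ : Fin p => gaussianReal 0 1).map
        (fun z => a + mulVec B (WithLp.toLp 2 z)) := by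
    have h := map_pi_gaussianReal a B (fun _ => 0) (fun _ => 1) (fun _ => one_pos)
    have h0 : mulVec B (WithLp.toLp 2 fun _ => (0 : ℝ)) = 0 := by
      have : (WithLp.toLp 2 fun _ => (0 : ℝ) : Param p) = 0 := rfl
      rw [this, mulVec_eq_toEuclideanCLM, map_zero]
    rw [h0, add_zero] at h
    simpa [hBB] using h.symm
  have hdiag : Matrix.diagonal lam * Matrix.diagonal (fun i => (lam i)⁻¹) = 1 := by
    rw [Matrix.diagonal_mul_diagonal, ← Matrix.diagonal_one]
    congr 1
    ext i
    exact mul_inv_cancel₀ (hpos i).ne'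
  have hFinv : B * Matrix.diagonal (fun i => (lam i)⁻¹) * B.transpose = F⁻¹ := by
    refine (Matrix.inv_eq_right_inv ?_).symm
    have hAB : A * B * B.transpose = 1 := by
      rw [← mul_eq_one_comm, ← Matrix.mul_assoc, hBA]
    have hFB : F * B = A * B * Matrix.diagonal lam := by
      rw [← hBF, ← Matrix.mul_assoc, ← Matrix.mul_assoc, hAB, Matrix.one_mul]
    calc F * (B * Matrix.diagonal (fun i => (lam i)⁻¹) * B.transpose)
        = F * B * Matrix.diagonal (fun i => (lam i)⁻¹) * B.transpose := by
          simp only [Matrix.mul_assoc]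
      _ = A * B * (Matrix.diagonal lam * Matrix.diagonal (fun i => (lam i)⁻¹)) * B.transpose := by
          rw [hFB]; simp only [Matrix.mul_assoc]
      _ = 1 := by rw [hdiag, Matrix.mul_one, hAB]
  have hQ : multivariateGaussian b F⁻¹
      = (Measure.pi fun i => gaussianReal (μ i) ((lam i)⁻¹).toNNReal).map
        (fun z => a + mulVec B (WithLp.toLp 2 z)) := by
    rw [map_pi_gaussianReal a B (fun i => μ i) lam hpos, hFinv]
    congr 1
    change b = a + mulVec B μ
    rw [hBμ]; abel
  have hsum : ∑ i, ((lam i - 1) ^ 2 + 3 / 2 * μ i ^ 2) ≤ e := by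
    rw [Finset.sum_add_distrib, ← Finset.mul_sum, ← hquad, he]
    gcongr
    calc ∑ i, (lam i - 1) ^ 2 ≤ ∑ _i : Fin p, δ ^ 2 :=
          Finset.sum_le_sum fun i _ => sq_le_sq.2 ((hlam i).trans (le_abs_self δ))
      _ = p * δ ^ 2 := by simp
  have hmeas : Measurable fun z : Fin p → ℝ => a + mulVec B (WithLp.toLp 2 z) := by
    simp_rw [mulVec_eq_toEuclideanCLM]; fun_prop
  rw [hP, hQ]
  refine (tvDist_map_le _ _ hmeas).trans ((tvDist_pi_gaussianReal_le _ lam hlam4 hsum).trans ?_)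
  have he0 : 0 ≤ e := by positivity
  have hexp : Real.exp e - 1 ≤ 16 * e := by
    have := Real.abs_exp_sub_one_le (x := e) (by rw [abs_of_nonneg he0]; linarith)
    rw [abs_of_nonneg he0] at this
    linarith [le_abs_self (Real.exp e - 1)]
  calc √(Real.exp e - 1) ≤ √(4 ^ 2 * e) := Real.sqrt_le_sqrt (by linarith)
    _ = 4 * √e := by rw [Real.sqrt_mul (by norm_num), Real.sqrt_sq (by norm_num)]

end GaussianComparison

end OnlineBvM

namespace OnlineBvM

/-! ### Quadratic forms and the spectral norm. -/

section QuadraticForms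

variable {p : ℕ}

lemma mulVec_sub_left (A B : Mat p) (v : Param p) :
    mulVec (A - B) v = mulVec A v - mulVec B v := by
  simp [mulVec_eq_toEuclideanCLM]

lemma mulVec_smul_left (c : ℝ) (A : Mat p) (v : Param p) :
    mulVec (c • A) v = c • mulVec A v := by
  simp [mulVec_eq_toEuclideanCLM]

lemma mulVec_smul_right (c : ℝ) (A : Mat p) (v : Param p) :
    mulVec A (c • v) = c • mulVec A v := by
  simp [mulVec_eq_toEuclideanCLM]

lemma mulVec_sum_left {ι : Type*} (s : Finset ι) (A : ι → Mat p) (v : Param p) :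
    mulVec (∑ i ∈ s, A i) v = ∑ i ∈ s, mulVec (A i) v := by
  simp [mulVec_eq_toEuclideanCLM, map_sum]

lemma quad_add_left (A B : Mat p) (v : Param p) : quad (A + B) v = quad A v + quad B v := by
  simp [quad, mulVec_add_left, inner_add_right]

lemma quad_sub_left (A B : Mat p) (v : Param p) : quad (A - B) v = quad A v - quad B v := by
  simp [quad, mulVec_sub_left, inner_sub_right]

lemma quad_smul_left (c : ℝ) (A : Mat p) (v : Param p) : quad (c • A) v = c * quad A v := by
  simp [quad, mulVec_smul_left, inner_smul_right]

lemma quad_smul_right (c : ℝ) (A : Mat p) (v : Param p) : quad A (c • v) = c ^ 2 * quad A v := by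
  simp [quad, mulVec_smul_right, inner_smul_right, inner_smul_left]; ring

lemma quad_neg_right (A : Mat p) (v : Param p) : quad A (-v) = quad A v := by
  rw [← neg_one_smul ℝ v, quad_smul_right]; ring

lemma quad_smul_one (c : ℝ) (v : Param p) : quad (c • 1) v = c * ‖v‖ ^ 2 := by
  rw [quad_smul_left, quad_one]

lemma norm_mulVec_le (A : Mat p) (v : Param p) : ‖mulVec A v‖ ≤ specNorm A * ‖v‖ :=
  (Matrix.toEuclideanCLM (n := Fin p) (𝕜 := ℝ) A).le_opNorm v

lemma specNorm_nonneg (A : Mat p) : 0 ≤ specNorm A := norm_nonneg _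

lemma specNorm_add_le (A B : Mat p) : specNorm (A + B) ≤ specNorm A + specNorm B := by
  unfold specNorm; rw [map_add]; exact norm_add_le _ _

lemma specNorm_sum_le {ι : Type*} (s : Finset ι) (A : ι → Mat p) :
    specNorm (∑ i ∈ s, A i) ≤ ∑ i ∈ s, specNorm (A i) := by
  unfold specNorm; rw [map_sum]; exact norm_sum_le _ _

lemma abs_quad_le (A : Mat p) (v : Param p) : |quad A v| ≤ specNorm A * ‖v‖ ^ 2 := by
  calc |quad A v| ≤ ‖v‖ * ‖mulVec A v‖ := abs_real_inner_le_norm _ _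
    _ ≤ ‖v‖ * (specNorm A * ‖v‖) :=
        mul_le_mul_of_nonneg_left (norm_mulVec_le A v) (norm_nonneg v)
    _ = _ := by ring

lemma quad_nonneg_of_posSemidef {A : Mat p} (hA : A.PosSemidef) (v : Param p) : 0 ≤ quad A v := by
  rw [quad, inner_mulVec_eq_dotProduct]
  simpa using hA.dotProduct_mulVec_nonneg v.ofLp

lemma Loewner.quad_le {A B : Mat p} (h : Loewner A B) (v : Param p) : quad A v ≤ quad B v := by
  have := quad_nonneg_of_posSemidef h v
  rw [quad_sub_left] at this
  linarith

lemma inner_mulVec_comm {A : Mat p} (hA : A.IsHermitian) (v w : Param p) :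
    inner ℝ (mulVec A v) w = inner ℝ v (mulVec A w) := by
  have : A.transpose = A := by simpa using hA.eq
  rw [← inner_mulVec_transpose, this]

/-- A symmetric matrix whose quadratic form dominates `c ‖v‖²`, `c > 0`, is positive definite. -/
lemma posDef_of_le_quad {A : Mat p} (hA : A.IsHermitian) {c : ℝ} (hc : 0 < c)
    (h : ∀ v, c * ‖v‖ ^ 2 ≤ quad A v) : A.PosDef := by
  refine Matrix.PosDef.of_dotProduct_mulVec_pos hA fun v hv => ?_
  have h1 := h (WithLp.toLp 2 v)
  rw [quad, inner_mulVec_eq_dotProduct] at h1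
  have h2 : (0 : ℝ) < ‖(WithLp.toLp 2 v : Param p)‖ ^ 2 := by
    have : (WithLp.toLp 2 v : Param p) ≠ 0 := by simpa using hv
    positivity
  simpa using lt_of_lt_of_le (mul_pos hc h2) h1

/-- If `A` dominates `c ‖v‖²` then `c ⟨d, A d⟩ ≤ ‖A d‖²`. -/
lemma quad_le_norm_mulVec_sq_div {A : Mat p} {c : ℝ} (hc : 0 < c)
    (h : ∀ v, c * ‖v‖ ^ 2 ≤ quad A v) (d : Param p) : quad A d ≤ ‖mulVec A d‖ ^ 2 / c := by
  rw [le_div_iff₀ hc]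
  have h1 : quad A d ≤ ‖d‖ * ‖mulVec A d‖ := real_inner_le_norm _ _
  have h2 := h d
  have h3 : c * ‖d‖ ≤ ‖mulVec A d‖ := by
    by_cases hd : ‖d‖ = 0
    · rw [hd]; simp
    · have : 0 < ‖d‖ := lt_of_le_of_ne (norm_nonneg d) (Ne.symm hd)
      refine le_of_mul_le_mul_left ?_ this
      nlinarith
  nlinarith [norm_nonneg d, norm_nonneg (mulVec A d)]

end QuadraticForms

/-! ### Hessians, Taylor bounds and the Newton-step inequality. -/

section Calculus

variable {p : ℕ} {f : Param p → ℝ}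

/-- Identifies the entrywise matrix `hess` with the second Fréchet derivative, so that the matrix
and the calculus statements can be combined. -/
lemma hess_apply_inner (hf' : Differentiable ℝ (fderiv ℝ f)) (θ v w : Param p) :
    inner ℝ v (mulVec (hess f θ) w) = fderiv ℝ (fderiv ℝ f) θ v w := by
  have hentry : ∀ i j, hess f θ i j = fderiv ℝ (fderiv ℝ f) θ (EuclideanSpace.single i 1)
      (EuclideanSpace.single j 1) := fun i j => by
    have : HasFDerivAt (fun θ' => fderiv ℝ f θ' (EuclideanSpace.single j 1))
        ((fderiv ℝ (fderiv ℝ f) θ).flip (EuclideanSpace.single j 1)) θ := by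
      simpa using (hf' θ).hasFDerivAt.clm_apply (hasFDerivAt_const _ θ)
    rw [hess, Matrix.of_apply, this.fderiv]
    rfl
  have hexp : ∀ u : Param p, u = ∑ i, u i • EuclideanSpace.single i (1 : ℝ) := fun u => by
    have := ((EuclideanSpace.basisFun (Fin p) ℝ).sum_repr u).symm
    simpa using this
  rw [inner_mulVec_eq_dotProduct]
  conv_rhs => rw [hexp v, hexp w]
  simp only [map_sum, map_smul, FunLike.coe_sum, Finset.sum_apply,
    smul_apply, smul_eq_mul, dotProduct, Matrix.mulVec, hentry, Finset.mul_sum]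
  rw [Finset.sum_comm]
  exact Finset.sum_congr rfl fun j _ => Finset.sum_congr rfl fun i _ => by
    ring

/-- Symmetry of second derivatives holds for a function that is merely twice differentiable; no
continuity of the Hessian is needed. -/
lemma hess_isHermitian (hf : Differentiable ℝ f) (hf' : Differentiable ℝ (fderiv ℝ f))
    (θ : Param p) : (hess f θ).IsHermitian := by
  ext i j
  have h : ∀ i j : Fin p, hess f θ i j = fderiv ℝ (fderiv ℝ f) θ (EuclideanSpace.single i 1)
      (EuclideanSpace.single j 1) := fun i j => by
    rw [← hess_apply_inner hf', inner_mulVec_eq_dotProduct]; simp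
  simp only [Matrix.conjTranspose_apply, star_trivial]
  rw [h, h]
  exact second_derivative_symmetric (fun y => (hf y).hasFDerivAt) (hf' θ).hasFDerivAt _ _

lemma inner_gradient (θ v : Param p) : inner ℝ (∇ f θ) v = fderiv ℝ f θ v := by
  simp [gradient]

lemma hasFDerivAt_gradient (hf : Differentiable ℝ f) (hf' : Differentiable ℝ (fderiv ℝ f))
    (θ : Param p) :
    HasFDerivAt (∇ f) (Matrix.toEuclideanCLM (n := Fin p) (𝕜 := ℝ) (hess f θ)) θ := by
  rw [← hasFDerivWithinAt_univ, hasFDerivWithinAt_euclidean]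
  intro i
  rw [hasFDerivWithinAt_univ]
  have h1 : (fun θ' => ∇ f θ' i) = fun θ' => fderiv ℝ f θ' (EuclideanSpace.single i 1) := by
    ext θ'
    rw [← inner_gradient, EuclideanSpace.inner_single_right]
    simp
  rw [h1]
  have := (hf' θ).hasFDerivAt.clm_apply (hasFDerivAt_const (EuclideanSpace.single i (1 : ℝ)) θ)
  refine this.congr_fderiv ?_
  ext v
  simp only [ContinuousLinearMap.comp_apply]
  have h2 : fderiv ℝ (fderiv ℝ f) θ v (EuclideanSpace.single i 1)
      = inner ℝ (EuclideanSpace.single i 1) (mulVec (hess f θ) v) := by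
    rw [← hess_apply_inner hf', ← inner_mulVec_comm (hess_isHermitian hf hf' θ), real_inner_comm]
  simp [h2, EuclideanSpace.inner_single_left, mulVec_eq_toEuclideanCLM]

/-- First-order expansion of the gradient when the Hessian is Lipschitz. -/
lemma norm_gradient_sub_sub_le (hf : Differentiable ℝ f) (hf' : Differentiable ℝ (fderiv ℝ f))
    {s : Set (Param p)} (hs : Convex ℝ s) {L : ℝ}
    (hL : ∀ θ ∈ s, ∀ θ' ∈ s, specNorm (hess f θ - hess f θ') ≤ L * ‖θ - θ'‖) (hL0 : 0 ≤ L)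
    {x y : Param p} (hx : x ∈ s) (hy : y ∈ s) :
    ‖∇ f y - ∇ f x - mulVec (hess f x) (y - x)‖ ≤ L * ‖y - x‖ ^ 2 := by
  -- Mean value inequality for `∇ f` minus its linearization at `x`: on the segment the derivative
  -- is at most `L ‖y - x‖`. The factor 1/2 of an integral remainder is given up.
  have := (convex_segment x y).norm_image_sub_le_of_norm_hasFDerivWithin_le'
    (f := ∇ f) (C := L * ‖y - x‖) (φ := Matrix.toEuclideanCLM (n := Fin p) (𝕜 := ℝ) (hess f x))
    (fun z _ => (hasFDerivAt_gradient hf hf' z).hasFDerivWithinAt) (fun z hz => ?_)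
    (left_mem_segment ℝ x y) (right_mem_segment ℝ x y)
  · rw [mulVec_eq_toEuclideanCLM]
    exact this.trans_eq (by ring)
  · rw [← map_sub]
    refine (hL z (hs.segment_subset hx hy hz) x hx).trans (mul_le_mul_of_nonneg_left ?_ hL0)
    obtain ⟨c, hc, rfl⟩ := (segment_eq_image' ℝ x y) ▸ hz
    simp only [add_sub_cancel_left, norm_smul, Real.norm_eq_abs, abs_of_nonneg hc.1]
    exact mul_le_of_le_one_left (norm_nonneg _) hc.2

lemma norm_gradient_sub_le (hf : Differentiable ℝ f) (hf' : Differentiable ℝ (fderiv ℝ f))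
    {s : Set (Param p)} (hs : Convex ℝ s) {L : ℝ} (hL : ∀ θ ∈ s, specNorm (hess f θ) ≤ L)
    {x y : Param p} (hx : x ∈ s) (hy : y ∈ s) : ‖∇ f y - ∇ f x‖ ≤ L * ‖y - x‖ :=
  hs.norm_image_sub_le_of_norm_hasFDerivWithin_le
    (fun z _ => (hasFDerivAt_gradient hf hf' z).hasFDerivWithinAt) (fun z hz => hL z hz) hx hy

/-- Taylor's inequality on `[0, 1]` for an affine bound of the second derivative. -/
lemma taylor_le_of_second_deriv_le {F F' F'' : ℝ → ℝ} (hF : ∀ w, HasDerivAt F (F' w) w)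
    (hF' : ∀ w, HasDerivAt F' (F'' w) w) {a b : ℝ}
    (h : ∀ w ∈ Set.Icc (0 : ℝ) 1, F'' w ≤ a + b * w) : F 1 - F 0 - F' 0 ≤ a / 2 + b / 6 := by
  -- Comparison of derivatives, applied twice, replaces integration: `F''` need not be integrable.
  have h1 : ∀ w ∈ Set.Icc (0 : ℝ) 1, F' w ≤ F' 0 + a * w + b * w ^ 2 / 2 := by
    refine image_le_of_deriv_right_le_deriv_boundary (f' := F'') (B' := fun w => a + b * w)
      (fun w _ => (hF' w).continuousAt.continuousWithinAt)
      (fun w _ => (hF' w).hasDerivWithinAt) (by simp) (by fun_prop) (fun w _ => ?_)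
      (fun w hw => h w ⟨hw.1, hw.2.le⟩)
    have : HasDerivAt (fun w : ℝ => F' 0 + a * w + b * w ^ 2 / 2)
        (0 + a * 1 + b * (2 * w ^ (2 - 1) * 1) / 2) w :=
      ((hasDerivAt_const w _).add ((hasDerivAt_id w).const_mul a)).add
        ((((hasDerivAt_id w).pow 2).const_mul b).div_const 2)
    exact (this.congr_deriv (by ring)).hasDerivWithinAt
  have h2 := image_le_of_deriv_right_le_deriv_boundary (f := F) (a := 0) (b := 1) (f' := F')
      (B := fun w => F 0 + F' 0 * w + a * w ^ 2 / 2 + b * w ^ 3 / 6)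
      (B' := fun w => F' 0 + a * w + b * w ^ 2 / 2)
      (fun w _ => (hF w).continuousAt.continuousWithinAt)
      (fun w _ => (hF w).hasDerivWithinAt) (by simp) (by fun_prop) (fun w _ => by
        have : HasDerivAt (fun w : ℝ => F 0 + F' 0 * w + a * w ^ 2 / 2 + b * w ^ 3 / 6)
            (0 + F' 0 * 1 + a * (2 * w ^ (2 - 1) * 1) / 2 + b * (3 * w ^ (3 - 1) * 1) / 6) w :=
          (((hasDerivAt_const w _).add ((hasDerivAt_id w).const_mul (F' 0))).add
            ((((hasDerivAt_id w).pow 2).const_mul a).div_const 2)).add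
            ((((hasDerivAt_id w).pow 3).const_mul b).div_const 6)
        exact (this.congr_deriv (by ring)).hasDerivWithinAt)
      (fun w hw => h1 w ⟨hw.1, hw.2.le⟩) (Set.right_mem_Icc.2 zero_le_one)
  linarith

lemma hasDerivAt_line (hf : Differentiable ℝ f) (x e : Param p) (w : ℝ) :
    HasDerivAt (fun w : ℝ => f (x + w • e)) (inner ℝ (∇ f (x + w • e)) e) w := by
  rw [inner_gradient]
  have h : HasDerivAt (fun w : ℝ => x + w • e) e w := by
    simpa using ((hasDerivAt_id w).smul_const e).const_add x
  exact (hf (x + w • e)).hasFDerivAt.comp_hasDerivAt w h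

lemma hasDerivAt_line_gradient (hf : Differentiable ℝ f) (hf' : Differentiable ℝ (fderiv ℝ f))
    (x e : Param p) (w : ℝ) :
    HasDerivAt (fun w : ℝ => inner ℝ (∇ f (x + w • e)) e) (quad (hess f (x + w • e)) e) w := by
  have h : HasDerivAt (fun w : ℝ => x + w • e) e w := by
    simpa using ((hasDerivAt_id w).smul_const e).const_add x
  have h2 := (hasFDerivAt_gradient hf hf' (x + w • e)).comp_hasDerivAt w h
  have h3 := h2.inner ℝ (hasDerivAt_const w e)
  refine h3.congr_deriv ?_
  simp [quad, mulVec_eq_toEuclideanCLM, real_inner_comm]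

/-- If the Hessian at the endpoint of an expansion is dominated, up to a factor `1 + L₁ ‖θ - θ'‖`,
by the Hessian at the Taylor point, then a Lipschitz bound for the second derivative of `f` along
segments depends on `L₁` and on the size of the Hessian only. -/
lemma quad_hess_sub_le_of_taylor (hf : Differentiable ℝ f) (hf' : Differentiable ℝ (fderiv ℝ f))
    {s : Set (Param p)} (hs : Convex ℝ s) {L₁ L₂ L₃ : ℝ} (hL₁ : 0 ≤ L₁)
    (htaylor : ∀ θ ∈ s, ∀ θ' ∈ s, ∃ φ : ℝ, 0 ≤ φ ∧ φ ≤ L₁ * ‖θ - θ'‖ ∧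
      ∃ θt ∈ segment ℝ θ θ', Loewner (hess f θ) ((1 + φ) • hess f θt) ∧
        f θ = f θ' + inner ℝ (∇ f θ') (θ - θ') + 1 / 2 * quad (hess f θt) (θ - θ'))
    (hbdd : ∀ θ ∈ s, specNorm (hess f θ) ≤ L₂)
    (hlip : ∀ θ ∈ s, ∀ θ' ∈ s, specNorm (hess f θ - hess f θ') ≤ L₃ * ‖θ - θ'‖)
    {x y a b : Param p} (hx : x ∈ s) (hy : y ∈ s) (ha : a ∈ segment ℝ x y)
    (hb : b ∈ segment ℝ x y) :
    quad (hess f a) (y - x) - quad (hess f b) (y - x) ≤ 3 / 2 * (L₁ * L₂ * ‖y - x‖ ^ 3) := by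
  set e := y - x with he
  set q : ℝ → ℝ := fun u => quad (hess f (x + u • e)) e with hq
  set c := L₁ * L₂ * ‖e‖ ^ 3 with hc
  have hmem : ∀ u ∈ Set.Icc (0 : ℝ) 1, x + u • e ∈ s := fun u hu =>
    hs.segment_subset hx hy (by rw [segment_eq_image']; exact ⟨u, hu, rfl⟩)
  -- Self-improvement. Write `d = u - u'`. If `q` is `K`-Lipschitz, the second-order remainder of
  -- `f` from `u'` to `u` is at most `d² (q u' / 2 + K |d| / 6)`; it also equals `d² / 2` times the
  -- form at the Taylor point `z`. So that form is at most `q u' + K |d| / 3`, and passing from `z`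
  -- back to `u` costs `φ` times the form, at most `c |d|`.
  have step : ∀ K : ℝ, (∀ u ∈ Set.Icc (0 : ℝ) 1, ∀ u' ∈ Set.Icc (0 : ℝ) 1,
      q u - q u' ≤ K * |u - u'|) → ∀ u ∈ Set.Icc (0 : ℝ) 1, ∀ u' ∈ Set.Icc (0 : ℝ) 1,
      q u - q u' ≤ (K / 3 + c) * |u - u'| := by
    intro K hK u hu u' hu'
    rcases eq_or_ne u u' with rfl | hne
    · simp
    set d := u - u' with hd
    have hd0 : d ≠ 0 := sub_ne_zero.2 hne
    have hd2 : 0 < d ^ 2 := by positivity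
    have hdiff : (x + u • e) - (x + u' • e) = d • e := by rw [hd, sub_smul]; abel
    obtain ⟨φ, hφ0, hφ, z, hz, hle, hexp⟩ := htaylor _ (hmem u hu) _ (hmem u' hu')
    have hzs : z ∈ s := hs.segment_subset (hmem u hu) (hmem u' hu') hz
    rw [hdiff] at hφ hexp
    rw [norm_smul, Real.norm_eq_abs] at hφ
    have hle' := hle.quad_le e
    rw [quad_smul_left] at hle'
    have hqz : |quad (hess f z) e| ≤ L₂ * ‖e‖ ^ 2 := (abs_quad_le _ _).trans
      (mul_le_mul_of_nonneg_right (hbdd z hzs) (sq_nonneg _))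
    have htay : f (x + u • e) - f (x + u' • e) - inner ℝ (∇ f (x + u' • e)) (d • e)
        ≤ d ^ 2 * q u' / 2 + d ^ 2 * (K * |d|) / 6 := by
      have h := taylor_le_of_second_deriv_le
        (hasDerivAt_line hf (x + u' • e) (d • e))
        (hasDerivAt_line_gradient hf hf' (x + u' • e) (d • e))
        (a := d ^ 2 * q u') (b := d ^ 2 * (K * |d|)) (fun w hw => ?_)
      · simp only [one_smul, zero_smul, add_zero] at h
        have h1 : x + u' • e + d • e = x + u • e := by rw [← hdiff]; abel
        rwa [h1] at h
      · have hpt : x + u' • e + w • d • e = x + (u' + w * d) • e := by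
          rw [add_smul, mul_smul, add_assoc]
        have hin : u' + w * d ∈ Set.Icc (0 : ℝ) 1 := by
          have : u' + w * d = (1 - w) * u' + w * u := by rw [hd]; ring
          rw [this]
          exact ⟨add_nonneg (mul_nonneg (by linarith [hw.2]) hu'.1) (mul_nonneg hw.1 hu.1), by
            nlinarith [hw.1, hw.2, hu.2, hu'.2]⟩
        rw [quad_smul_right, hpt]
        have := hK _ hin u' hu'
        rw [add_sub_cancel_left, abs_mul, abs_of_nonneg hw.1] at this
        have h2 : q (u' + w * d) ≤ q u' + K * |d| * w := by linarith
        calc d ^ 2 * q (u' + w * d) ≤ d ^ 2 * (q u' + K * |d| * w) :=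
              mul_le_mul_of_nonneg_left h2 hd2.le
          _ = _ := by ring
    rw [hexp, quad_smul_right] at htay
    have hz1 : quad (hess f z) e ≤ q u' + K * |d| / 3 := by
      refine le_of_mul_le_mul_left ?_ hd2
      linarith
    have hφq : φ * quad (hess f z) e ≤ c * |d| := by
      calc φ * quad (hess f z) e ≤ φ * (L₂ * ‖e‖ ^ 2) :=
            mul_le_mul_of_nonneg_left ((le_abs_self _).trans hqz) hφ0
        _ ≤ (L₁ * (|d| * ‖e‖)) * (L₂ * ‖e‖ ^ 2) :=
            mul_le_mul_of_nonneg_right hφ ((abs_nonneg _).trans hqz)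
        _ = c * |d| := by rw [hc]; ring
    have : q u ≤ (1 + φ) * quad (hess f z) e := hle'
    linarith
  have hbase : ∀ u ∈ Set.Icc (0 : ℝ) 1, ∀ u' ∈ Set.Icc (0 : ℝ) 1,
      q u - q u' ≤ (L₃ * ‖e‖ ^ 3) * |u - u'| := fun u hu u' hu' => by
    have hdiff : (x + u • e) - (x + u' • e) = (u - u') • e := by rw [sub_smul]; abel
    rw [hq]
    simp only
    rw [← quad_sub_left]
    refine (le_abs_self _).trans ((abs_quad_le _ _).trans ?_)
    have := hlip _ (hmem u hu) _ (hmem u' hu')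
    rw [hdiff, norm_smul, Real.norm_eq_abs] at this
    calc _ ≤ L₃ * (|u - u'| * ‖e‖) * ‖e‖ ^ 2 := mul_le_mul_of_nonneg_right this (sq_nonneg _)
      _ = _ := by ring
  -- The map `K ↦ K / 3 + c` contracts to `3 c / 2`. Started at the value coming from `L₃`, its
  -- iterates forget `L₃` in the limit.
  have hiter : ∀ n : ℕ, ∀ u ∈ Set.Icc (0 : ℝ) 1, ∀ u' ∈ Set.Icc (0 : ℝ) 1,
      q u - q u' ≤ (3 / 2 * c + (L₃ * ‖e‖ ^ 3 - 3 / 2 * c) * (1 / 3) ^ n) * |u - u'| := by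
    intro n
    induction n with
    | zero => simpa using hbase
    | succ n ih =>
      intro u hu u' hu'
      refine (step _ ih u hu u' hu').trans_eq ?_
      rw [pow_succ]; ring
  rw [segment_eq_image'] at ha hb
  obtain ⟨u, hu, rfl⟩ := ha
  obtain ⟨u', hu', rfl⟩ := hb
  have hlim : Filter.Tendsto
      (fun n : ℕ => (3 / 2 * c + (L₃ * ‖e‖ ^ 3 - 3 / 2 * c) * (1 / 3) ^ n) * |u - u'|)
      Filter.atTop (nhds ((3 / 2 * c + (L₃ * ‖e‖ ^ 3 - 3 / 2 * c) * 0) * |u - u'|)) :=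
    (((tendsto_pow_atTop_nhds_zero_of_lt_one (by norm_num) (by norm_num)).const_mul _).const_add
      _).mul_const _
  have hfin := ge_of_tendsto' hlim fun n => hiter n u hu u' hu'
  rw [mul_zero, add_zero] at hfin
  have hL₂ : 0 ≤ L₂ := (specNorm_nonneg _).trans (hbdd x hx)
  have hc0 : 0 ≤ c := by positivity
  have habs : |u - u'| ≤ 1 := abs_sub_le_iff.2 ⟨by linarith [hu.2, hu'.1], by linarith [hu'.2, hu.1]⟩
  exact hfin.trans (mul_le_of_le_one_right (by positivity) habs)

/-- The key inequality for one online Newton step from `y`, compared with the point `x`. -/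
lemma quad_hess_sub_inner_gradient_le (hf : Differentiable ℝ f)
    (hf' : Differentiable ℝ (fderiv ℝ f))
    {s : Set (Param p)} (hs : Convex ℝ s) {L₁ L₂ L₃ : ℝ} (hL₁ : 0 ≤ L₁)
    (htaylor : ∀ θ ∈ s, ∀ θ' ∈ s, ∃ φ : ℝ, 0 ≤ φ ∧ φ ≤ L₁ * ‖θ - θ'‖ ∧
      ∃ θt ∈ segment ℝ θ θ', Loewner (hess f θ) ((1 + φ) • hess f θt) ∧
        f θ = f θ' + inner ℝ (∇ f θ') (θ - θ') + 1 / 2 * quad (hess f θt) (θ - θ'))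
    (hbdd : ∀ θ ∈ s, specNorm (hess f θ) ≤ L₂)
    (hlip : ∀ θ ∈ s, ∀ θ' ∈ s, specNorm (hess f θ - hess f θ') ≤ L₃ * ‖θ - θ'‖)
    {x y : Param p} (hx : x ∈ s) (hy : y ∈ s) :
    quad (hess f y) (y - x) - 2 * inner ℝ (∇ f y) (y - x)
      ≤ 2 * (f x - f y) + 3 / 2 * (L₁ * L₂ * ‖y - x‖ ^ 3) := by
  obtain ⟨φ, -, -, z, hz, -, hexp⟩ := htaylor x hx y hy
  -- The expansion of `f x` around `y` is exact with the Hessian at `z`; replacing it by the Hessian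
  -- at `y` costs the cubic term.
  have h := quad_hess_sub_le_of_taylor hf hf' hs hL₁ htaylor hbdd hlip hx hy
    (right_mem_segment ℝ x y) hz
  have e1 : x - y = -(y - x) := by abel
  rw [e1, inner_neg_right, quad_neg_right] at hexp
  linarith

end Calculus

end OnlineBvM

namespace OnlineBvM

/-! ### Scalar inequalities for the growth rate and for power sums. -/

section ScalarBounds

/-- The growth rate `p log t + x` of the regret. -/
noncomputable def growth (p : ℕ) (x : ℝ) (t : ℕ) : ℝ := p * Real.log t + x

variable {p : ℕ} {x : ℝ}

/-- `log y / √y` decreases from `e²` on; this is the source of the threshold 8 for times. -/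
lemma exp_two_lt_eight : Real.exp 2 < 8 := by
  have h := Real.exp_one_lt_d9
  have : Real.exp 2 = Real.exp 1 ^ 2 := by rw [← Real.exp_nat_mul]; norm_num
  rw [this]
  nlinarith [Real.exp_pos 1]

lemma one_le_log_of_three_le {y : ℝ} (hy : 3 ≤ y) : 1 ≤ Real.log y := by
  rw [Real.le_log_iff_exp_le (by linarith)]
  linarith [Real.exp_one_lt_d9]

lemma growth_mono {s t : ℕ} (hs : 1 ≤ s) (hst : s ≤ t) :
    growth p x s ≤ growth p x t := by
  unfold growth
  have h1 : (0 : ℝ) < s := by exact_mod_cast hs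
  have h2 : (s : ℝ) ≤ t := by exact_mod_cast hst
  have := Real.log_le_log h1 h2
  gcongr

lemma one_le_growth (hp : 1 ≤ p) (hx : 0 < x) {t : ℕ} (ht : 3 ≤ t) : 1 ≤ growth p x t := by
  have h1 : (1 : ℝ) ≤ p := by exact_mod_cast hp
  have h2 := one_le_log_of_three_le (show (3 : ℝ) ≤ t by exact_mod_cast ht)
  unfold growth
  nlinarith

lemma dim_le_growth (hx : 0 < x) {t : ℕ} (ht : 3 ≤ t) : (p : ℝ) ≤ growth p x t := by
  have h1 : (0 : ℝ) ≤ p := p.cast_nonneg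
  have h2 := one_le_log_of_three_le (show (3 : ℝ) ≤ t by exact_mod_cast ht)
  unfold growth
  nlinarith

lemma log_add_le_growth (hp : 1 ≤ p) {t : ℕ} (ht : 3 ≤ t) :
    x + Real.log t ≤ growth p x t := by
  have h1 : (1 : ℝ) ≤ p := by exact_mod_cast hp
  have h2 := one_le_log_of_three_le (show (3 : ℝ) ≤ t by exact_mod_cast ht)
  unfold growth
  nlinarith

lemma rate_le_two_growth (hp : 1 ≤ p) (hx : 0 < x) {t : ℕ} (ht : 3 ≤ t) :
    p + Real.log t + x ≤ 2 * growth p x t := by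
  have := dim_le_growth (p := p) hx ht
  have := log_add_le_growth (x := x) hp ht
  linarith

/-- `(p log s + x) / √s` is non-increasing. -/
lemma growth_div_sqrt_anti (hx : 0 < x) {s t : ℕ} (hs : 8 ≤ s) (hst : s ≤ t) :
    growth p x t / √t ≤ growth p x s / √s := by
  have hs' : (8 : ℝ) ≤ s := by exact_mod_cast hs
  have hst' : (s : ℝ) ≤ t := by exact_mod_cast hst
  have h1 := Real.log_div_sqrt_antitoneOn (a := (s : ℝ)) (b := t)
    (show Real.exp 2 ≤ (s : ℝ) by linarith [exp_two_lt_eight])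
    (show Real.exp 2 ≤ (t : ℝ) by linarith [exp_two_lt_eight]) hst'
  have h2 : x / √t ≤ x / √s :=
    div_le_div_of_nonneg_left hx.le (Real.sqrt_pos.2 (by linarith)) (Real.sqrt_le_sqrt hst')
  unfold growth
  rw [add_div, add_div, mul_div_assoc, mul_div_assoc]
  have : (p : ℝ) * (Real.log t / √t) ≤ p * (Real.log s / √s) :=
    mul_le_mul_of_nonneg_left h1 p.cast_nonneg
  linarith

/-- Besides the bound by `η` there is a decay `√(s / t)`, one half power of the time. This decay
makes the sum of cubed errors converge with a small constant. -/
lemma growth_div_le (hx : 0 < x) {s t : ℕ} (hs : 8 ≤ s) (hst : s ≤ t) {η : ℝ}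
    (hη : growth p x s ≤ η * s) : growth p x t / t ≤ η * (√s / √t) := by
  have hs' : (8 : ℝ) ≤ s := by exact_mod_cast hs
  have hst' : (s : ℝ) ≤ t := by exact_mod_cast hst
  have hts : 0 < √(t : ℝ) := Real.sqrt_pos.2 (by linarith)
  have hss : 0 < √(s : ℝ) := Real.sqrt_pos.2 (by linarith)
  have h := growth_div_sqrt_anti (p := p) hx hs hst
  have h2 : growth p x s / √s ≤ η * √s := by
    rw [div_le_iff₀ hss, mul_assoc, Real.mul_self_sqrt (by linarith)]
    exact hη
  calc growth p x t / t = growth p x t / √t / √t := by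
        rw [div_div, Real.mul_self_sqrt (by linarith)]
    _ ≤ η * √s / √t := by gcongr; exact h.trans h2
    _ = _ := by ring

lemma growth_le_of_le (hp : 1 ≤ p) (hx : 0 < x) {s t : ℕ} (hs : 8 ≤ s) (hst : s ≤ t) {η : ℝ}
    (hη : growth p x s ≤ η * s) : growth p x t / t ≤ η := by
  have hs' : (8 : ℝ) ≤ s := by exact_mod_cast hs
  have hst' : (s : ℝ) ≤ t := by exact_mod_cast hst
  have h1 := one_le_growth hp hx (t := s) (by omega)
  have hη0 : 0 ≤ η := by
    by_contra h
    push Not at h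
    nlinarith
  refine (growth_div_le hx hs hst hη).trans (mul_le_of_le_one_right hη0 ?_)
  exact div_le_one_of_le₀ (Real.sqrt_le_sqrt hst') (Real.sqrt_nonneg _)

/-- The warm-start condition makes `(p log t₀ + x) / t₀` small. -/
lemma growth_le_of_warm_start (hp : 1 ≤ p) (hx : 0 < x) {t₀ : ℕ} {η M : ℝ} (hη : 0 < η)
    (hη1 : η ≤ 1) (hM : M = 25 / η ^ 2)
    (ht₀ : M * (p * Real.log (max (p : ℝ) 3) + x) ≤ t₀) :
    8 ≤ t₀ ∧ growth p x t₀ ≤ η * t₀ := by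
  have hp' : (1 : ℝ) ≤ p := by exact_mod_cast hp
  set y := Real.log (max (p : ℝ) 3) with hy
  have hy1 : 1 ≤ y := one_le_log_of_three_le (le_max_right _ _)
  set q := (p : ℝ) * y with hq
  have hqp : (p : ℝ) ≤ q := by nlinarith
  have hq0 : 0 < q := by linarith
  have hη2 : η ^ 2 ≤ 1 := by nlinarith
  have hM25 : 25 ≤ M := by
    rw [hM, le_div_iff₀ (by positivity)]; linarith
  have hM0 : 0 < M := by linarith
  set T := M * (q + x) with hT
  have hMT : M ≤ T := by nlinarith
  have hT0 : 0 < T := by linarith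
  have ht0 : (25 : ℝ) ≤ t₀ := by linarith
  have hsqrtM : √M = 5 / η := by
    rw [hM, Real.sqrt_div (by norm_num), Real.sqrt_sq hη.le]
    congr 1
    rw [show (25 : ℝ) = 5 ^ 2 by norm_num, Real.sqrt_sq (by norm_num)]
  have hlogM : Real.log M ≤ 2 * √M := by
    have h := Real.log_le_sub_one_of_pos (Real.sqrt_pos.2 hM0)
    rw [Real.log_sqrt hM0.le] at h
    linarith
  have hηM : η * M = 25 / η := by rw [hM]; field_simp
  -- With `M = 25 / η²` this reads `10 / η + 2 ≤ 25 / η`. The choice of 25 leaves room for `log M ≤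
  -- 2 √M` and for the logarithm of `q + x`.
  have hηM2 : 2 * √M + 2 ≤ η * M := by
    rw [hηM, hsqrtM, ← sub_nonneg]
    have : 25 / η - (2 * (5 / η) + 2) = (15 - 2 * η) / η := by field_simp; ring
    rw [this]
    exact div_nonneg (by linarith) hη.le
  have hlogq : Real.log q ≤ 2 * y := by
    rw [hq, Real.log_mul (by positivity) (by positivity)]
    have h1 : Real.log p ≤ y := Real.log_le_log (by positivity) (le_max_left _ _)
    have h2 := Real.log_le_sub_one_of_pos (show 0 < y by linarith)
    linarith
  have hlogqx : Real.log (q + x) ≤ 2 * y + x / q := by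
    have h1 : q + x = q * (1 + x / q) := by field_simp
    rw [h1, Real.log_mul hq0.ne' (by positivity)]
    have h2 := Real.log_le_sub_one_of_pos (show 0 < 1 + x / q by positivity)
    linarith
  have hpx : (p : ℝ) * (x / q) ≤ x := by
    rw [mul_div_assoc', div_le_iff₀ hq0]; nlinarith
  have hlogT : p * Real.log T + x ≤ η * T := by
    rw [hT, Real.log_mul hM0.ne' (by positivity)]
    have h1 : p * Real.log M ≤ p * (2 * √M) := mul_le_mul_of_nonneg_left hlogM (by linarith)
    have h2 : p * Real.log (q + x) ≤ p * (2 * y + x / q) :=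
      mul_le_mul_of_nonneg_left hlogqx (by linarith)
    have h3 : p * (2 * √M) ≤ q * (2 * √M) := mul_le_mul_of_nonneg_right hqp (by positivity)
    have h4 : (2 * √M + 2) * (q + x) ≤ η * M * (q + x) :=
      mul_le_mul_of_nonneg_right hηM2 (by positivity)
    have h5 : 0 ≤ √M * x := by positivity
    nlinarith
  have hexp : Real.exp 1 ≤ 25 := by linarith [Real.exp_one_lt_d9]
  -- The bound at the threshold `T` passes to every `t₀ ≥ T` because `log y / y` and `x / y`
  -- decrease.
  have hanti := Real.log_div_self_antitoneOn (a := T) (b := t₀)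
    (show Real.exp 1 ≤ T by linarith) (show Real.exp 1 ≤ (t₀ : ℝ) by linarith) ht₀
  refine ⟨by exact_mod_cast (show (8 : ℝ) ≤ t₀ by linarith), ?_⟩
  simp only at hanti
  have h6 : Real.log t₀ ≤ t₀ * (Real.log T / T) := by
    rw [div_le_iff₀ (by linarith)] at hanti
    linarith
  have h7 : x ≤ t₀ * (x / T) := by
    rw [mul_div_assoc', le_div_iff₀ hT0]; nlinarith
  unfold growth
  calc p * Real.log t₀ + x ≤ p * (t₀ * (Real.log T / T)) + t₀ * (x / T) := by gcongr
    _ = t₀ * ((p * Real.log T + x) / T) := by ring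
    _ ≤ t₀ * η := by
        gcongr
        rwa [div_le_iff₀ hT0]
    _ = η * t₀ := by ring

/-- Discrete comparison with a primitive `b`; each of the power sums below is an instance. -/
lemma sum_Ico_le_sub_of_step {a b : ℕ → ℝ} {m : ℕ} (h : ∀ s, m ≤ s → a s ≤ b (s + 1) - b s)
    {t : ℕ} (ht : m ≤ t) : ∑ s ∈ Finset.Ico m t, a s ≤ b t - b m := by
  induction t, ht using Nat.le_induction with
  | base => simp
  | succ n hn ih =>
    rw [Finset.sum_Ico_succ_top hn]
    linarith [h n hn]

/-- The integral of `s^{-5/4}` would give the constant 4; the discrete step costs a factor 2,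
through `s + 1 ≤ 2 s`. The proof factors `b⁴ - a⁴ = 1` for consecutive fourth roots. -/
lemma sum_inv_mul_sqrt_sqrt_le {m t : ℕ} (hm : 1 ≤ m) (hmt : m ≤ t) :
    ∑ s ∈ Finset.Ico m t, 1 / ((s : ℝ) * √√s) ≤ 8 / √√m := by
  refine (sum_Ico_le_sub_of_step (b := fun s => -(8 / √√(s : ℝ))) (fun s hs => ?_) hmt).trans ?_
  · have hs' : (1 : ℝ) ≤ s := by exact_mod_cast hm.trans hs
    set a := √√(s : ℝ) with ha
    set b := √√((s + 1 : ℕ) : ℝ) with hb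
    have ha0 : 0 < a := Real.sqrt_pos.2 (Real.sqrt_pos.2 (by linarith))
    have hb0 : 0 < b := Real.sqrt_pos.2 (Real.sqrt_pos.2 (by positivity))
    have ha4 : a ^ 4 = s := by
      rw [show a ^ 4 = (a ^ 2) ^ 2 by ring, ha, Real.sq_sqrt (Real.sqrt_nonneg _),
        Real.sq_sqrt (by linarith)]
    have hb4 : b ^ 4 = s + 1 := by
      rw [show b ^ 4 = (b ^ 2) ^ 2 by ring, hb, Real.sq_sqrt (Real.sqrt_nonneg _),
        Real.sq_sqrt (by positivity)]
      push_cast; ring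
    have hab : a ≤ b := Real.sqrt_le_sqrt (Real.sqrt_le_sqrt (by push_cast; linarith))
    have hfac : (b - a) * (b ^ 3 + b ^ 2 * a + b * a ^ 2 + a ^ 3) = 1 := by
      have : (b - a) * (b ^ 3 + b ^ 2 * a + b * a ^ 2 + a ^ 3) = b ^ 4 - a ^ 4 := by ring
      rw [this, ha4, hb4]; ring
    have hle : b ^ 3 + b ^ 2 * a + b * a ^ 2 + a ^ 3 ≤ 4 * b ^ 3 := by
      have h1 : b ^ 2 * a ≤ b ^ 2 * b := by gcongr
      have h2 : b * a ^ 2 ≤ b * b ^ 2 := by gcongr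
      have h3 : a ^ 3 ≤ b ^ 3 := by gcongr
      linarith
    have h1 : 1 ≤ (b - a) * (4 * b ^ 3) := by
      rw [← hfac]; exact mul_le_mul_of_nonneg_left hle (by linarith)
    have h2 : b ^ 4 ≤ 2 * a ^ 4 := by rw [ha4, hb4]; linarith
    have e : -(8 / b) - -(8 / a) = 8 * (b - a) / (a * b) := by field_simp; ring
    rw [e, ← ha4, div_le_div_iff₀ (by positivity) (by positivity)]
    calc 1 * (a * b) ≤ (b - a) * (4 * b ^ 3) * (a * b) :=
          mul_le_mul_of_nonneg_right h1 (by positivity)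
      _ = 4 * (b - a) * a * b ^ 4 := by ring
      _ ≤ 4 * (b - a) * a * (2 * a ^ 4) :=
          mul_le_mul_of_nonneg_left h2 (by
            have : 0 ≤ b - a := by linarith
            positivity)
      _ = 8 * (b - a) * (a ^ 4 * a) := by ring
  · have : 0 ≤ 8 / √√(t : ℝ) := by positivity
    linarith

lemma sum_one_div_sqrt_le {m t : ℕ} (hm : 1 ≤ m) (hmt : m ≤ t) :
    ∑ s ∈ Finset.Ico m t, 1 / √(s : ℝ) ≤ 3 * √t := by
  refine (sum_Ico_le_sub_of_step (b := fun s => 3 * √(s : ℝ)) (fun s hs => ?_) hmt).trans ?_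
  · have hs' : (1 : ℝ) ≤ s := by exact_mod_cast hm.trans hs
    have ha0 : 0 < √(s : ℝ) := Real.sqrt_pos.2 (by linarith)
    have ha := Real.sq_sqrt (show (0 : ℝ) ≤ s by linarith)
    have hb := Real.sq_sqrt (show (0 : ℝ) ≤ (s + 1 : ℕ) by positivity)
    have hb0 := Real.sqrt_nonneg ((s + 1 : ℕ) : ℝ)
    push_cast at hb hb0 ⊢
    rw [div_le_iff₀ ha0]
    have h : √((s : ℝ) + 1) ≤ 2 * √s := by
      refine (sq_le_sq₀ hb0 (by positivity)).1 ?_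
      nlinarith
    nlinarith
  · have := Real.sqrt_nonneg (m : ℝ)
    linarith

lemma sum_one_div_le {m t : ℕ} (hm : 1 ≤ m) (hmt : m ≤ t) :
    ∑ s ∈ Finset.Ico m t, 1 / (s : ℝ) ≤ 2 * Real.log ((t : ℝ) / m) := by
  refine (sum_Ico_le_sub_of_step (b := fun s => 2 * Real.log (s : ℝ)) (fun s hs => ?_)
    hmt).trans ?_
  · have hs' : (1 : ℝ) ≤ s := by exact_mod_cast hm.trans hs
    have h := Real.one_sub_inv_le_log_of_pos (show (0 : ℝ) < ((s + 1 : ℕ) : ℝ) / s by positivity)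
    rw [Real.log_div (by positivity) (by positivity), inv_div] at h
    have h2 : 1 / (s : ℝ) ≤ 2 * (1 - s / ((s + 1 : ℕ) : ℝ)) := by
      push_cast
      rw [one_sub_div (by positivity), mul_div_assoc', div_le_div_iff₀ (by positivity)
        (by positivity)]
      linarith
    linarith
  · have hm' : (0 : ℝ) < m := by exact_mod_cast hm
    have ht' : (0 : ℝ) < t := by exact_mod_cast hm.trans hmt
    rw [Real.log_div ht'.ne' hm'.ne']
    linarith

end ScalarBounds

end OnlineBvM

namespace OnlineBvM

/-! ### The recursion of the one-pass algorithm. -/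

section Recursion

variable {p : ℕ} (ℓ : ℕ → Param p → ℝ) (θ₀ : Param p) (Ω₀ : Mat p) (t₀ : ℕ)

lemma alg_of_le {t : ℕ} (ht : 1 ≤ t) (h : t ≤ t₀) :
    alg ℓ θ₀ Ω₀ t₀ t
      = (mapEst ℓ θ₀ Ω₀ t, Ω₀ + fisher ℓ t (mapEst ℓ θ₀ Ω₀ t)) := by
  obtain ⟨n, rfl⟩ : ∃ n, t = n + 1 := ⟨t - 1, by omega⟩
  rw [alg, if_pos h]

lemma algΩ_succ {t : ℕ} (h : t₀ ≤ t) :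
    algΩ ℓ θ₀ Ω₀ t₀ (t + 1)
      = algΩ ℓ θ₀ Ω₀ t₀ t + hess (ℓ (t + 1)) (algθ ℓ θ₀ Ω₀ t₀ t) := by
  rw [algΩ, alg, if_neg (by omega)]
  rfl

lemma algθ_succ {t : ℕ} (h : t₀ ≤ t) :
    algθ ℓ θ₀ Ω₀ t₀ (t + 1) = algθ ℓ θ₀ Ω₀ t₀ t
      - mulVec (algΩ ℓ θ₀ Ω₀ t₀ (t + 1))⁻¹ (∇ (ℓ (t + 1)) (algθ ℓ θ₀ Ω₀ t₀ t)) := by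
  rw [algΩ_succ ℓ θ₀ Ω₀ t₀ h, algθ, alg, if_neg (by omega)]
  rfl

lemma algθ_warm (h : 1 ≤ t₀) : algθ ℓ θ₀ Ω₀ t₀ t₀ = mapEst ℓ θ₀ Ω₀ t₀ := by
  rw [algθ, alg_of_le ℓ θ₀ Ω₀ t₀ h le_rfl]

/-- The precision matrix is a sum of Hessians at the linearization points: the warm start for
`s ≤ t₀`, the previous iterate for `s > t₀`. -/
lemma algΩ_eq_sum (h : 1 ≤ t₀) {t : ℕ} (ht : t₀ ≤ t) :
    algΩ ℓ θ₀ Ω₀ t₀ t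
      = Ω₀ + ∑ s ∈ Finset.Icc 1 t, hess (ℓ s) (algθ ℓ θ₀ Ω₀ t₀ (max (s - 1) t₀)) := by
  induction t, ht using Nat.le_induction with
  | base =>
    rw [algΩ, alg_of_le ℓ θ₀ Ω₀ t₀ h le_rfl]
    simp only [fisher]
    congr 1
    refine Finset.sum_congr rfl fun s hs => ?_
    rw [max_eq_right (by have := (Finset.mem_Icc.1 hs).2; omega), algθ_warm ℓ θ₀ Ω₀ t₀ h]
  | succ n hn ih =>
    rw [algΩ_succ ℓ θ₀ Ω₀ t₀ hn, ih, Finset.sum_Icc_succ_top (by omega), add_assoc,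
      Nat.add_sub_cancel, max_eq_left hn]

end Recursion

/-- The assumptions along one path of losses, on the events where the bounds hold. -/
structure PathBounds {p : ℕ} (ℓ : ℕ → Param p → ℝ) (θstar θ₀ : Param p) (Ω₀ : Mat p) (t₀ : ℕ)
    (r x K₂ K₃ K₄ K₅ L₁ L₂ L₃ lam C : ℝ) : Prop where
  dim : 1 ≤ p
  eight_le : 8 ≤ t₀
  x_pos : 0 < x
  r_pos : 0 < r
  K₂_pos : 0 < K₂
  K₃_pos : 0 < K₃
  K₄_pos : 0 < K₄
  K₅_nonneg : 0 ≤ K₅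
  L₁_nonneg : 0 ≤ L₁
  L₂_pos : 0 < L₂
  L₃_pos : 0 < L₃
  lam_pos : 0 < lam
  C_pos : 0 < C
  prior_posDef : Ω₀.PosDef
  prior_le : Loewner Ω₀ (lam • (1 : Mat p))
  diff : ∀ t, 1 ≤ t → Differentiable ℝ (ℓ t)
  diff_fderiv : ∀ t, 1 ≤ t → Differentiable ℝ (fderiv ℝ (ℓ t))
  info : ∀ t : ℕ, t₀ ≤ t → ∀ θbar : ℕ → Param p,
    (∀ s ∈ Finset.Icc 1 t, θbar s ∈ localSet θstar r) →
      Loewner ((K₂ * t) • (1 : Mat p)) (∑ s ∈ Finset.Icc 1 t, hess (ℓ s) (θbar s))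
  taylor : ∀ t, 1 ≤ t → ∀ θ ∈ localSet θstar r, ∀ θ' ∈ localSet θstar r,
    ∃ φ : ℝ, 0 ≤ φ ∧ φ ≤ L₁ * ‖θ - θ'‖ ∧
      ∃ θt ∈ segment ℝ θ θ', Loewner (hess (ℓ t) θ) ((1 + φ) • hess (ℓ t) θt) ∧
        ℓ t θ = ℓ t θ' + inner ℝ (∇ (ℓ t) θ') (θ - θ') + 1 / 2 * quad (hess (ℓ t) θt) (θ - θ')
  bounded : ∀ t, 1 ≤ t → ∀ θ ∈ localSet θstar r, specNorm (hess (ℓ t) θ) ≤ L₂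
  lipschitz : ∀ t, 1 ≤ t → ∀ θ ∈ localSet θstar r, ∀ θ' ∈ localSet θstar r,
    specNorm (hess (ℓ t) θ - hess (ℓ t) θ') ≤ L₃ * ‖θ - θ'‖
  regret : ∀ t : ℕ, t₀ < t →
    ∑ s ∈ Finset.Icc (t₀ + 1) t, (ℓ s θstar - ℓ s (algθ ℓ θ₀ Ω₀ t₀ (s - 1))) ≤ K₃ * x
  grad : ∀ t : ℕ, t₀ < t → (∀ s, t₀ < s → s < t → algθ ℓ θ₀ Ω₀ t₀ s ∈ localSet θstar r) →
    ∑ s ∈ Finset.Icc (t₀ + 1) t, quad (algΩ ℓ θ₀ Ω₀ t₀ s)⁻¹ (algGrad ℓ θ₀ Ω₀ t₀ s)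
      ≤ K₄ * p * Real.log t + K₅ * (x + Real.log t)
  map_min : ∀ t : ℕ, t₀ ≤ t → IsArgmin (mapLoss ℓ θ₀ Ω₀ t) (mapEst ℓ θ₀ Ω₀ t)
  mle_min : ∀ t : ℕ, t₀ ≤ t → IsArgmin (batchLoss ℓ t) (mle ℓ t)
  map_rate : ∀ t : ℕ, t₀ ≤ t → ‖mapEst ℓ θ₀ Ω₀ t - θstar‖ ≤ C * √((p + Real.log t + x) / t)
  mle_rate : ∀ t : ℕ, t₀ ≤ t → ‖mle ℓ t - θstar‖ ≤ C * √((p + Real.log t + x) / t)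

lemma convex_localSet {p : ℕ} (θstar : Param p) (r : ℝ) : Convex ℝ (localSet θstar r) := by
  have : localSet θstar r = Metric.closedBall θstar r := by
    ext θ; simp [localSet, dist_eq_norm]
  rw [this]
  exact convex_closedBall _ _

/-! ### Energy of the iterates along one path. -/

namespace PathBounds

variable {p : ℕ} {ℓ : ℕ → Param p → ℝ} {θstar θ₀ : Param p} {Ω₀ : Mat p} {t₀ : ℕ}
  {r x K₂ K₃ K₄ K₅ L₁ L₂ L₃ lam C : ℝ}

lemma star_mem (h : PathBounds ℓ θstar θ₀ Ω₀ t₀ r x K₂ K₃ K₄ K₅ L₁ L₂ L₃ lam C) :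
    θstar ∈ localSet θstar r := by
  simp [localSet, h.r_pos.le]

/-- Since `log t ≥ 1`, the quantity `p + log t + x` is at most `2 (p log t + x)`, which expresses
the batch rate in units of `growth`. -/
lemma rate_sq_le (h : PathBounds ℓ θstar θ₀ Ω₀ t₀ r x K₂ K₃ K₄ K₅ L₁ L₂ L₃ lam C) {θ : Param p}
    {t : ℕ} (ht : t₀ ≤ t) (hθ : ‖θ - θstar‖ ≤ C * √((p + Real.log t + x) / t)) :
    ‖θ - θstar‖ ^ 2 ≤ 2 * C ^ 2 * (growth p x t / t) := by
  have h8 := h.eight_le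
  have ht1 : (1 : ℝ) ≤ t := by exact_mod_cast (by omega : 1 ≤ t)
  have hlog := Real.log_nonneg ht1
  have hx := h.x_pos
  calc ‖θ - θstar‖ ^ 2 ≤ (C * √((p + Real.log t + x) / t)) ^ 2 :=
        pow_le_pow_left₀ (norm_nonneg _) hθ 2
    _ = C ^ 2 * ((p + Real.log t + x) / t) := by
        rw [mul_pow, Real.sq_sqrt (by positivity)]
    _ ≤ C ^ 2 * (2 * growth p x t / t) := by
        gcongr
        exact rate_le_two_growth h.dim hx (by omega)
    _ = _ := by ring

lemma mem_localSet_of_rate (h : PathBounds ℓ θstar θ₀ Ω₀ t₀ r x K₂ K₃ K₄ K₅ L₁ L₂ L₃ lam C)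
    {η : ℝ} (hη : growth p x t₀ ≤ η * t₀) (hr : 2 * C ^ 2 * η ≤ r ^ 2) {θ : Param p}
    {t : ℕ} (ht : t₀ ≤ t) (hθ : ‖θ - θstar‖ ≤ C * √((p + Real.log t + x) / t)) :
    θ ∈ localSet θstar r := by
  refine (sq_le_sq₀ (norm_nonneg _) h.r_pos.le).1 ((h.rate_sq_le ht hθ).trans (le_trans ?_ hr))
  exact mul_le_mul_of_nonneg_left (growth_le_of_le h.dim h.x_pos h.eight_le ht hη) (by positivity)

lemma algΩ_isHermitian (h : PathBounds ℓ θstar θ₀ Ω₀ t₀ r x K₂ K₃ K₄ K₅ L₁ L₂ L₃ lam C) {t : ℕ}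
    (ht : t₀ ≤ t) : (algΩ ℓ θ₀ Ω₀ t₀ t).IsHermitian := by
  have h8 := h.eight_le
  rw [algΩ_eq_sum ℓ θ₀ Ω₀ t₀ (by omega) ht]
  refine h.prior_posDef.isHermitian.add ?_
  rw [Matrix.IsHermitian, Matrix.conjTranspose_sum]
  exact Finset.sum_congr rfl fun s hs =>
    hess_isHermitian (h.diff s (Finset.mem_Icc.1 hs).1) (h.diff_fderiv s (Finset.mem_Icc.1 hs).1) _

/-- The prior only helps, and the information bound allows a different point for each loss. Only
iterates strictly before `t` enter `Ω_t`, so nothing about `θ_t` itself is required; the induction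
in `localization` relies on this. -/
lemma le_quad_algΩ (h : PathBounds ℓ θstar θ₀ Ω₀ t₀ r x K₂ K₃ K₄ K₅ L₁ L₂ L₃ lam C) {t : ℕ}
    (ht : t₀ ≤ t) (hmem₀ : algθ ℓ θ₀ Ω₀ t₀ t₀ ∈ localSet θstar r)
    (hmem : ∀ s, t₀ ≤ s → s < t → algθ ℓ θ₀ Ω₀ t₀ s ∈ localSet θstar r) (v : Param p) :
    K₂ * t * ‖v‖ ^ 2 ≤ quad (algΩ ℓ θ₀ Ω₀ t₀ t) v := by
  have h8 := h.eight_le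
  have hinfo := (h.info t ht (fun s => algθ ℓ θ₀ Ω₀ t₀ (max (s - 1) t₀)) fun s hs => by
    have hs := Finset.mem_Icc.1 hs
    rcases le_or_gt (s - 1) t₀ with h1 | h1
    · rw [max_eq_right h1]; exact hmem₀
    · rw [max_eq_left h1.le]; exact hmem _ h1.le (by omega)).quad_le v
  rw [quad_smul_one] at hinfo
  rw [algΩ_eq_sum ℓ θ₀ Ω₀ t₀ (by omega) ht, quad_add_left]
  have := quad_nonneg_of_posSemidef h.prior_posDef.posSemidef v
  linarith

lemma algΩ_posDef (h : PathBounds ℓ θstar θ₀ Ω₀ t₀ r x K₂ K₃ K₄ K₅ L₁ L₂ L₃ lam C) {t : ℕ}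
    (ht : t₀ ≤ t) (hmem₀ : algθ ℓ θ₀ Ω₀ t₀ t₀ ∈ localSet θstar r)
    (hmem : ∀ s, t₀ ≤ s → s < t → algθ ℓ θ₀ Ω₀ t₀ s ∈ localSet θstar r) :
    (algΩ ℓ θ₀ Ω₀ t₀ t).PosDef := by
  have h8 := h.eight_le
  have ht0 : (0 : ℝ) < t := by exact_mod_cast (by omega : 0 < t)
  exact posDef_of_le_quad (h.algΩ_isHermitian ht) (mul_pos h.K₂_pos ht0)
    (h.le_quad_algΩ ht hmem₀ hmem)

lemma mulVec_algΩ_inv (h : PathBounds ℓ θstar θ₀ Ω₀ t₀ r x K₂ K₃ K₄ K₅ L₁ L₂ L₃ lam C) {t : ℕ}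
    (ht : t₀ ≤ t) (hmem₀ : algθ ℓ θ₀ Ω₀ t₀ t₀ ∈ localSet θstar r)
    (hmem : ∀ s, t₀ ≤ s → s < t → algθ ℓ θ₀ Ω₀ t₀ s ∈ localSet θstar r) (v : Param p) :
    mulVec (algΩ ℓ θ₀ Ω₀ t₀ t) (mulVec (algΩ ℓ θ₀ Ω₀ t₀ t)⁻¹ v) = v := by
  rw [mulVec_mulVec, Matrix.mul_nonsing_inv _ ((Matrix.isUnit_iff_isUnit_det _).1
    (h.algΩ_posDef ht hmem₀ hmem).isUnit), one_mulVec]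

/-- One step of the recursion for `‖Ω_t^{1/2} (θ_t - θ⋆)‖²`. -/
lemma energy_succ_le (h : PathBounds ℓ θstar θ₀ Ω₀ t₀ r x K₂ K₃ K₄ K₅ L₁ L₂ L₃ lam C) {t : ℕ}
    (ht : t₀ ≤ t)
    (hmem : ∀ s, t₀ ≤ s → s ≤ t → algθ ℓ θ₀ Ω₀ t₀ s ∈ localSet θstar r) :
    quad (algΩ ℓ θ₀ Ω₀ t₀ (t + 1)) (algθ ℓ θ₀ Ω₀ t₀ (t + 1) - θstar)
      ≤ quad (algΩ ℓ θ₀ Ω₀ t₀ t) (algθ ℓ θ₀ Ω₀ t₀ t - θstar)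
        + 2 * (ℓ (t + 1) θstar - ℓ (t + 1) (algθ ℓ θ₀ Ω₀ t₀ t))
        + quad (algΩ ℓ θ₀ Ω₀ t₀ (t + 1))⁻¹ (algGrad ℓ θ₀ Ω₀ t₀ (t + 1))
        + 3 / 2 * (L₁ * L₂ * ‖algθ ℓ θ₀ Ω₀ t₀ t - θstar‖ ^ 3) := by
  have hinv := h.mulVec_algΩ_inv (t := t + 1) (by omega) (hmem t₀ le_rfl ht)
    (fun s h1 h2 => hmem s h1 (by omega)) (∇ (ℓ (t + 1)) (algθ ℓ θ₀ Ω₀ t₀ t))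
  have hherm := h.algΩ_isHermitian (t := t + 1) (by omega)
  have hstep := quad_hess_sub_inner_gradient_le (h.diff (t + 1) (by omega))
    (h.diff_fderiv (t + 1) (by omega)) (convex_localSet θstar r) h.L₁_nonneg
    (h.taylor (t + 1) (by omega)) (h.bounded (t + 1) (by omega)) (h.lipschitz (t + 1) (by omega))
    h.star_mem (hmem t ht le_rfl)
  have hΩ := algΩ_succ ℓ θ₀ Ω₀ t₀ ht
  rw [algθ_succ ℓ θ₀ Ω₀ t₀ ht, algGrad, Nat.add_sub_cancel]
  set θ := algθ ℓ θ₀ Ω₀ t₀ t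
  set g := ∇ (ℓ (t + 1)) θ
  set Ω' := algΩ ℓ θ₀ Ω₀ t₀ (t + 1)
  set d := mulVec Ω'⁻¹ g with hd
  -- As `Ω' d = g`, the cross term is `-2 ⟨g, θ - θ⋆⟩` and the square of the step is `⟨g, Ω'⁻¹ g⟩`.
  have hsplit : quad Ω' (θ - d - θstar) = quad Ω' (θ - θstar) - 2 * inner ℝ g (θ - θstar)
      + quad Ω'⁻¹ g := by
    have e1 : θ - d - θstar = (θ - θstar) - d := by abel
    rw [e1]
    unfold quad
    rw [mulVec_sub_right, hinv, inner_sub_left, inner_sub_right, inner_sub_right,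
      ← inner_mulVec_comm hherm d, hinv, real_inner_comm g (θ - θstar), real_inner_comm d g]
    ring
  have hquad : quad Ω' (θ - θstar)
      = quad (algΩ ℓ θ₀ Ω₀ t₀ t) (θ - θstar) + quad (hess (ℓ (t + 1)) θ) (θ - θstar) := by
    rw [← quad_add_left, ← hΩ]
  rw [hsplit, hquad]
  linarith

/-- The summed recursion. -/
lemma energy_le_sum (h : PathBounds ℓ θstar θ₀ Ω₀ t₀ r x K₂ K₃ K₄ K₅ L₁ L₂ L₃ lam C) {t : ℕ}
    (ht : t₀ ≤ t)
    (hmem : ∀ s, t₀ ≤ s → s < t → algθ ℓ θ₀ Ω₀ t₀ s ∈ localSet θstar r) :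
    quad (algΩ ℓ θ₀ Ω₀ t₀ t) (algθ ℓ θ₀ Ω₀ t₀ t - θstar)
      ≤ quad (algΩ ℓ θ₀ Ω₀ t₀ t₀) (algθ ℓ θ₀ Ω₀ t₀ t₀ - θstar)
        + 2 * ∑ s ∈ Finset.Icc (t₀ + 1) t, (ℓ s θstar - ℓ s (algθ ℓ θ₀ Ω₀ t₀ (s - 1)))
        + ∑ s ∈ Finset.Icc (t₀ + 1) t, quad (algΩ ℓ θ₀ Ω₀ t₀ s)⁻¹ (algGrad ℓ θ₀ Ω₀ t₀ s)
        + 3 / 2 * (L₁ * L₂ * ∑ s ∈ Finset.Ico t₀ t, ‖algθ ℓ θ₀ Ω₀ t₀ s - θstar‖ ^ 3) := by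
  induction t, ht using Nat.le_induction with
  | base => simp
  | succ n hn ih =>
    have h1 := ih fun s hs1 hs2 => hmem s hs1 (by omega)
    have h2 := h.energy_succ_le hn fun s hs1 hs2 => hmem s hs1 (by omega)
    rw [Finset.sum_Icc_succ_top (by omega), Finset.sum_Icc_succ_top (by omega),
      Finset.sum_Ico_succ_top hn, Nat.add_sub_cancel]
    linarith

/-- Positivity of the form of `Ω₀` at `lam v - Ω₀ v`, together with `Ω₀ ≼ lam`, gives `‖Ω₀ v‖² ≤
lam² ‖v‖²`. -/
lemma specNorm_prior_le (h : PathBounds ℓ θstar θ₀ Ω₀ t₀ r x K₂ K₃ K₄ K₅ L₁ L₂ L₃ lam C) :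
    specNorm Ω₀ ≤ lam := by
  refine ContinuousLinearMap.opNorm_le_bound _ h.lam_pos.le fun v => ?_
  rw [← mulVec_eq_toEuclideanCLM]
  have hl := h.lam_pos
  set w := mulVec Ω₀ v with hw
  have h0 := quad_nonneg_of_posSemidef h.prior_posDef.posSemidef (lam • v - w)
  have hv := h.prior_le.quad_le v
  have hw' := h.prior_le.quad_le w
  rw [quad_smul_one] at hv hw'
  have e : quad Ω₀ (lam • v - w) = lam ^ 2 * quad Ω₀ v - 2 * lam * ‖w‖ ^ 2 + quad Ω₀ w := by
    unfold quad
    rw [mulVec_sub_right, mulVec_smul_right, ← hw, inner_sub_left, inner_sub_right,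
      inner_sub_right, ← inner_mulVec_comm h.prior_posDef.isHermitian (lam • v) w,
      mulVec_smul_right, ← hw]
    simp only [inner_smul_left, inner_smul_right, real_inner_self_eq_norm_sq]
    simp
    ring
  rw [e] at h0
  refine (sq_le_sq₀ (norm_nonneg _) (by positivity)).1 ?_
  rw [mul_pow]
  refine le_of_mul_le_mul_left ?_ hl
  nlinarith [mul_le_mul_of_nonneg_left hv (sq_nonneg lam)]

/-- The initial energy. -/
lemma energy_warm_le (h : PathBounds ℓ θstar θ₀ Ω₀ t₀ r x K₂ K₃ K₄ K₅ L₁ L₂ L₃ lam C)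
    (hmem₀ : algθ ℓ θ₀ Ω₀ t₀ t₀ ∈ localSet θstar r) :
    quad (algΩ ℓ θ₀ Ω₀ t₀ t₀) (algθ ℓ θ₀ Ω₀ t₀ t₀ - θstar)
      ≤ 2 * C ^ 2 * (lam + L₂) * growth p x t₀ := by
  have h8 := h.eight_le
  have ht0 : (1 : ℝ) ≤ t₀ := by exact_mod_cast (by omega : 1 ≤ t₀)
  have hl := h.lam_pos
  have hL := h.L₂_pos
  have hG := one_le_growth h.dim h.x_pos (t := t₀) (by omega)
  -- The norm of `Ω_{t₀}` is of order `t₀` and the squared MAP error of order `G_{t₀} / t₀`, so `t₀`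
  -- cancels.
  have hspec : specNorm (algΩ ℓ θ₀ Ω₀ t₀ t₀) ≤ (lam + L₂) * t₀ := by
    rw [algΩ_eq_sum ℓ θ₀ Ω₀ t₀ (by omega) le_rfl]
    refine (specNorm_add_le _ _).trans ?_
    have h1 : specNorm (∑ s ∈ Finset.Icc 1 t₀,
        hess (ℓ s) (algθ ℓ θ₀ Ω₀ t₀ (max (s - 1) t₀))) ≤ ∑ _s ∈ Finset.Icc 1 t₀, L₂ :=
      (specNorm_sum_le _ _).trans (Finset.sum_le_sum fun s hs => by
        rw [max_eq_right (by have := (Finset.mem_Icc.1 hs).2; omega)]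
        exact h.bounded s (Finset.mem_Icc.1 hs).1 _ hmem₀)
    simp only [Finset.sum_const, Nat.card_Icc, Nat.add_sub_cancel, nsmul_eq_mul] at h1
    have := h.specNorm_prior_le
    nlinarith
  have hrate := h.rate_sq_le le_rfl (h.map_rate t₀ le_rfl)
  rw [← algθ_warm ℓ θ₀ Ω₀ t₀ (by omega)] at hrate
  calc _ ≤ specNorm (algΩ ℓ θ₀ Ω₀ t₀ t₀) * ‖algθ ℓ θ₀ Ω₀ t₀ t₀ - θstar‖ ^ 2 :=
        (le_abs_self _).trans (abs_quad_le _ _)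
    _ ≤ (lam + L₂) * t₀ * (2 * C ^ 2 * (growth p x t₀ / t₀)) := by gcongr
    _ = _ := by field_simp

end PathBounds

end OnlineBvM

namespace OnlineBvM

/-! ### Localization and the rate of the iterates. -/

namespace PathBounds

variable {p : ℕ} {ℓ : ℕ → Param p → ℝ} {θstar θ₀ : Param p} {Ω₀ : Mat p} {t₀ : ℕ}
  {r x K₂ K₃ K₄ K₅ L₁ L₂ L₃ lam C : ℝ}

/-- Split `a³ = a² · a`. The square is bounded by `κ G_t / s`, and the remaining factor by `√(κ η)
(t₀ / s)^{1/4}`. The sum of `t₀^{1/4} s^{-5/4}` over `s ≥ t₀` is at most 8, and a small `η` makes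
the total a small multiple of `G_t`. -/
lemma sum_cube_le (hp : 1 ≤ p) (hx : 0 < x) {a : ℕ → ℝ} (ha : ∀ s, 0 ≤ a s) {t : ℕ}
    (h8 : 8 ≤ t₀) (ht : t₀ ≤ t) {κ η : ℝ} (hκ : 0 ≤ κ) (hη : growth p x t₀ ≤ η * t₀)
    (hsq : ∀ s, t₀ ≤ s → s < t → a s ^ 2 ≤ κ * (growth p x s / s)) :
    ∑ s ∈ Finset.Ico t₀ t, a s ^ 3 ≤ 8 * (κ * √κ * √η) * growth p x t := by
  have hGt := one_le_growth hp hx (t := t) (by omega)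
  have hGt0 := one_le_growth hp hx (t := t₀) (by omega)
  have ht0 : (0 : ℝ) < t₀ := by exact_mod_cast (by omega : 0 < t₀)
  have hη0 : 0 ≤ η := by
    by_contra hneg
    push Not at hneg
    nlinarith
  have hterm : ∀ s ∈ Finset.Ico t₀ t, a s ^ 3
      ≤ κ * √κ * √η * growth p x t * √√(t₀ : ℝ) * (1 / ((s : ℝ) * √√(s : ℝ))) := fun s hs => by
    obtain ⟨hs1, hs2⟩ := Finset.mem_Ico.1 hs
    have hs0 : (0 : ℝ) < s := by exact_mod_cast (by omega : 0 < s)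
    have h1 : a s ^ 2 ≤ κ * (growth p x t / s) := by
      refine (hsq s hs1 hs2).trans ?_
      gcongr
      exact growth_mono (by omega) hs2.le
    have h2 : a s ≤ √κ * √η * (√√(t₀ : ℝ) / √√(s : ℝ)) := by
      have hq : a s ^ 2 ≤ κ * (η * (√(t₀ : ℝ) / √(s : ℝ))) := by
        refine (hsq s hs1 hs2).trans ?_
        gcongr
        exact growth_div_le hx h8 hs1 hη
      rw [← abs_of_nonneg (ha s)]
      refine (Real.abs_le_sqrt hq).trans_eq ?_
      rw [Real.sqrt_mul hκ, Real.sqrt_mul hη0, Real.sqrt_div (Real.sqrt_nonneg _)]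
      ring
    calc a s ^ 3 = a s ^ 2 * a s := by ring
      _ ≤ κ * (growth p x t / s) * (√κ * √η * (√√(t₀ : ℝ) / √√(s : ℝ))) := by
          refine mul_le_mul h1 h2 (ha s) (by positivity)
      _ = _ := by field_simp
  have hC : 0 ≤ κ * √κ * √η * growth p x t := by positivity
  have hq0 : 0 < √√(t₀ : ℝ) := Real.sqrt_pos.2 (Real.sqrt_pos.2 ht0)
  calc _ ≤ ∑ s ∈ Finset.Ico t₀ t,
        κ * √κ * √η * growth p x t * √√(t₀ : ℝ) * (1 / ((s : ℝ) * √√(s : ℝ))) :=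
        Finset.sum_le_sum hterm
    _ = κ * √κ * √η * growth p x t * √√(t₀ : ℝ)
        * ∑ s ∈ Finset.Ico t₀ t, 1 / ((s : ℝ) * √√(s : ℝ)) := by rw [Finset.mul_sum]
    _ ≤ κ * √κ * √η * growth p x t * √√(t₀ : ℝ) * (8 / √√(t₀ : ℝ)) := by
        gcongr
        exact sum_inv_mul_sqrt_sqrt_le (by omega) ht
    _ = _ := by field_simp

/-- The iterates never leave the local neighbourhood, and they converge at the rate
`√((p log t + x) / t)`. -/
theorem localization (h : PathBounds ℓ θstar θ₀ Ω₀ t₀ r x K₂ K₃ K₄ K₅ L₁ L₂ L₃ lam C)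
    {Ka η : ℝ} (hKa : 2 * C ^ 2 * (lam + L₂) + 2 * K₃ + K₄ + K₅ ≤ Ka)
    (hη : growth p x t₀ ≤ η * t₀) (hrC : 2 * C ^ 2 * η ≤ r ^ 2) (hrK : 2 * Ka / K₂ * η ≤ r ^ 2)
    (hcube : 12 * (L₁ * L₂) * (2 * Ka / K₂ * √(2 * Ka / K₂) * √η) ≤ Ka) {t : ℕ} (ht : t₀ ≤ t) :
    algθ ℓ θ₀ Ω₀ t₀ t ∈ localSet θstar r ∧
      ‖algθ ℓ θ₀ Ω₀ t₀ t - θstar‖ ^ 2 ≤ 2 * Ka / K₂ * (growth p x t / t) := by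
  have h8 := h.eight_le
  have hx := h.x_pos
  have hp := h.dim
  have hK₂ := h.K₂_pos
  have hK₃ := h.K₃_pos
  have hK₄ := h.K₄_pos
  have hK₅ := h.K₅_nonneg
  have hL₁ := h.L₁_nonneg
  have hL₂ := h.L₂_pos
  have hlam := h.lam_pos
  have hC := h.C_pos
  have hKa0 : 0 < Ka := lt_of_lt_of_le (by positivity) hKa
  have hmem₀ : algθ ℓ θ₀ Ω₀ t₀ t₀ ∈ localSet θstar r := by
    rw [algθ_warm ℓ θ₀ Ω₀ t₀ (by omega)]
    exact h.mem_localSet_of_rate hη hrC le_rfl (h.map_rate t₀ le_rfl)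
  -- The energy at `t` involves only earlier errors, so membership in `Θ_r` and the rate at all `s`
  -- with `t₀ ≤ s < t` give both at `t`.
  induction t using Nat.strong_induction_on with
  | _ t ih =>
    have hmem : ∀ s, t₀ ≤ s → s < t → algθ ℓ θ₀ Ω₀ t₀ s ∈ localSet θstar r :=
      fun s hs1 hs2 => (ih s hs2 hs1).1
    have ht0 : (0 : ℝ) < t := by exact_mod_cast (by omega : 0 < t)
    have hG := one_le_growth hp hx (t := t) (by omega)
    have hlog : 0 ≤ Real.log (t : ℝ) :=
      Real.log_nonneg (by exact_mod_cast (by omega : 1 ≤ t))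
    have hpl : 0 ≤ (p : ℝ) * Real.log t := by positivity
    have hxl := log_add_le_growth (x := x) hp (t := t) (by omega)
    have hxG : x ≤ growth p x t := by unfold growth; linarith
    have hplG : p * Real.log t ≤ growth p x t := by unfold growth; linarith
    have henergy := h.energy_le_sum ht hmem
    have hwarm := h.energy_warm_le hmem₀
    have hmono : growth p x t₀ ≤ growth p x t := growth_mono (by omega) ht
    have hcubes := sum_cube_le (a := fun s => ‖algθ ℓ θ₀ Ω₀ t₀ s - θstar‖) hp hx
      (fun s => norm_nonneg _) h8 ht (κ := 2 * Ka / K₂) (by positivity) hη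
      (fun s hs1 hs2 => (ih s hs2 hs1).2)
    have hregret : ∑ s ∈ Finset.Icc (t₀ + 1) t,
        (ℓ s θstar - ℓ s (algθ ℓ θ₀ Ω₀ t₀ (s - 1))) ≤ K₃ * x := by
      rcases eq_or_lt_of_le ht with rfl | hlt
      · simp; positivity
      · exact h.regret t hlt
    have hgrad : ∑ s ∈ Finset.Icc (t₀ + 1) t,
        quad (algΩ ℓ θ₀ Ω₀ t₀ s)⁻¹ (algGrad ℓ θ₀ Ω₀ t₀ s)
          ≤ K₄ * p * Real.log t + K₅ * (x + Real.log t) := by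
      rcases eq_or_lt_of_le ht with rfl | hlt
      · simp; positivity
      · exact h.grad t hlt fun s hs1 hs2 => hmem s hs1.le hs2
    have h1 : K₃ * x ≤ K₃ * growth p x t := by gcongr
    have h2 : K₄ * p * Real.log t ≤ K₄ * growth p x t := by rw [mul_assoc]; gcongr
    have h3 : K₅ * (x + Real.log t) ≤ K₅ * growth p x t := by gcongr
    have h4 : 2 * C ^ 2 * (lam + L₂) * growth p x t₀ ≤ 2 * C ^ 2 * (lam + L₂) * growth p x t := by
      gcongr
    have h5 : 3 / 2 * (L₁ * L₂ * ∑ s ∈ Finset.Ico t₀ t, ‖algθ ℓ θ₀ Ω₀ t₀ s - θstar‖ ^ 3)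
        ≤ Ka * growth p x t := by
      calc _ ≤ 3 / 2 * (L₁ * L₂ * (8 * (2 * Ka / K₂ * √(2 * Ka / K₂) * √η) * growth p x t)) := by
            gcongr
        _ = 12 * (L₁ * L₂) * (2 * Ka / K₂ * √(2 * Ka / K₂) * √η) * growth p x t := by ring
        _ ≤ _ := by gcongr
    have h6 : (2 * C ^ 2 * (lam + L₂) + 2 * K₃ + K₄ + K₅) * growth p x t ≤ Ka * growth p x t := by
      gcongr
    -- One `Ka` pays for the warm start, the regret and the gradients; the other pays for the cubes.
    have hD : quad (algΩ ℓ θ₀ Ω₀ t₀ t) (algθ ℓ θ₀ Ω₀ t₀ t - θstar) ≤ 2 * Ka * growth p x t := by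
      linarith
    have hlow := h.le_quad_algΩ ht hmem₀ hmem (algθ ℓ θ₀ Ω₀ t₀ t - θstar)
    have hsq : ‖algθ ℓ θ₀ Ω₀ t₀ t - θstar‖ ^ 2 ≤ 2 * Ka / K₂ * (growth p x t / t) := by
      rw [div_mul_div_comm, le_div_iff₀ (by positivity)]
      linarith
    refine ⟨?_, hsq⟩
    refine (sq_le_sq₀ (norm_nonneg _) h.r_pos.le).1 (hsq.trans (le_trans ?_ hrK))
    exact mul_le_mul_of_nonneg_left (growth_le_of_le hp hx h8 ht hη) (by positivity)

end PathBounds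

end OnlineBvM

namespace OnlineBvM

/-! ### First-order conditions for the batch estimators. -/

section Stationarity

variable {p : ℕ} {ℓ : ℕ → Param p → ℝ}

/-- First-order condition for the MAP estimator. -/
lemma sum_gradient_add_eq_zero_of_isArgmin {θ₀ : Param p} {Ω₀ : Mat p} (hΩ : Ω₀.IsHermitian)
    {t : ℕ} (hdiff : ∀ s, 1 ≤ s → Differentiable ℝ (ℓ s)) {θ : Param p}
    (hmin : IsArgmin (mapLoss ℓ θ₀ Ω₀ t) θ) :
    ∑ s ∈ Finset.Icc 1 t, ∇ (ℓ s) θ + mulVec Ω₀ (θ - θ₀) = 0 := by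
  -- The test direction is the gradient itself, so the derivative along the line is `‖e‖²`.
  set e := ∑ s ∈ Finset.Icc 1 t, ∇ (ℓ s) θ + mulVec Ω₀ (θ - θ₀) with he
  have hquad : ∀ w : ℝ, quad Ω₀ (θ + w • e - θ₀)
      = quad Ω₀ (θ - θ₀) + w * (2 * inner ℝ (mulVec Ω₀ (θ - θ₀)) e) + w ^ 2 * quad Ω₀ e :=
    fun w => by
      have e1 : θ + w • e - θ₀ = (θ - θ₀) + w • e := by abel
      rw [e1]
      unfold quad
      rw [mulVec_add_right, mulVec_smul_right, inner_add_left, inner_add_right, inner_add_right]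
      simp only [inner_smul_left, inner_smul_right]
      rw [← inner_mulVec_comm hΩ (θ - θ₀) e, real_inner_comm (mulVec Ω₀ (θ - θ₀)) e]
      simp
      ring
  have hderiv : HasDerivAt (fun w : ℝ => mapLoss ℓ θ₀ Ω₀ t (θ + w • e)) (inner ℝ e e) 0 := by
    have h1 : HasDerivAt (fun w : ℝ => batchLoss ℓ t (θ + w • e))
        (∑ s ∈ Finset.Icc 1 t, inner ℝ (∇ (ℓ s) (θ + (0 : ℝ) • e)) e) 0 := by
      unfold batchLoss
      exact HasDerivAt.fun_sum fun s hs =>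
        hasDerivAt_line (hdiff s (Finset.mem_Icc.1 hs).1) θ e 0
    have h2 : HasDerivAt (fun w : ℝ => 1 / 2 * quad Ω₀ (θ + w • e - θ₀))
        (inner ℝ (mulVec Ω₀ (θ - θ₀)) e) 0 := by
      simp_rw [hquad]
      have := ((((hasDerivAt_id (0 : ℝ)).mul_const (2 * inner ℝ (mulVec Ω₀ (θ - θ₀)) e)).const_add
        (quad Ω₀ (θ - θ₀))).add (((hasDerivAt_id (0 : ℝ)).pow 2).mul_const (quad Ω₀ e))).const_mul
        (1 / 2 : ℝ)
      refine this.congr_deriv ?_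
      simp
    refine (h1.add h2).congr_deriv ?_
    rw [zero_smul, add_zero, ← sum_inner, ← inner_add_left]
  have hloc : IsLocalMin (fun w : ℝ => mapLoss ℓ θ₀ Ω₀ t (θ + w • e)) 0 :=
    Filter.Eventually.of_forall fun w => by simpa using hmin (θ + w • e)
  exact inner_self_eq_zero.1 (hloc.hasDerivAt_eq_zero hderiv)

/-- First-order condition for the maximum likelihood estimator. -/
lemma sum_gradient_eq_zero_of_isArgmin {t : ℕ} (hdiff : ∀ s, 1 ≤ s → Differentiable ℝ (ℓ s))
    {θ : Param p} (hmin : IsArgmin (batchLoss ℓ t) θ) :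
    ∑ s ∈ Finset.Icc 1 t, ∇ (ℓ s) θ = 0 := by
  -- Maximum likelihood is the MAP estimator for the flat prior of precision zero.
  have h0 : mapLoss ℓ 0 (0 : Mat p) t = batchLoss ℓ t := by
    ext θ'; simp [mapLoss, quad, mulVec_eq_toEuclideanCLM]
  have := sum_gradient_add_eq_zero_of_isArgmin (ℓ := ℓ) (θ₀ := 0) (Ω₀ := (0 : Mat p))
    Matrix.isHermitian_zero hdiff (h0.symm ▸ hmin)
  simpa [mulVec_eq_toEuclideanCLM] using this

end Stationarity

/-- The first `t₀` losses are all linearized at the warm start; loss `s > t₀` is linearized at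
iterate `s - 1`, which runs over `t₀, …, t - 1`. -/
lemma sum_Icc_max_pred (φ : ℕ → ℝ) {t₀ t : ℕ} (ht : t₀ ≤ t) :
    ∑ s ∈ Finset.Icc 1 t, φ (max (s - 1) t₀) = t₀ * φ t₀ + ∑ s ∈ Finset.Ico t₀ t, φ s := by
  induction t, ht using Nat.le_induction with
  | base =>
    have : ∑ s ∈ Finset.Icc 1 t₀, φ (max (s - 1) t₀) = ∑ _s ∈ Finset.Icc 1 t₀, φ t₀ :=
      Finset.sum_congr rfl fun s hs => by
        rw [max_eq_right (by have := (Finset.mem_Icc.1 hs).2; omega)]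
    simp [this]
  | succ n hn ih =>
    rw [Finset.sum_Icc_succ_top (by omega), Finset.sum_Ico_succ_top hn, ih, Nat.add_sub_cancel,
      max_eq_left hn, add_assoc]

/-! ### Closeness of the precisions and of the means. -/

namespace PathBounds

variable {p : ℕ} {ℓ : ℕ → Param p → ℝ} {θstar θ₀ : Param p} {Ω₀ : Mat p} {t₀ : ℕ}
  {r x K₂ K₃ K₄ K₅ L₁ L₂ L₃ lam C : ℝ}

/-- The online precision matrix is close to the Fisher information at `θ⋆`. -/
lemma specNorm_fisher_sub_algΩ_le
    (h : PathBounds ℓ θstar θ₀ Ω₀ t₀ r x K₂ K₃ K₄ K₅ L₁ L₂ L₃ lam C) {κ : ℝ} (hκ : 0 ≤ κ)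
    {t : ℕ} (ht : t₀ ≤ t) (hmem : ∀ s, t₀ ≤ s → algθ ℓ θ₀ Ω₀ t₀ s ∈ localSet θstar r)
    (hrate : ∀ s, t₀ ≤ s → ‖algθ ℓ θ₀ Ω₀ t₀ s - θstar‖ ^ 2 ≤ κ * (growth p x s / s)) :
    specNorm (fisher ℓ t θstar - algΩ ℓ θ₀ Ω₀ t₀ t)
      ≤ (lam + 4 * L₃ * √κ) * (√(growth p x t) * √t) := by
  have h8 := h.eight_le
  have hL₃ := h.L₃_pos
  have hlam := h.lam_pos
  have ht1 : (1 : ℝ) ≤ t := by exact_mod_cast (by omega : 1 ≤ t)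
  have hG := one_le_growth h.dim h.x_pos (t := t) (by omega)
  have hsG : 1 ≤ √(growth p x t) := Real.one_le_sqrt.2 hG
  have hst : 1 ≤ √(t : ℝ) := Real.one_le_sqrt.2 ht1
  have hterm : ∀ s, t₀ ≤ s → s ≤ t →
      ‖algθ ℓ θ₀ Ω₀ t₀ s - θstar‖ ≤ √κ * √(growth p x t) * (1 / √(s : ℝ)) := fun s hs1 hs2 => by
    have hq : ‖algθ ℓ θ₀ Ω₀ t₀ s - θstar‖ ^ 2 ≤ κ * (growth p x t / s) := by
      refine (hrate s hs1).trans ?_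
      gcongr
      exact growth_mono (by omega) hs2
    rw [← abs_of_nonneg (norm_nonneg (algθ ℓ θ₀ Ω₀ t₀ s - θstar))]
    refine (Real.abs_le_sqrt hq).trans_eq ?_
    rw [Real.sqrt_mul hκ, Real.sqrt_div (by linarith)]
    ring
  -- The warm start contributes `t₀ / √t₀ ≤ √t` and the later iterates `∑ 1/√s ≤ 3 √t`, whence the
  -- 4.
  have hsum : ∑ s ∈ Finset.Icc 1 t, ‖algθ ℓ θ₀ Ω₀ t₀ (max (s - 1) t₀) - θstar‖
      ≤ 4 * √κ * (√(growth p x t) * √t) := by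
    rw [sum_Icc_max_pred (fun s => ‖algθ ℓ θ₀ Ω₀ t₀ s - θstar‖) ht]
    have ht0 : (0 : ℝ) < t₀ := by exact_mod_cast (by omega : 0 < t₀)
    have h1 : t₀ * ‖algθ ℓ θ₀ Ω₀ t₀ t₀ - θstar‖ ≤ √κ * √(growth p x t) * √t := by
      calc t₀ * ‖algθ ℓ θ₀ Ω₀ t₀ t₀ - θstar‖
          ≤ t₀ * (√κ * √(growth p x t) * (1 / √(t₀ : ℝ))) :=
            mul_le_mul_of_nonneg_left (hterm t₀ le_rfl ht) ht0.le
        _ = √κ * √(growth p x t) * (t₀ / √(t₀ : ℝ)) := by ring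
        _ = √κ * √(growth p x t) * √(t₀ : ℝ) := by rw [Real.div_sqrt]
        _ ≤ _ := by gcongr
    have h2 : ∑ s ∈ Finset.Ico t₀ t, ‖algθ ℓ θ₀ Ω₀ t₀ s - θstar‖
        ≤ √κ * √(growth p x t) * (3 * √t) := by
      calc _ ≤ ∑ s ∈ Finset.Ico t₀ t, √κ * √(growth p x t) * (1 / √(s : ℝ)) :=
            Finset.sum_le_sum fun s hs =>
              hterm s (Finset.mem_Ico.1 hs).1 (Finset.mem_Ico.1 hs).2.le
        _ ≤ _ := by
            rw [← Finset.mul_sum]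
            exact mul_le_mul_of_nonneg_left (sum_one_div_sqrt_le (by omega) ht) (by positivity)
    linarith
  have hdiff : specNorm (fisher ℓ t θstar - algΩ ℓ θ₀ Ω₀ t₀ t)
      ≤ lam + L₃ * ∑ s ∈ Finset.Icc 1 t, ‖algθ ℓ θ₀ Ω₀ t₀ (max (s - 1) t₀) - θstar‖ := by
    have e : specNorm (fisher ℓ t θstar - algΩ ℓ θ₀ Ω₀ t₀ t)
        = specNorm (Ω₀ + ∑ s ∈ Finset.Icc 1 t,
          (hess (ℓ s) (algθ ℓ θ₀ Ω₀ t₀ (max (s - 1) t₀)) - hess (ℓ s) θstar)) := by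
      rw [algΩ_eq_sum ℓ θ₀ Ω₀ t₀ (by omega) ht, fisher, Finset.sum_sub_distrib, specNorm,
        specNorm, ← norm_neg, ← map_neg]
      congr 2
      abel
    rw [e, Finset.mul_sum]
    refine (specNorm_add_le _ _).trans (add_le_add h.specNorm_prior_le
      ((specNorm_sum_le _ _).trans (Finset.sum_le_sum fun s hs => ?_)))
    exact h.lipschitz s (Finset.mem_Icc.1 hs).1 _ (hmem _ (le_max_right _ _)) _ h.star_mem
  have h1 : 1 ≤ √(growth p x t) * √t := one_le_mul_of_one_le_of_one_le hsG hst
  calc _ ≤ lam + L₃ * (4 * √κ * (√(growth p x t) * √t)) :=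
        hdiff.trans (by gcongr)
    _ ≤ lam * (√(growth p x t) * √t) + L₃ * (4 * √κ * (√(growth p x t) * √t)) := by
        gcongr
        exact le_mul_of_one_le_right hlam.le h1
    _ = _ := by ring

/-- The online iterate solves a perturbed normal equation. -/
lemma mulVec_algΩ_sub (h : PathBounds ℓ θstar θ₀ Ω₀ t₀ r x K₂ K₃ K₄ K₅ L₁ L₂ L₃ lam C)
    (hmem : ∀ s, t₀ ≤ s → algθ ℓ θ₀ Ω₀ t₀ s ∈ localSet θstar r) (y : Param p) {t : ℕ}
    (ht : t₀ ≤ t) :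
    mulVec (algΩ ℓ θ₀ Ω₀ t₀ t) (algθ ℓ θ₀ Ω₀ t₀ t - y)
      = mulVec Ω₀ (θ₀ - y) + ∑ s ∈ Finset.Icc 1 t,
        (mulVec (hess (ℓ s) (algθ ℓ θ₀ Ω₀ t₀ (max (s - 1) t₀)))
            (algθ ℓ θ₀ Ω₀ t₀ (max (s - 1) t₀) - y)
          - ∇ (ℓ s) (algθ ℓ θ₀ Ω₀ t₀ (max (s - 1) t₀))) := by
  have h8 := h.eight_le
  induction t, ht using Nat.le_induction with
  | base =>
    have hstat := sum_gradient_add_eq_zero_of_isArgmin h.prior_posDef.isHermitian h.diff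
      (h.map_min t₀ le_rfl)
    rw [← algθ_warm ℓ θ₀ Ω₀ t₀ (by omega)] at hstat
    rw [algΩ_eq_sum ℓ θ₀ Ω₀ t₀ (by omega) le_rfl, mulVec_add_left, mulVec_sum_left,
      Finset.sum_sub_distrib]
    have hmax : ∀ s ∈ Finset.Icc 1 t₀, max (s - 1) t₀ = t₀ := fun s hs =>
      max_eq_right (by have := (Finset.mem_Icc.1 hs).2; omega)
    have e1 : ∑ s ∈ Finset.Icc 1 t₀, mulVec (hess (ℓ s) (algθ ℓ θ₀ Ω₀ t₀ (max (s - 1) t₀)))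
        (algθ ℓ θ₀ Ω₀ t₀ (max (s - 1) t₀) - y)
        = ∑ s ∈ Finset.Icc 1 t₀, mulVec (hess (ℓ s) (algθ ℓ θ₀ Ω₀ t₀ (max (s - 1) t₀)))
        (algθ ℓ θ₀ Ω₀ t₀ t₀ - y) := Finset.sum_congr rfl fun s hs => by rw [hmax s hs]
    have e2 : ∑ s ∈ Finset.Icc 1 t₀, ∇ (ℓ s) (algθ ℓ θ₀ Ω₀ t₀ (max (s - 1) t₀))
        = ∑ s ∈ Finset.Icc 1 t₀, ∇ (ℓ s) (algθ ℓ θ₀ Ω₀ t₀ t₀) :=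
      Finset.sum_congr rfl fun s hs => by rw [hmax s hs]
    have e3 : mulVec Ω₀ (algθ ℓ θ₀ Ω₀ t₀ t₀ - y)
        = mulVec Ω₀ (θ₀ - y) + mulVec Ω₀ (algθ ℓ θ₀ Ω₀ t₀ t₀ - θ₀) := by
      rw [← mulVec_add_right]
      congr 1
      abel
    rw [e1, e2, e3, eq_neg_of_add_eq_zero_left hstat]
    abel
  | succ n hn ih =>
    -- Multiplying the update by `Ω_{n+1}` cancels the inverse, and `Ω_{n+1} - Ω_n` is the Hessian
    -- at `θ_n`, so the identity is exact.
    have hinv := h.mulVec_algΩ_inv (t := n + 1) (by omega) (hmem t₀ le_rfl)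
      (fun s h1 _ => hmem s h1) (∇ (ℓ (n + 1)) (algθ ℓ θ₀ Ω₀ t₀ n))
    rw [Finset.sum_Icc_succ_top (by omega), Nat.add_sub_cancel, max_eq_left hn, ← add_assoc,
      ← ih, algθ_succ ℓ θ₀ Ω₀ t₀ hn, sub_right_comm, mulVec_sub_right, hinv,
      algΩ_succ ℓ θ₀ Ω₀ t₀ hn, mulVec_add_left]
    abel

/-- The prior drift `Ω₀ (θ₀ - y)` is controlled by the rates of the batch estimators. -/
lemma norm_prior_drift_le (h : PathBounds ℓ θstar θ₀ Ω₀ t₀ r x K₂ K₃ K₄ K₅ L₁ L₂ L₃ lam C)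
    {B : ℝ} (hB : 0 < B) {t : ℕ} (ht : t₀ ≤ t) (hBt : (t₀ : ℝ) ≤ B * growth p x t)
    (hmap : mapEst ℓ θ₀ Ω₀ t₀ ∈ localSet θstar r) (hmle : mle ℓ t₀ ∈ localSet θstar r)
    {y : Param p} (hy : y ∈ localSet θstar r) :
    ‖mulVec Ω₀ (θ₀ - y)‖ ≤ (3 * C * L₂ * √B + 2 * lam * r) * growth p x t := by
  have h8 := h.eight_le
  have hC := h.C_pos
  have hL₂ := h.L₂_pos
  have hlam := h.lam_pos
  have hr := h.r_pos
  have ht0 : (0 : ℝ) < t₀ := by exact_mod_cast (by omega : 0 < t₀)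
  have hG := one_le_growth h.dim h.x_pos (t := t) (by omega)
  have hG0 := one_le_growth h.dim h.x_pos (t := t₀) (by omega)
  have hmono : growth p x t₀ ≤ growth p x t := growth_mono (by omega) ht
  -- `t₀² ‖θ - θ⋆‖² ≤ 2 C² G t₀ ≤ 2 C² B G²` by `t₀ ≤ B G`; the constant 3/2 is a rational bound for
  -- `√2`.
  have hrate : ∀ θ : Param p, ‖θ - θstar‖ ≤ C * √((p + Real.log t₀ + x) / t₀) →
      t₀ * ‖θ - θstar‖ ≤ 3 / 2 * C * √B * growth p x t := fun θ hθ => by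
    refine (sq_le_sq₀ (by positivity) (by positivity)).1 ?_
    have h1 := h.rate_sq_le le_rfl hθ
    calc (t₀ * ‖θ - θstar‖) ^ 2 = (t₀ : ℝ) ^ 2 * ‖θ - θstar‖ ^ 2 := by ring
      _ ≤ (t₀ : ℝ) ^ 2 * (2 * C ^ 2 * (growth p x t₀ / t₀)) := by gcongr
      _ = 2 * C ^ 2 * growth p x t₀ * t₀ := by field_simp
      _ ≤ 2 * C ^ 2 * growth p x t * (B * growth p x t) := by gcongr
      _ ≤ 9 / 4 * C ^ 2 * growth p x t * (B * growth p x t) := by gcongr; norm_num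
      _ = (3 / 2 * C * √B * growth p x t) ^ 2 := by
          rw [mul_pow, mul_pow, Real.sq_sqrt hB.le]; ring
  have hstat := sum_gradient_add_eq_zero_of_isArgmin h.prior_posDef.isHermitian h.diff
    (h.map_min t₀ le_rfl)
  have hstat' := sum_gradient_eq_zero_of_isArgmin h.diff (h.mle_min t₀ le_rfl)
  set a := mapEst ℓ θ₀ Ω₀ t₀
  set b := mle ℓ t₀
  have hgrad : ‖∑ s ∈ Finset.Icc 1 t₀, ∇ (ℓ s) a‖ ≤ t₀ * (L₂ * ‖a - b‖) := by
    have e : ∑ s ∈ Finset.Icc 1 t₀, ∇ (ℓ s) a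
        = ∑ s ∈ Finset.Icc 1 t₀, (∇ (ℓ s) a - ∇ (ℓ s) b) := by
      rw [Finset.sum_sub_distrib, hstat', sub_zero]
    rw [e]
    refine (norm_sum_le_of_le (Finset.Icc 1 t₀) (f := fun s => ∇ (ℓ s) a - ∇ (ℓ s) b)
      (n := fun _ => L₂ * ‖a - b‖) fun s hs => ?_).trans_eq (by simp)
    have hs1 := (Finset.mem_Icc.1 hs).1
    exact norm_gradient_sub_le (h.diff s hs1) (h.diff_fderiv s hs1) (convex_localSet θstar r)
      (h.bounded s hs1) hmle hmap
  have hab : t₀ * ‖a - b‖ ≤ 3 * C * √B * growth p x t := by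
    have h1 : ‖a - b‖ ≤ ‖a - θstar‖ + ‖b - θstar‖ := by
      have := norm_sub_le_norm_sub_add_norm_sub a θstar b
      rwa [norm_sub_rev θstar b] at this
    have h2 := hrate a (h.map_rate t₀ le_rfl)
    have h3 := hrate b (h.mle_rate t₀ le_rfl)
    nlinarith
  have hay : ‖a - y‖ ≤ 2 * r := by
    have h1 := norm_sub_le_norm_sub_add_norm_sub a θstar y
    rw [norm_sub_rev θstar y] at h1
    have h2 : ‖a - θstar‖ ≤ r := hmap
    have h3 : ‖y - θstar‖ ≤ r := hy
    linarith
  -- No assumption bounds `θ₀`. The MAP condition at `t₀` trades `Ω₀ (a - θ₀)` for the likelihood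
  -- score at `a`, which is small because the score vanishes at the nearby maximum likelihood
  -- estimator `b`.
  have e : mulVec Ω₀ (θ₀ - y) = ∑ s ∈ Finset.Icc 1 t₀, ∇ (ℓ s) a + mulVec Ω₀ (a - y) := by
    have e1 : θ₀ - y = (a - y) - (a - θ₀) := by abel
    rw [e1, mulVec_sub_right, eq_neg_of_add_eq_zero_left hstat]
    abel
  rw [e]
  calc _ ≤ ‖∑ s ∈ Finset.Icc 1 t₀, ∇ (ℓ s) a‖ + ‖mulVec Ω₀ (a - y)‖ := norm_add_le _ _
    _ ≤ t₀ * (L₂ * ‖a - b‖) + lam * (2 * r) := by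
        refine add_le_add hgrad ((norm_mulVec_le _ _).trans ?_)
        exact mul_le_mul h.specNorm_prior_le hay (norm_nonneg _) hlam.le
    _ = L₂ * (t₀ * ‖a - b‖) + 2 * lam * r := by ring
    _ ≤ L₂ * (3 * C * √B * growth p x t) + 2 * lam * r * growth p x t :=
        add_le_add (mul_le_mul_of_nonneg_left hab hL₂.le)
          (le_mul_of_one_le_right (by positivity) hG)
    _ = _ := by ring

/-- The online iterate is close to the maximum likelihood estimator. -/
lemma norm_mulVec_algΩ_sub_mle_le
    (h : PathBounds ℓ θstar θ₀ Ω₀ t₀ r x K₂ K₃ K₄ K₅ L₁ L₂ L₃ lam C) {κ B : ℝ} (hκ : 0 ≤ κ)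
    (hB : 0 < B) {t : ℕ} (ht : 3 * (t₀ : ℝ) < t) (hBt : (t₀ : ℝ) ≤ B * growth p x t)
    (hmem : ∀ s, t₀ ≤ s → algθ ℓ θ₀ Ω₀ t₀ s ∈ localSet θstar r)
    (hmle : ∀ s, t₀ ≤ s → mle ℓ s ∈ localSet θstar r)
    (hrate : ∀ s, t₀ ≤ s → ‖algθ ℓ θ₀ Ω₀ t₀ s - θstar‖ ^ 2 ≤ κ * (growth p x s / s)) :
    ‖mulVec (algΩ ℓ θ₀ Ω₀ t₀ t) (algθ ℓ θ₀ Ω₀ t₀ t - mle ℓ t)‖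
      ≤ (3 * C * L₂ * √B + 2 * lam * r + 2 * L₃ * (3 * κ + 2 * C ^ 2))
        * (Real.log ((t : ℝ) / t₀) * growth p x t) := by
  have h8 := h.eight_le
  have hC := h.C_pos
  have hL₂ := h.L₂_pos
  have hL₃ := h.L₃_pos
  have hlam := h.lam_pos
  have hr := h.r_pos
  have ht0 : (0 : ℝ) < t₀ := by exact_mod_cast (by omega : 0 < t₀)
  have htt : t₀ ≤ t := by exact_mod_cast (by linarith : (t₀ : ℝ) ≤ t)
  have htpos : (0 : ℝ) < t := by linarith
  have hlog : 1 ≤ Real.log ((t : ℝ) / t₀) :=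
    one_le_log_of_three_le (by rw [le_div_iff₀ ht0]; exact ht.le)
  have hG := one_le_growth h.dim h.x_pos (t := t) (by omega)
  have hdrift := h.norm_prior_drift_le hB htt hBt
    (by rw [← algθ_warm ℓ θ₀ Ω₀ t₀ (by omega)]; exact hmem t₀ le_rfl) (hmle t₀ le_rfl)
    (hmle t htt)
  have hstat := sum_gradient_eq_zero_of_isArgmin h.diff (h.mle_min t htt)
  have hmle_sq := h.rate_sq_le htt (h.mle_rate t htt)
  have hymem := hmle t htt
  rw [h.mulVec_algΩ_sub hmem (mle ℓ t) htt]
  set y := mle ℓ t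
  set b : ℕ → Param p := fun s => algθ ℓ θ₀ Ω₀ t₀ (max (s - 1) t₀) with hb
  have hrem : ‖∑ s ∈ Finset.Icc 1 t, (mulVec (hess (ℓ s) (b s)) (b s - y) - ∇ (ℓ s) (b s))‖
      ≤ L₃ * ∑ s ∈ Finset.Icc 1 t, ‖y - b s‖ ^ 2 := by
    have e : ∑ s ∈ Finset.Icc 1 t, (mulVec (hess (ℓ s) (b s)) (b s - y) - ∇ (ℓ s) (b s))
        = ∑ s ∈ Finset.Icc 1 t, (∇ (ℓ s) y - ∇ (ℓ s) (b s) - mulVec (hess (ℓ s) (b s)) (y - b s)) := by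
      -- The zero score `∑ ∇ℓ_s(y) = 0` is inserted, turning each residual into a first-order Taylor
      -- remainder of the gradient.
      rw [← sub_zero (∑ s ∈ Finset.Icc 1 t, (mulVec (hess (ℓ s) (b s)) (b s - y)
        - ∇ (ℓ s) (b s))), ← neg_zero, ← hstat, sub_neg_eq_add, ← Finset.sum_add_distrib]
      refine Finset.sum_congr rfl fun s _ => ?_
      rw [mulVec_sub_right, mulVec_sub_right]
      abel
    rw [e, Finset.mul_sum]
    refine norm_sum_le_of_le _ fun s hs => ?_
    have hs1 := (Finset.mem_Icc.1 hs).1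
    exact norm_gradient_sub_sub_le (h.diff s hs1) (h.diff_fderiv s hs1)
      (convex_localSet θstar r) (h.lipschitz s hs1) hL₃.le (hmem _ (le_max_right _ _)) hymem
  have hsq : ∑ s ∈ Finset.Icc 1 t, ‖y - b s‖ ^ 2
      ≤ 2 * (3 * κ + 2 * C ^ 2) * (Real.log ((t : ℝ) / t₀) * growth p x t) := by
    have h1 : ∀ s ∈ Finset.Icc 1 t, ‖y - b s‖ ^ 2 ≤ 2 * ‖y - θstar‖ ^ 2 + 2 * ‖b s - θstar‖ ^ 2 :=
      fun s _ => by
        have h2 := norm_sub_le_norm_sub_add_norm_sub y θstar (b s)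
        rw [norm_sub_rev θstar (b s)] at h2
        have h3 : ‖y - b s‖ ^ 2 ≤ (‖y - θstar‖ + ‖b s - θstar‖) ^ 2 :=
          pow_le_pow_left₀ (norm_nonneg _) h2 2
        nlinarith [sq_nonneg (‖y - θstar‖ - ‖b s - θstar‖)]
    -- The `t₀` copies of the warm start give `κ G`; the later iterates give a harmonic sum, the
    -- origin of `log (t / t₀)`.
    have h2 : ∑ s ∈ Finset.Icc 1 t, ‖b s - θstar‖ ^ 2
        ≤ κ * growth p x t + κ * growth p x t * (2 * Real.log ((t : ℝ) / t₀)) := by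
      rw [sum_Icc_max_pred (fun s => ‖algθ ℓ θ₀ Ω₀ t₀ s - θstar‖ ^ 2) htt]
      have hterm : ∀ s, t₀ ≤ s → s ≤ t →
          ‖algθ ℓ θ₀ Ω₀ t₀ s - θstar‖ ^ 2 ≤ κ * growth p x t * (1 / (s : ℝ)) := fun s hs1 hs2 => by
        refine (hrate s hs1).trans ?_
        rw [mul_assoc, mul_one_div]
        gcongr
        exact growth_mono (by omega) hs2
      refine add_le_add ?_ ?_
      · calc (t₀ : ℝ) * ‖algθ ℓ θ₀ Ω₀ t₀ t₀ - θstar‖ ^ 2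
            ≤ t₀ * (κ * growth p x t * (1 / (t₀ : ℝ))) :=
              mul_le_mul_of_nonneg_left (hterm t₀ le_rfl htt) ht0.le
          _ = _ := by field_simp
      · calc _ ≤ ∑ s ∈ Finset.Ico t₀ t, κ * growth p x t * (1 / (s : ℝ)) :=
              Finset.sum_le_sum fun s hs =>
                hterm s (Finset.mem_Ico.1 hs).1 (Finset.mem_Ico.1 hs).2.le
          _ ≤ _ := by
              rw [← Finset.mul_sum]
              exact mul_le_mul_of_nonneg_left (sum_one_div_le (by omega) htt) (by positivity)
    have h3 : (t : ℝ) * ‖y - θstar‖ ^ 2 ≤ 2 * C ^ 2 * growth p x t := by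
      calc (t : ℝ) * ‖y - θstar‖ ^ 2 ≤ t * (2 * C ^ 2 * (growth p x t / t)) :=
            mul_le_mul_of_nonneg_left hmle_sq htpos.le
        _ = _ := by field_simp
    have h4 : ∑ s ∈ Finset.Icc 1 t, ‖y - b s‖ ^ 2
        ≤ 2 * (t * ‖y - θstar‖ ^ 2) + 2 * ∑ s ∈ Finset.Icc 1 t, ‖b s - θstar‖ ^ 2 := by
      refine (Finset.sum_le_sum h1).trans_eq ?_
      rw [Finset.sum_add_distrib, ← Finset.mul_sum, ← Finset.mul_sum]
      simp
    have h5 : growth p x t ≤ Real.log ((t : ℝ) / t₀) * growth p x t :=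
      le_mul_of_one_le_left (by linarith) hlog
    have h6 : κ * growth p x t ≤ κ * (Real.log ((t : ℝ) / t₀) * growth p x t) := by gcongr
    have h7 : 2 * C ^ 2 * growth p x t ≤ 2 * C ^ 2 * (Real.log ((t : ℝ) / t₀) * growth p x t) := by
      gcongr
    linarith
  calc _ ≤ ‖mulVec Ω₀ (θ₀ - y)‖
        + ‖∑ s ∈ Finset.Icc 1 t, (mulVec (hess (ℓ s) (b s)) (b s - y) - ∇ (ℓ s) (b s))‖ :=
        norm_add_le _ _
    _ ≤ (3 * C * L₂ * √B + 2 * lam * r) * growth p x t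
        + L₃ * (2 * (3 * κ + 2 * C ^ 2) * (Real.log ((t : ℝ) / t₀) * growth p x t)) :=
        add_le_add hdrift (hrem.trans (mul_le_mul_of_nonneg_left hsq hL₃.le))
    _ ≤ (3 * C * L₂ * √B + 2 * lam * r) * (Real.log ((t : ℝ) / t₀) * growth p x t)
        + L₃ * (2 * (3 * κ + 2 * C ^ 2) * (Real.log ((t : ℝ) / t₀) * growth p x t)) := by
        gcongr
        exact le_mul_of_one_le_left (by linarith) hlog
    _ = _ := by ring

end PathBounds

end OnlineBvM

namespace OnlineBvM

/-- The full posterior is proper when a maximum likelihood estimator exists. -/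
lemma isProbabilityMeasure_fullPosterior {p : ℕ} {ℓ : ℕ → Param p → ℝ} (θ₀ : Param p)
    (Ω₀ : Mat p) {t : ℕ} (hdiff : ∀ s, 1 ≤ s → Differentiable ℝ (ℓ s))
    {θ : Param p} (hmin : IsArgmin (batchLoss ℓ t) θ) :
    IsProbabilityMeasure (fullPosterior ℓ θ₀ Ω₀ t) := by
  have hcont : Continuous (batchLoss ℓ t) := by
    unfold batchLoss
    exact continuous_finsetSum _ fun s hs => (hdiff s (Finset.mem_Icc.1 hs).1).continuous
  have hmeas : Measurable fun θ' => ENNReal.ofReal (Real.exp (-batchLoss ℓ t θ')) :=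
    (Real.continuous_exp.comp hcont.neg).measurable.ennreal_ofReal
  have htotal : unnormalizedPosterior ℓ θ₀ Ω₀ t Set.univ
      = ∫⁻ θ', ENNReal.ofReal (Real.exp (-batchLoss ℓ t θ')) ∂(multivariateGaussian θ₀ Ω₀⁻¹) := by
    rw [unnormalizedPosterior, withDensity_apply _ MeasurableSet.univ, Measure.restrict_univ]
  -- The likelihood is bounded by its value at the minimizer of the batch loss, and the Gaussian
  -- prior has mass one.
  have hne_top : unnormalizedPosterior ℓ θ₀ Ω₀ t Set.univ ≠ ⊤ := by
    rw [htotal]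
    refine ne_top_of_le_ne_top (b := ENNReal.ofReal (Real.exp (-batchLoss ℓ t θ)))
      ENNReal.ofReal_ne_top ?_
    calc _ ≤ ∫⁻ _, ENNReal.ofReal (Real.exp (-batchLoss ℓ t θ))
          ∂(multivariateGaussian θ₀ Ω₀⁻¹) :=
          lintegral_mono fun θ' => ENNReal.ofReal_le_ofReal
            (Real.exp_le_exp.2 (neg_le_neg (hmin θ')))
      _ = _ := by simp
  have hne_zero : unnormalizedPosterior ℓ θ₀ Ω₀ t Set.univ ≠ 0 := by
    rw [htotal, Ne, lintegral_eq_zero_iff hmeas]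
    intro h0
    have hfalse : ∀ᵐ _θ' ∂(multivariateGaussian θ₀ Ω₀⁻¹), False := by
      filter_upwards [h0] with θ' hθ'
      have : (0 : ENNReal) < ENNReal.ofReal (Real.exp (-batchLoss ℓ t θ')) :=
        ENNReal.ofReal_pos.2 (Real.exp_pos _)
      exact this.ne' hθ'
    exact hfalse.exists.elim fun _ h => h
  refine ⟨?_⟩
  rw [fullPosterior, Measure.smul_apply, smul_eq_mul]
  exact ENNReal.inv_mul_cancel hne_zero hne_top

/-! ### The total variation bound along one path. -/

namespace PathBounds

variable {p : ℕ} {ℓ : ℕ → Param p → ℝ} {θstar θ₀ : Param p} {Ω₀ : Mat p} {t₀ : ℕ}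
  {r x K₂ K₃ K₄ K₅ L₁ L₂ L₃ lam C : ℝ}

lemma le_quad_fisher (h : PathBounds ℓ θstar θ₀ Ω₀ t₀ r x K₂ K₃ K₄ K₅ L₁ L₂ L₃ lam C) {t : ℕ}
    (ht : t₀ ≤ t) (v : Param p) : K₂ * t * ‖v‖ ^ 2 ≤ quad (fisher ℓ t θstar) v := by
  have := (h.info t ht (fun _ => θstar) fun _ _ => h.star_mem).quad_le v
  rwa [quad_smul_one] at this

lemma fisher_posDef (h : PathBounds ℓ θstar θ₀ Ω₀ t₀ r x K₂ K₃ K₄ K₅ L₁ L₂ L₃ lam C) {t : ℕ}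
    (ht : t₀ ≤ t) : (fisher ℓ t θstar).PosDef := by
  have h8 := h.eight_le
  have ht0 : (0 : ℝ) < t := by exact_mod_cast (by omega : 0 < t)
  refine posDef_of_le_quad ?_ (mul_pos h.K₂_pos ht0) (h.le_quad_fisher ht)
  rw [Matrix.IsHermitian, fisher, Matrix.conjTranspose_sum]
  exact Finset.sum_congr rfl fun s hs =>
    hess_isHermitian (h.diff s (Finset.mem_Icc.1 hs).1) (h.diff_fderiv s (Finset.mem_Icc.1 hs).1) _

/-- Online Bernstein–von Mises bound along one path. -/
theorem tvDist_bvmGaussian_onePassPosterior_le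
    (h : PathBounds ℓ θstar θ₀ Ω₀ t₀ r x K₂ K₃ K₄ K₅ L₁ L₂ L₃ lam C) {κ B : ℝ} (hκ : 0 ≤ κ)
    (hB : 0 < B) {t : ℕ} (ht : 3 * (t₀ : ℝ) < t) (hBt : (t₀ : ℝ) ≤ B * growth p x t)
    (hmem : ∀ s, t₀ ≤ s → algθ ℓ θ₀ Ω₀ t₀ s ∈ localSet θstar r)
    (hmle : ∀ s, t₀ ≤ s → mle ℓ s ∈ localSet θstar r)
    (hrate : ∀ s, t₀ ≤ s → ‖algθ ℓ θ₀ Ω₀ t₀ s - θstar‖ ^ 2 ≤ κ * (growth p x s / s)) :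
    tvDist (bvmGaussian ℓ θstar t) (onePassPosterior ℓ θ₀ Ω₀ t₀ t)
      ≤ 4 * √(((lam + 4 * L₃ * √κ) / K₂) ^ 2 + 3 / 2 * ((3 * C * L₂ * √B + 2 * lam * r
        + 2 * L₃ * (3 * κ + 2 * C ^ 2)) ^ 2 / K₂)) * epsApp t₀ p x t := by
  have h8 := h.eight_le
  have hK₂ := h.K₂_pos
  have hL₃ := h.L₃_pos
  have hlam := h.lam_pos
  have ht0 : (0 : ℝ) < t₀ := by exact_mod_cast (by omega : 0 < t₀)
  have htt : t₀ ≤ t := by exact_mod_cast (by linarith : (t₀ : ℝ) ≤ t)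
  have htpos : (0 : ℝ) < t := by linarith
  have hlog : 1 ≤ Real.log ((t : ℝ) / t₀) :=
    one_le_log_of_three_le (by rw [le_div_iff₀ ht0]; exact ht.le)
  have hG := one_le_growth h.dim h.x_pos (t := t) (by omega)
  have hΩlow := h.le_quad_algΩ htt (hmem t₀ le_rfl) fun s hs _ => hmem s hs
  have hΩ := h.algΩ_posDef htt (hmem t₀ le_rfl) fun s hs _ => hmem s hs
  have hspec := h.specNorm_fisher_sub_algΩ_le hκ htt hmem hrate
  have hmean := h.norm_mulVec_algΩ_sub_mle_le hκ hB ht hBt hmem hmle hrate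
  set Kb := lam + 4 * L₃ * √κ with hKb
  set Kd := 3 * C * L₂ * √B + 2 * lam * r + 2 * L₃ * (3 * κ + 2 * C ^ 2) with hKd
  set Lg := Real.log ((t : ℝ) / t₀) with hLg
  set G := growth p x t with hGdef
  set d := mle ℓ t - algθ ℓ θ₀ Ω₀ t₀ t with hd
  have hKb0 : 0 < Kb := by positivity
  set δ := Kb * (√G * √t) / (K₂ * t) with hδ
  have hδ0 : 0 ≤ δ := by positivity
  have hrel : ∀ v, |quad (fisher ℓ t θstar) v - quad (algΩ ℓ θ₀ Ω₀ t₀ t) v|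
      ≤ δ * quad (algΩ ℓ θ₀ Ω₀ t₀ t) v := fun v => by
    rw [← quad_sub_left]
    calc _ ≤ specNorm (fisher ℓ t θstar - algΩ ℓ θ₀ Ω₀ t₀ t) * ‖v‖ ^ 2 := abs_quad_le _ _
      _ ≤ Kb * (√G * √t) * ‖v‖ ^ 2 := mul_le_mul_of_nonneg_right hspec (sq_nonneg _)
      _ = δ * (K₂ * t * ‖v‖ ^ 2) := by rw [hδ]; field_simp
      _ ≤ _ := mul_le_mul_of_nonneg_left (hΩlow v) hδ0
  -- Here `p δ²` is of order `p G / t`; the second factor `G` of the rate comes from `p ≤ G`, and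
  -- `log (t / t₀) ≥ 1` does the rest.
  have hδsq : p * δ ^ 2 ≤ (Kb / K₂) ^ 2 * (Lg ^ 2 * G ^ 2 / t) := by
    have e : δ ^ 2 = (Kb / K₂) ^ 2 * (G / t) := by
      rw [hδ, div_pow, mul_pow, mul_pow, Real.sq_sqrt (by linarith), Real.sq_sqrt htpos.le]
      field_simp
    rw [e]
    have hpG : (p : ℝ) ≤ G := dim_le_growth h.x_pos (by omega)
    have hLg2 : 1 ≤ Lg ^ 2 := one_le_pow₀ hlog
    calc p * ((Kb / K₂) ^ 2 * (G / t)) = (Kb / K₂) ^ 2 * (1 * (p * G) / t) := by ring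
      _ ≤ (Kb / K₂) ^ 2 * (Lg ^ 2 * (G * G) / t) := by gcongr
      _ = _ := by ring
  have hquad : quad (algΩ ℓ θ₀ Ω₀ t₀ t) d ≤ Kd ^ 2 / K₂ * (Lg ^ 2 * G ^ 2 / t) := by
    have e : d = -(algθ ℓ θ₀ Ω₀ t₀ t - mle ℓ t) := by rw [hd]; abel
    rw [e, quad_neg_right]
    refine (quad_le_norm_mulVec_sq_div (mul_pos hK₂ htpos) hΩlow _).trans ?_
    calc _ ≤ (Kd * (Lg * G)) ^ 2 / (K₂ * t) := by gcongr
      _ = _ := by field_simp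
  have htv := tvDist_multivariateGaussian_le h.dim (algθ ℓ θ₀ Ω₀ t₀ t) (mle ℓ t) _ _ hΩ
    (h.fisher_posDef htt) hrel
  -- The comparison takes `Ω_t` as reference, since both the relative precision error and the mean
  -- shift are measured in its norm.
  rw [tvDist_comm]
  refine htv.trans ?_
  have heps : epsApp t₀ p x t = √(Lg ^ 2 * G ^ 2 / t) := rfl
  rw [heps, mul_assoc, ← Real.sqrt_mul (by positivity)]
  refine mul_le_mul_of_nonneg_left (Real.sqrt_le_sqrt ?_) (by norm_num)
  linarith

end PathBounds

/-! ### Choice of the constants. -/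

section Constants

/-- The constant in the energy bound. -/
noncomputable def energyConst (C K₀ K₃ K₄ K₅ L₂ : ℝ) : ℝ :=
  2 * C ^ 2 * (K₀ + L₂) + 2 * K₃ + K₄ + K₅

/-- The constant in the convergence rate of the iterates. -/
noncomputable def rateConst (C K₀ K₂ K₃ K₄ K₅ L₂ : ℝ) : ℝ :=
  2 * energyConst C K₀ K₃ K₄ K₅ L₂ / K₂

/-- The size of `(p log t₀ + x) / t₀` that makes the localization argument work. -/
noncomputable def warmRatio (C K₀ K₂ K₃ K₄ K₅ L₁ L₂ r : ℝ) : ℝ :=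
  min (min 1 (r ^ 2 / (2 * C ^ 2))) (min (r ^ 2 / rateConst C K₀ K₂ K₃ K₄ K₅ L₂)
    ((energyConst C K₀ K₃ K₄ K₅ L₂ / (12 * (L₁ * L₂) * (rateConst C K₀ K₂ K₃ K₄ K₅ L₂
      * √(rateConst C K₀ K₂ K₃ K₄ K₅ L₂)) + 1)) ^ 2))

/-- The warm-start constant. -/
noncomputable def warmConst (C K₀ K₂ K₃ K₄ K₅ L₁ L₂ r : ℝ) : ℝ :=
  25 / warmRatio C K₀ K₂ K₃ K₄ K₅ L₁ L₂ r ^ 2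

/-- The constant of the total variation bound. -/
noncomputable def approxConst (C K₀ K₂ K₃ K₄ K₅ L₂ L₃ lam r B : ℝ) : ℝ :=
  4 * √(((lam + 4 * L₃ * √(rateConst C K₀ K₂ K₃ K₄ K₅ L₂)) / K₂) ^ 2
    + 3 / 2 * ((3 * C * L₂ * √B + 2 * lam * r
      + 2 * L₃ * (3 * rateConst C K₀ K₂ K₃ K₄ K₅ L₂ + 2 * C ^ 2)) ^ 2 / K₂))

variable {C K₀ K₂ K₃ K₄ K₅ L₁ L₂ L₃ lam r B : ℝ}

lemma energyConst_pos (hC : 0 < C) (hK₀ : 0 < K₀) (hK₃ : 0 < K₃) (hK₄ : 0 < K₄) (hK₅ : 0 ≤ K₅)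
    (hL₂ : 0 < L₂) : 0 < energyConst C K₀ K₃ K₄ K₅ L₂ := by
  unfold energyConst; positivity

lemma rateConst_pos (hC : 0 < C) (hK₀ : 0 < K₀) (hK₂ : 0 < K₂) (hK₃ : 0 < K₃) (hK₄ : 0 < K₄)
    (hK₅ : 0 ≤ K₅) (hL₂ : 0 < L₂) : 0 < rateConst C K₀ K₂ K₃ K₄ K₅ L₂ := by
  have := energyConst_pos hC hK₀ hK₃ hK₄ hK₅ hL₂
  unfold rateConst; positivity

lemma warmRatio_pos (hC : 0 < C) (hK₀ : 0 < K₀) (hK₂ : 0 < K₂) (hK₃ : 0 < K₃) (hK₄ : 0 < K₄)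
    (hK₅ : 0 ≤ K₅) (hL₁ : 0 ≤ L₁) (hL₂ : 0 < L₂) (hr : 0 < r) :
    0 < warmRatio C K₀ K₂ K₃ K₄ K₅ L₁ L₂ r := by
  have h1 := energyConst_pos hC hK₀ hK₃ hK₄ hK₅ hL₂
  have h2 := rateConst_pos hC hK₀ hK₂ hK₃ hK₄ hK₅ hL₂
  unfold warmRatio
  refine lt_min (lt_min one_pos (by positivity)) (lt_min (by positivity) (by positivity))

/-- The four entries of the minimum answer the four smallness requirements: the range of
`growth_le_of_warm_start`, the batch estimators in `Θ_r`, the iterates in `Θ_r`, and the cubic term.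
-/
lemma warmRatio_spec (hC : 0 < C) (hK₀ : 0 < K₀) (hK₂ : 0 < K₂) (hK₃ : 0 < K₃) (hK₄ : 0 < K₄)
    (hK₅ : 0 ≤ K₅) (hL₁ : 0 ≤ L₁) (hL₂ : 0 < L₂) :
    warmRatio C K₀ K₂ K₃ K₄ K₅ L₁ L₂ r ≤ 1 ∧
    2 * C ^ 2 * warmRatio C K₀ K₂ K₃ K₄ K₅ L₁ L₂ r ≤ r ^ 2 ∧
    rateConst C K₀ K₂ K₃ K₄ K₅ L₂ * warmRatio C K₀ K₂ K₃ K₄ K₅ L₁ L₂ r ≤ r ^ 2 ∧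
    12 * (L₁ * L₂) * (rateConst C K₀ K₂ K₃ K₄ K₅ L₂ * √(rateConst C K₀ K₂ K₃ K₄ K₅ L₂)
      * √(warmRatio C K₀ K₂ K₃ K₄ K₅ L₁ L₂ r)) ≤ energyConst C K₀ K₃ K₄ K₅ L₂ := by
  have h1 := energyConst_pos hC hK₀ hK₃ hK₄ hK₅ hL₂
  have h2 := rateConst_pos hC hK₀ hK₂ hK₃ hK₄ hK₅ hL₂
  have hη1 : warmRatio C K₀ K₂ K₃ K₄ K₅ L₁ L₂ r ≤ 1 := (min_le_left _ _).trans (min_le_left _ _)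
  have hη2 : warmRatio C K₀ K₂ K₃ K₄ K₅ L₁ L₂ r ≤ r ^ 2 / (2 * C ^ 2) :=
    (min_le_left _ _).trans (min_le_right _ _)
  have hη3 : warmRatio C K₀ K₂ K₃ K₄ K₅ L₁ L₂ r ≤ r ^ 2 / rateConst C K₀ K₂ K₃ K₄ K₅ L₂ :=
    (min_le_right _ _).trans (min_le_left _ _)
  have hη4 : warmRatio C K₀ K₂ K₃ K₄ K₅ L₁ L₂ r ≤ _ := (min_le_right _ _).trans (min_le_right _ _)
  set κ := rateConst C K₀ K₂ K₃ K₄ K₅ L₂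
  set Ka := energyConst C K₀ K₃ K₄ K₅ L₂
  refine ⟨hη1, ?_, ?_, ?_⟩
  · rw [le_div_iff₀ (by positivity)] at hη2; linarith
  · rw [le_div_iff₀ h2] at hη3; linarith
  · have hden : 0 < 12 * (L₁ * L₂) * (κ * √κ) + 1 := by positivity
    have hs := Real.sqrt_le_sqrt hη4
    rw [Real.sqrt_sq (by positivity), le_div_iff₀ hden] at hs
    have := Real.sqrt_nonneg (warmRatio C K₀ K₂ K₃ K₄ K₅ L₁ L₂ r)
    linarith

lemma approxConst_pos (hK₂ : 0 < K₂) (hL₃ : 0 < L₃) (hlam : 0 < lam) :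
    0 < approxConst C K₀ K₂ K₃ K₄ K₅ L₂ L₃ lam r B := by
  unfold approxConst
  have : 0 < (lam + 4 * L₃ * √(rateConst C K₀ K₂ K₃ K₄ K₅ L₂)) / K₂ := by positivity
  refine mul_pos four_pos (Real.sqrt_pos.2 (add_pos_of_pos_of_nonneg (by positivity) ?_))
  positivity

end Constants

/-- The iterate at `t` itself may lie outside `Θ_r`: the gradient bound includes the exit time, so
it is available before `θ_t` has been localized. -/
lemma le_exitTime {p : ℕ} {ℓ : ℕ → Param p → ℝ} {θ₀ : Param p} {Ω₀ : Mat p} {t₀ : ℕ}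
    {θstar : Param p} {r : ℝ} {t : ℕ}
    (hmem : ∀ s, t₀ < s → s < t → algθ ℓ θ₀ Ω₀ t₀ s ∈ localSet θstar r) :
    (t : ℕ∞) ≤ exitTime ℓ θ₀ Ω₀ t₀ θstar r := by
  refine le_sInf ?_
  rintro _ ⟨s, rfl, hs, hout⟩
  by_contra hlt
  exact hout (hmem s hs (by exact_mod_cast not_le.1 hlt))

lemma isArgmin_argmin {p : ℕ} {f : Param p → ℝ} (h : ∃ θ, IsArgmin f θ) : IsArgmin f (argmin f) :=
  Classical.epsilon_spec h

end OnlineBvM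

/-! ### From the model assumptions to the theorem. -/

open OnlineBvM in
/-- The model assumptions give the path-wise bounds on the intersection of the events. -/
lemma OnlineBvM.pathBounds_of_assumptions {C K₀ K₁ K₂ K₃ K₄ K₅ K₆ L₁ L₂ L₃ lamHigh r : ℝ}
    {M : ℝ} (hC : 0 < C) (hK₂ : 0 < K₂) (hK₃ : 0 < K₃) (hK₄ : 0 < K₄)
    (hK₅ : 0 ≤ K₅) (hL₁ : 0 ≤ L₁) (hL₂ : 0 < L₂) (hL₃ : 0 < L₃) (hlam : 0 < lamHigh) (hr : 0 < r)
    {p : ℕ} (hp : 1 ≤ p) {x : ℝ} (hx : 0 < x) {𝒴 : Type*} [MeasurableSpace 𝒴] {m : Model p 𝒴}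
    {S : Type*} [MeasurableSpace S] {P : Measure S} {Y : ℕ → S → 𝒴}
    {θstar θ₀ : Param p} {Ω₀ : Mat p} {lamLow : ℝ} {t₀ : ℕ} (ht₀ : 8 ≤ t₀) {E₁ E₂ E₃ E₄ : Set S}
    (h0 : A0 m P Y θstar Ω₀ lamLow lamHigh K₀)
    (h1 : A1 P (m.lossAt Y) θstar r x K₁ K₂ E₁) (h2 : A2 (m.lossAt Y) θstar r L₁ L₂)
    (h3 : A3 (m.lossAt Y) θstar r L₃ K₆)
    (h4 : A4 P (m.lossAt Y) θstar θ₀ Ω₀ t₀ r x K₁ K₃ K₄ K₅ E₂ E₃)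
    (h5 : A5 P (m.lossAt Y) θstar θ₀ Ω₀ t₀ x M C E₄) {ω : S} (hω : ω ∈ E₁ ∩ E₂ ∩ E₃ ∩ E₄) :
    PathBounds (m.lossAt Y ω) θstar θ₀ Ω₀ t₀ r x K₂ K₃ K₄ K₅ L₁ L₂ L₃ lamHigh C where
  dim := hp
  eight_le := ht₀
  x_pos := hx
  r_pos := hr
  K₂_pos := hK₂
  K₃_pos := hK₃
  K₄_pos := hK₄
  K₅_nonneg := hK₅
  L₁_nonneg := hL₁
  L₂_pos := hL₂
  L₃_pos := hL₃
  lam_pos := hlam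
  C_pos := hC
  prior_posDef := by
    have := (Matrix.PosDef.one (n := Fin p) (R := ℝ)).smul h0.lamLow_pos
    simpa using this.add_posSemidef h0.lower
  prior_le := h0.upper
  diff := h0.differentiable ω
  diff_fderiv := h0.differentiable_fderiv ω
  info := fun t ht θbar hθ => h1.lower ω hω.1.1.1 t (by omega)
    (h4.le_t₀.trans (by exact_mod_cast ht)) θbar hθ
  taylor := h2.taylor ω
  bounded := h2.bounded ω
  lipschitz := h3.lipschitz ω
  regret := h4.regret ω hω.1.1.2
  grad := fun t ht hmem => h4.grad ω hω.1.2 t ht (le_exitTime hmem)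
  map_min := fun t ht => isArgmin_argmin (h5.exists_map ω hω.2 t ht)
  mle_min := fun t ht => isArgmin_argmin (h5.exists_mle ω hω.2 t ht)
  map_rate := fun t ht => (le_max_left _ _).trans (h5.rate ω hω.2 t ht)
  mle_rate := fun t ht => (le_max_right _ _).trans (h5.rate ω hω.2 t ht)

/-- `C` and `K₀` are the universal constants in the assumptions. The warm-start constant `M`, the
time threshold `M₂` and the constant `K` of the bounds depend only on the displayed arguments. -/
theorem theorem2 (C K₀ : ℝ) (hC : 0 < C) (hK₀ : 0 < K₀) :
    -- `M K₁ K₂ K₃ K₄ K₅ L₁ L₂ r`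
    ∃ (M : ℝ → ℝ → ℝ → ℝ → ℝ → ℝ → ℝ → ℝ → ℝ)
      -- `M₂ K₆ L₃ lamHigh`
      (M₂ : ℝ → ℝ → ℝ → ℝ)
      -- `K K₁ K₂ K₃ K₄ K₅ L₁ L₂ L₃ lamHigh r B`
      (K : ℝ → ℝ → ℝ → ℝ → ℝ → ℝ → ℝ → ℝ → ℝ → ℝ → ℝ → ℝ),
    ∀ K₁ K₂ K₃ K₄ K₅ K₆ L₁ L₂ L₃ lamHigh r B : ℝ,
      0 < K₁ → 0 < K₂ → 0 < K₃ → 0 < K₄ → 0 ≤ K₅ → 0 < K₆ → 0 ≤ L₁ → 0 < L₂ → 0 < L₃ →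
      0 < lamHigh → 0 < r → 0 < B →
      0 < M K₁ K₂ K₃ K₄ K₅ L₁ L₂ r ∧
      0 < M₂ K₆ L₃ lamHigh ∧
      0 < K K₁ K₂ K₃ K₄ K₅ L₁ L₂ L₃ lamHigh r B ∧
      ∀ (p : ℕ) (_ : 1 ≤ p) (x : ℝ) (_ : 0 < x)
        (𝒴 : Type*) [MeasurableSpace 𝒴] (m : OnlineBvM.Model p 𝒴)
        (S : Type*) [MeasurableSpace S] (P : MeasureTheory.Measure S)
        [MeasureTheory.IsProbabilityMeasure P] (Y : ℕ → S → 𝒴)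
        (θstar θ₀ : OnlineBvM.Param p) (Ω₀ : OnlineBvM.Mat p) (lamLow : ℝ) (t₀ : ℕ)
        (E₁ E₂ E₃ E₄ : Set S),
        m.CorrectlySpecified P Y θstar →
        OnlineBvM.A0 m P Y θstar Ω₀ lamLow lamHigh K₀ →
        OnlineBvM.A1 P (m.lossAt Y) θstar r x K₁ K₂ E₁ →
        OnlineBvM.A2 (m.lossAt Y) θstar r L₁ L₂ →
        OnlineBvM.A3 (m.lossAt Y) θstar r L₃ K₆ →
        OnlineBvM.A4 P (m.lossAt Y) θstar θ₀ Ω₀ t₀ r x K₁ K₃ K₄ K₅ E₂ E₃ →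
        OnlineBvM.A5 P (m.lossAt Y) θstar θ₀ Ω₀ t₀ x (M K₁ K₂ K₃ K₄ K₅ L₁ L₂ r) C E₄ →
        ∀ ω ∈ E₁ ∩ E₂ ∩ E₃ ∩ E₄, ∀ t : ℕ,
          M₂ K₆ L₃ lamHigh * t₀ < t →
          (t₀ : ℝ) ≤ B * (p * Real.log t + x) →
          -- the two normal distributions are non-degenerate and the full posterior is proper
          (OnlineBvM.algΩ (m.lossAt Y ω) θ₀ Ω₀ t₀ t).PosDef ∧
          (OnlineBvM.fisher (m.lossAt Y ω) t θstar).PosDef ∧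
          MeasureTheory.IsProbabilityMeasure
            (OnlineBvM.fullPosterior (m.lossAt Y ω) θ₀ Ω₀ t) ∧
          OnlineBvM.tvDist (OnlineBvM.bvmGaussian (m.lossAt Y ω) θstar t)
              (OnlineBvM.onePassPosterior (m.lossAt Y ω) θ₀ Ω₀ t₀ t)
            ≤ K K₁ K₂ K₃ K₄ K₅ L₁ L₂ L₃ lamHigh r B * OnlineBvM.epsApp t₀ p x t ∧
          OnlineBvM.tvDist (OnlineBvM.onePassPosterior (m.lossAt Y ω) θ₀ Ω₀ t₀ t)
              (OnlineBvM.fullPosterior (m.lossAt Y ω) θ₀ Ω₀ t)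
            ≤ K K₁ K₂ K₃ K₄ K₅ L₁ L₂ L₃ lamHigh r B * OnlineBvM.epsApp t₀ p x t
              + OnlineBvM.tvDist (OnlineBvM.bvmGaussian (m.lossAt Y ω) θstar t)
                (OnlineBvM.fullPosterior (m.lossAt Y ω) θ₀ Ω₀ t) := by
  -- `M₂ = 3` ensures `log (t / t₀) ≥ 1`, so that terms without this logarithm are absorbed in the
  -- rate.
  refine ⟨fun _ K₂ K₃ K₄ K₅ L₁ L₂ r => OnlineBvM.warmConst C K₀ K₂ K₃ K₄ K₅ L₁ L₂ r,
    fun _ _ _ => 3,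
    fun _ K₂ K₃ K₄ K₅ _ L₂ L₃ lam r B => OnlineBvM.approxConst C K₀ K₂ K₃ K₄ K₅ L₂ L₃ lam r B,
    ?_⟩
  intro K₁ K₂ K₃ K₄ K₅ K₆ L₁ L₂ L₃ lamHigh r B _ hK₂ hK₃ hK₄ hK₅ _ hL₁ hL₂ hL₃ hlam hr hB
  have hη := OnlineBvM.warmRatio_pos hC hK₀ hK₂ hK₃ hK₄ hK₅ hL₁ hL₂ hr
  obtain ⟨hη1, hηC, hηκ, hηcube⟩ :=
    OnlineBvM.warmRatio_spec (r := r) hC hK₀ hK₂ hK₃ hK₄ hK₅ hL₁ hL₂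
  have hM : 0 < OnlineBvM.warmConst C K₀ K₂ K₃ K₄ K₅ L₁ L₂ r := by
    unfold OnlineBvM.warmConst; positivity
  refine ⟨hM, three_pos, OnlineBvM.approxConst_pos hK₂ hL₃ hlam, ?_⟩
  intro p hp x hx 𝒴 _ m S _ P _ Y θstar θ₀ Ω₀ lamLow t₀ E₁ E₂ E₃ E₄ _ h0 h1 h2 h3 h4 h5 ω hω t
    ht hBt
  have hκ := (OnlineBvM.rateConst_pos hC hK₀ hK₂ hK₃ hK₄ hK₅ hL₂).le
  have hwarm : OnlineBvM.warmConst C K₀ K₂ K₃ K₄ K₅ L₁ L₂ r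
      * (p * Real.log (max (p : ℝ) 3) + x) ≤ t₀ := by
    have := Int.ceil_le.1 h5.le_t₀
    exact_mod_cast this
  obtain ⟨h8, hgrowth⟩ := OnlineBvM.growth_le_of_warm_start hp hx hη hη1 rfl hwarm
  have hpath := OnlineBvM.pathBounds_of_assumptions hC hK₂ hK₃ hK₄ hK₅ hL₁ hL₂ hL₃ hlam hr hp hx
    h8 h0 h1 h2 h3 h4 h5 hω
  -- Replacing `lamHigh` by its universal bound `K₀` keeps the localization constants, and hence
  -- `M`, free of `lamHigh`.
  have hKa : 2 * C ^ 2 * (lamHigh + L₂) + 2 * K₃ + K₄ + K₅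
      ≤ OnlineBvM.energyConst C K₀ K₃ K₄ K₅ L₂ := by
    have := h0.lamHigh_le
    unfold OnlineBvM.energyConst
    gcongr
  have hloc := fun s (hs : t₀ ≤ s) => hpath.localization hKa hgrowth hηC hηκ hηcube hs
  have hmle := fun s (hs : t₀ ≤ s) =>
    hpath.mem_localSet_of_rate hgrowth hηC hs (hpath.mle_rate s hs)
  have htt : t₀ ≤ t := by
    have : (0 : ℝ) ≤ t₀ := t₀.cast_nonneg
    exact_mod_cast (by linarith : (t₀ : ℝ) ≤ t)
  have hpost : MeasureTheory.IsProbabilityMeasure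
      (OnlineBvM.fullPosterior (m.lossAt Y ω) θ₀ Ω₀ t) :=
    OnlineBvM.isProbabilityMeasure_fullPosterior θ₀ Ω₀ hpath.diff (hpath.mle_min t htt)
  have htv := hpath.tvDist_bvmGaussian_onePassPosterior_le hκ hB ht hBt
    (fun s hs => (hloc s hs).1) hmle fun s hs => (hloc s hs).2
  refine ⟨hpath.algΩ_posDef htt (hloc t₀ le_rfl).1 fun s hs _ => (hloc s hs).1,
    hpath.fisher_posDef htt, hpost, htv, ?_⟩
  have hgauss₁ : MeasureTheory.IsProbabilityMeasure
      (OnlineBvM.onePassPosterior (m.lossAt Y ω) θ₀ Ω₀ t₀ t) := by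
    unfold OnlineBvM.onePassPosterior; infer_instance
  have hgauss₂ : MeasureTheory.IsProbabilityMeasure
      (OnlineBvM.bvmGaussian (m.lossAt Y ω) θstar t) := by
    unfold OnlineBvM.bvmGaussian; infer_instance
  refine (OnlineBvM.tvDist_triangle _ (OnlineBvM.bvmGaussian (m.lossAt Y ω) θstar t) _).trans ?_
  rw [OnlineBvM.tvDist_comm (OnlineBvM.onePassPosterior (m.lossAt Y ω) θ₀ Ω₀ t₀ t)]
  exact add_le_add_left htv _
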